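/- Let $\log_2=\log\log$. For real $\sigma,t,y$ put $\zeta(\sigma+\mathrm{i}t;y):=\prod_{p\leqslant y}(1-p^{-\sigma-\mathrm{i}t})^{-1}$ ($p$ running over primes), and for $T>0$ and real $\tau$ let $$\Phi_T(\tau;y):=\frac1T\,\mathrm{meas}\big\{t\in[T,2T]:\log|\zeta(\sigma+\mathrm{i}t;y)|>\tau\big\}.$$ Let $\sigma\in(\tfrac12,1)$ be fixed, and put $I_0(t):=\int_0^1\exp(t\cos(2\pi\theta))\,\mathrm{d}\theta$ and $C_0:=\int_0^\infty t^{-1/\sigma-1}\log I_0(t)\,\mathrm{d}t$. There exist a sequence $\{\mathfrak a_n\}_{n\geqslant0}$ of real polynomials with $\deg\mathfrak a_n\leqslant n$ and $$\mathfrak a_0=\bigg(\frac{\sigma^{2\sigma}}{C_0^{\sigma}(1-\sigma)^{2\sigma-1}}\bigg)^{1/(1-\sigma)},$$ and a constant $c(\sigma)>0$, all depending only on $\sigma$, such that for every integer $N\geqslant1$ and every sufficiently large constant $c_0$ (in terms of $\sigma$ and $N$) the following holds. Put $$\varepsilon_0=\varepsilon_0(\tau,y):=c_0\bigg\{\bigg(\frac{\log_2\tau}{\log\tau}\bigg)^{N+1}+\bigg(\frac{(\tau\log\tau)^{1/(1-\sigma)}}{y}\bigg)^{\sigma-1/2}\bigg\}.$$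 Then $$\Phi_T\big((1+\varepsilon_0)\tau;y\big)\leqslant\exp\bigg(-(\tau\log^{\sigma}\tau)^{\frac1{1-\sigma}}\bigg\{\sum_{n=0}^{N}\frac{\mathfrak a_n(\log_2\tau)}{(\log\tau)^n}+O(\varepsilon_0)\bigg\}\bigg)\leqslant\Phi_T\big((1-\varepsilon_0)\tau;y\big)$$ uniformly for all $T\geqslant T_0$, $\log T\leqslant y\leqslant(\log T)^2$ and $$\tau_0\leqslant\tau\leqslant\frac{c(\sigma)}{\log_2T}\bigg(\frac{\log T}{y^{1-\sigma}}\bigg)^{\frac{1-\sigma}{\sigma}},$$ where $T_0$ and $\tau_0$ depend only on $\sigma$ and $N$, and the constant implied by $O(\varepsilon_0)$ is absolute. -/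

import Mathlib

open MeasureTheory

noncomputable section

/-- The short Euler product `ζ(s; y) = ∏_{p ≤ y} (1 - p^{-s})⁻¹`. -/
def zetaShort (s : ℂ) (y : ℝ) : ℂ :=
  ∏ p ∈ (Finset.Icc 1 ⌊y⌋₊).filter Nat.Prime, (1 - (p : ℂ) ^ (-s))⁻¹

/-- The distribution function
`Φ_T(τ; y) = T⁻¹ meas {t ∈ [T, 2T] : log |ζ(σ + it; y)| > τ}`. -/
def PhiShort (σ T τ y : ℝ) : ℝ :=
  1 / T * volume.real
    {t : ℝ | t ∈ Set.Icc T (2 * T) ∧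
      τ < Real.log ‖zetaShort ((σ : ℂ) + (t : ℂ) * Complex.I) y‖}

/-- The modified Bessel function `I₀(t) = ∫₀¹ exp(t cos 2πθ) dθ`. -/
def besselIZero (t : ℝ) : ℝ :=
  ∫ θ in (0 : ℝ)..1, Real.exp (t * Real.cos (2 * Real.pi * θ))

/-- The constant `C₀ = ∫₀^∞ t^{-1/σ - 1} log I₀(t) dt`. -/
def besselConst (σ : ℝ) : ℝ :=
  ∫ t in Set.Ioi (0 : ℝ), Real.log (besselIZero t) / t ^ (1 / σ + 1)

/-- The leading coefficient
`(σ^{2σ} / (C₀^σ (1 - σ)^{2σ - 1}))^{1/(1 - σ)}`. -/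
def leadingConst (σ : ℝ) : ℝ :=
  (σ ^ (2 * σ) / (besselConst σ ^ σ * (1 - σ) ^ (2 * σ - 1))) ^ (1 / (1 - σ))

/-- `ε₀(τ, y) = c₀ {(log₂ τ / log τ)^{N+1} + ((τ log τ)^{1/(1-σ)} / y)^{σ - 1/2}}`,
where `log₂ = log log`. -/
def epsZero (σ : ℝ) (N : ℕ) (c₀ τ y : ℝ) : ℝ :=
  c₀ * ((Real.log (Real.log τ) / Real.log τ) ^ (N + 1)
    + ((τ * Real.log τ) ^ (1 / (1 - σ)) / y) ^ (σ - 1 / 2))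

end

/-!
# Large values of the short Euler product `ζ(σ + it; y)`

The distribution function is read off from the moments of `|ζ(σ + it; y)|` over `[T, 2T]`, and these
are compared with the moments of the random model in which the `p ^ (-it)` are independent and
uniform on the unit circle.

*Moments.* The power `ζ(s; y) ^ (k / 2)` is a Dirichlet series with nonnegative coefficients. In the
admissible range of `k` almost all of its mass sits, by Rankin's trick, on integers up to a small
power of `T`, so its mean square over `[T, 2T]` is within a factor `2` of the diagonal term
`exp (cumulant σ y k)`, the moment of the random model (`exists_moment_mem_Icc`). A bounded factor is
harmless: only logarithms of moments are used, with an error that is at least a constant.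

*The cumulant generating function.* By Parseval's identity an Euler factor contributes the
logarithm of `∑ⱼ cⱼ² p ^ (-2σj)`, which is close to `log I₀(k p ^ (-σ))`. For `k = x ^ σ` the sum over
the primes is expanded in powers of `1 / log x`, with the moments
`∫ log I₀(v ^ (-σ)) (-log v) ^ n dv` as coefficients and a loss `(x / y) ^ (2σ - 1)` from the primes
beyond `y` (`exists_abs_cumulant_sub_le`). This needs the prime number theorem with an error saving
every power of the logarithm (`exists_abs_theta_sub_le`). That follows from a bound `O(T ^ ε)` for
the logarithmic derivative of `(s - 1) ζ(s)` slightly to the left of `Re s = 1`, a consequence of the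
`3-4-1` inequality: a contour shift gives Gaussian means of `ψ(e ^ v) - e ^ v`, and the monotonicity
of `ψ` removes the smoothing.

*The Legendre transform.* With `k = (τ log τ) ^ (σ / (1 - σ)) e ^ (σ w)`, `z = 1 / log τ` and
`q = log log τ / log τ`, the exponent `k τ - cumulant σ y k` is the expected order of magnitude times
a function of `(z, q, w)` that is analytic near `z = q = 0`. That function has a nondegenerate
maximum in `w` at `(0, 0)`, so by the implicit function theorem the maximum is an analytic function
of `(z, q)`. On `q = z l` its Taylor expansion is `∑ 𝔞ₙ(l) zⁿ` with `deg 𝔞ₙ ≤ n`, and `𝔞₀` is computed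
at the origin (`exists_polynomials_legendreFun`).

*The two inequalities.* The upper bound for `Φ_T(τ; y)` is Chernoff's inequality. For the lower
bound the measure is tilted by `|ζ| ^ k` for the optimal `k`. Moments of slightly different orders
show that half of the tilted mass lies where `log |ζ|` is within `O(ε₀ τ)` of `τ`, since the maximum
is at most quadratic (`exp_le_PhiShort`). The error in the cumulants is of order `δ²` with
`ε₀ = c₀ δ`, because both the truncation order and the exponent `2σ - 1` are twice those in `δ`; this
makes windows of relative width `O(δ)` sufficient. If `δ` is not small, then `y` is comparable to
`(τ log τ) ^ (1 / (1 - σ))` and `log |ζ|` exceeds `(1 - ε₀) τ` for every `t` once `c₀` is large.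
-/


noncomputable section

/-! ### Growth of the zeta function near the line `Re s = 1` -/

lemma norm_natCast_cpow_sub_le {m : ℕ} (hm : 0 < m) {u : ℝ} (hu : u ∈ Set.Icc (m : ℝ) (m + 1))
    {s : ℂ} (hs : 0 ≤ s.re) :
    ‖((m : ℝ) : ℂ) ^ (-s) - (u : ℂ) ^ (-s)‖ ≤ ‖s‖ * (m : ℝ) ^ (-s.re - 1) := by
  have hm0 : (0 : ℝ) < m := by exact_mod_cast hm
  by_cases hs0 : s = 0
  · subst hs0; simp
  have h := (convex_Icc (m : ℝ) (m + 1)).norm_image_sub_le_of_norm_hasDerivWithin_le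
    (f := fun v : ℝ => (v : ℂ) ^ (-s)) (f' := fun v : ℝ => (-s) * (v : ℂ) ^ (-s - 1))
    (C := ‖s‖ * (m : ℝ) ^ (-s.re - 1)) (x := u) (y := m) ?_ ?_ hu ?_
  · refine h.trans ?_
    have : ‖(m : ℝ) - u‖ ≤ 1 := by
      rw [Real.norm_eq_abs, abs_le]; constructor <;> linarith [hu.1, hu.2]
    have h0 : 0 ≤ ‖s‖ * (m : ℝ) ^ (-s.re - 1) := by positivity
    nlinarith
  · intro v hv
    have hv0 : 0 < v := hm0.trans_le hv.1
    exact (hasDerivAt_ofReal_cpow_const hv0.ne' (neg_ne_zero.mpr hs0)).hasDerivWithinAt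
  · intro v hv
    have hv0 : 0 < v := hm0.trans_le hv.1
    rw [norm_mul, norm_neg, Complex.norm_cpow_eq_rpow_re_of_pos hv0]
    gcongr ‖s‖ * ?_
    simp only [Complex.sub_re, Complex.neg_re, Complex.one_re]
    exact Real.rpow_le_rpow_of_nonpos hm0 hv.1 (by linarith)
  · constructor <;> linarith

/-- The `n`-th term of the expansion of `(s - 1) ζ(s) - 1` as a series converging for `0 < Re s`. -/
def zetaTerm (n : ℕ) (s : ℂ) : ℂ :=
  (s - 1) * ((n + 1 : ℕ) : ℂ) ^ (-s) -
    (((n + 1 : ℕ) : ℂ) ^ (1 - s) - ((n + 2 : ℕ) : ℂ) ^ (1 - s))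

lemma differentiable_zetaTerm (n : ℕ) : Differentiable ℂ (zetaTerm n) := by
  have h (m : ℕ) : ((m + 1 : ℕ) : ℂ) ≠ 0 := by exact_mod_cast m.succ_ne_zero
  unfold zetaTerm
  refine ((differentiable_id.sub_const 1).mul ?_).sub (Differentiable.sub ?_ ?_)
  · exact Differentiable.const_cpow (by fun_prop) (Or.inl (h n))
  · exact Differentiable.const_cpow (by fun_prop) (Or.inl (h n))
  · exact Differentiable.const_cpow (by fun_prop) (Or.inl (h (n + 1)))

lemma norm_zetaTerm_le_mul {n : ℕ} {s : ℂ} {B : ℝ}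
    (hB : ∀ u ∈ Set.Icc ((n + 1 : ℕ) : ℝ) ((n + 1 : ℕ) + 1),
      ‖(((n + 1 : ℕ) : ℝ) : ℂ) ^ (-s) - (u : ℂ) ^ (-s)‖ ≤ B) :
    ‖zetaTerm n s‖ ≤ ‖s - 1‖ * B := by
  set m : ℕ := n + 1 with hm
  have hm0 : (0 : ℝ) < m := by positivity
  by_cases hs1 : s = 1
  · subst hs1; simp [zetaTerm]
  have h := (convex_Icc (m : ℝ) (m + 1)).norm_image_sub_le_of_norm_hasDerivWithin_le
    (f := fun v : ℝ => (s - 1) * ((v : ℂ) - m) * ((m : ℝ) : ℂ) ^ (-s) + (v : ℂ) ^ (1 - s))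
    (f' := fun v : ℝ => (s - 1) * (((m : ℝ) : ℂ) ^ (-s) - (v : ℂ) ^ (-s)))
    (C := ‖s - 1‖ * B) (x := m) (y := m + 1) ?_ ?_ (by simp) (by simp)
  · simp only [add_sub_cancel_left, norm_one, mul_one] at h
    refine le_trans (le_of_eq ?_) h
    unfold zetaTerm
    congr 1
    push_cast [hm]
    ring_nf
  · intro v hv
    have hv0 : 0 < v := hm0.trans_le hv.1
    have h1 : HasDerivAt (fun v : ℝ => (v : ℂ) ^ (1 - s)) ((1 - s) * (v : ℂ) ^ (1 - s - 1)) v :=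
      hasDerivAt_ofReal_cpow_const hv0.ne' (sub_ne_zero.mpr (Ne.symm hs1))
    have h2 : HasDerivAt (fun v : ℝ => (s - 1) * ((v : ℂ) - m) * ((m : ℝ) : ℂ) ^ (-s))
        ((s - 1) * 1 * ((m : ℝ) : ℂ) ^ (-s)) v :=
      ((Complex.ofRealCLM.hasDerivAt.sub_const _).const_mul _).mul_const _
    refine ((h2.add h1).congr_deriv ?_).hasDerivWithinAt
    rw [show 1 - s - 1 = -s by ring]; ring
  · intro v hv
    rw [norm_mul]
    gcongr
    exact hB v hv

lemma norm_zetaTerm_le {ε : ℝ} (hε : 0 < ε) (hε2 : ε < 1 / 2) {s : ℂ} (hs : 1 - ε < s.re) (n : ℕ) :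
    ‖zetaTerm n s‖ ≤ ‖s - 1‖ * (2 * ‖s‖ ^ (2 * ε) * ((n + 1 : ℕ) : ℝ) ^ (-1 - ε)) := by
  have hm : 0 < n + 1 := n.succ_pos
  have hm0 : (0 : ℝ) < (n + 1 : ℕ) := by exact_mod_cast hm
  have hm1 : (1 : ℝ) ≤ (n + 1 : ℕ) := by exact_mod_cast hm
  refine norm_zetaTerm_le_mul fun u hu => ?_
  have hu0 : 0 < u := hm0.trans_le hu.1
  set X := ‖(((n + 1 : ℕ) : ℝ) : ℂ) ^ (-s) - (u : ℂ) ^ (-s)‖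
  have h1 : X ≤ 2 * ((n + 1 : ℕ) : ℝ) ^ (-s.re) := by
    refine (norm_sub_le _ _).trans ?_
    rw [Complex.norm_cpow_eq_rpow_re_of_pos hm0, Complex.norm_cpow_eq_rpow_re_of_pos hu0,
      Complex.neg_re]
    have := Real.rpow_le_rpow_of_nonpos hm0 hu.1 (by linarith : -s.re ≤ 0)
    linarith
  have h2 : X ≤ ‖s‖ * ((n + 1 : ℕ) : ℝ) ^ (-s.re - 1) :=
    norm_natCast_cpow_sub_le hm hu (by linarith)
  -- interpolate between the two bounds with exponents `1 - 2ε` and `2ε`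
  have hX : 0 ≤ X := norm_nonneg _
  calc X = X ^ (1 - 2 * ε) * X ^ (2 * ε) := by
        rcases hX.eq_or_lt with h | h
        · rw [← h, Real.zero_rpow (by linarith), zero_mul]
        · rw [← Real.rpow_add h]; simp
    _ ≤ (2 * ((n + 1 : ℕ) : ℝ) ^ (-s.re)) ^ (1 - 2 * ε)
        * (‖s‖ * ((n + 1 : ℕ) : ℝ) ^ (-s.re - 1)) ^ (2 * ε) := by
        gcongr
        linarith
    _ = 2 ^ (1 - 2 * ε) * ‖s‖ ^ (2 * ε) * ((n + 1 : ℕ) : ℝ) ^ (-s.re - 2 * ε) := by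
        rw [Real.mul_rpow (by positivity) (by positivity),
          Real.mul_rpow (by positivity) (by positivity), ← Real.rpow_mul hm0.le,
          ← Real.rpow_mul hm0.le, show -s.re - 2 * ε =
            -s.re * (1 - 2 * ε) + (-s.re - 1) * (2 * ε) by ring, Real.rpow_add hm0]
        ring
    _ ≤ 2 * ‖s‖ ^ (2 * ε) * ((n + 1 : ℕ) : ℝ) ^ (-1 - ε) := by
        refine mul_le_mul (mul_le_mul_of_nonneg_right ?_ (by positivity)) ?_ (by positivity)
          (by positivity)
        · calc (2 : ℝ) ^ (1 - 2 * ε) ≤ 2 ^ (1 : ℝ) :=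
                Real.rpow_le_rpow_of_exponent_le (by norm_num) (by linarith)
            _ = 2 := by norm_num
        · exact Real.rpow_le_rpow_of_exponent_le hm1 (by linarith)

lemma hasSum_zetaTerm_of_one_lt_re {s : ℂ} (hs : 1 < s.re) :
    HasSum (fun n => zetaTerm n s) (riemannZeta₁ s - 1) := by
  have hs1 : s ≠ 1 := by rintro rfl; simp at hs
  have h1 : HasSum (fun n : ℕ => (s - 1) * ((n + 1 : ℕ) : ℂ) ^ (-s)) (riemannZeta₁ s) := by
    have h := (Complex.summable_one_div_nat_cpow.mpr hs)
    have h' := ((summable_nat_add_iff 1).mpr h).hasSum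
    have e : ∑' n : ℕ, 1 / ((n + 1 : ℕ) : ℂ) ^ s = riemannZeta s := by
      rw [zeta_eq_tsum_one_div_nat_add_one_cpow hs]; push_cast; rfl
    rw [e, riemannZeta_eq_inv_sub_mul hs1] at h'
    have h'' := h'.mul_left (s - 1)
    rw [← mul_assoc, mul_inv_cancel₀ (sub_ne_zero.mpr hs1), one_mul] at h''
    simpa only [Complex.cpow_neg, one_div] using h''
  have hsum : Summable fun n => zetaTerm n s := by
    refine Summable.of_norm_bounded ?_
      (norm_zetaTerm_le (ε := 1 / 4) (by norm_num) (by norm_num) (s := s) (by linarith))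
    exact (((summable_nat_add_iff 1).mpr
      (Real.summable_nat_rpow.mpr (by norm_num))).mul_left _).mul_left _
  have h2 : Filter.Tendsto (fun N : ℕ => ((N + 1 : ℕ) : ℂ) ^ (1 - s)) Filter.atTop (nhds 0) := by
    rw [tendsto_zero_iff_norm_tendsto_zero]
    have h := (tendsto_rpow_neg_atTop (y := s.re - 1) (by linarith)).comp
      (tendsto_natCast_atTop_atTop.comp (Filter.tendsto_add_atTop_nat 1))
    refine h.congr fun N => ?_
    rw [Complex.norm_natCast_cpow_of_pos N.succ_pos]
    simp
  have h3 (N : ℕ) : ∑ n ∈ Finset.range N, zetaTerm n s =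
      ∑ n ∈ Finset.range N, (s - 1) * ((n + 1 : ℕ) : ℂ) ^ (-s)
        - (1 - ((N + 1 : ℕ) : ℂ) ^ (1 - s)) := by
    unfold zetaTerm
    rw [Finset.sum_sub_distrib]
    congr 1
    have := Finset.sum_range_sub' (fun n : ℕ => ((n + 1 : ℕ) : ℂ) ^ (1 - s)) N
    simpa [add_assoc, one_add_one_eq_two] using this
  have h4 := (h1.tendsto_sum_nat.sub (h2.const_sub 1))
  simp_rw [← h3, sub_zero] at h4
  rw [← tendsto_nhds_unique hsum.hasSum.tendsto_sum_nat h4]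
  exact hsum.hasSum

lemma norm_riemannZeta₁_sub_one_le {ε : ℝ} (hε : 0 < ε) (hε2 : ε < 1 / 2) :
    ∃ C : ℝ, 0 < C ∧ ∀ s : ℂ, 1 - ε < s.re →
      ‖riemannZeta₁ s - 1‖ ≤ C * ‖s - 1‖ * ‖s‖ ^ (2 * ε) := by
  have hsum : Summable fun n : ℕ => ((n + 1 : ℕ) : ℝ) ^ (-1 - ε) :=
    (summable_nat_add_iff 1).mpr (Real.summable_nat_rpow.mpr (by linarith))
  refine ⟨2 * ∑' n : ℕ, ((n + 1 : ℕ) : ℝ) ^ (-1 - ε), ?_, fun s hs => ?_⟩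
  · have := hsum.tsum_pos (fun n => by positivity) 0 (by simp)
    positivity
  -- the series represents `ζ₁ - 1` on a bounded convex region, by the identity theorem
  have key : riemannZeta₁ s - 1 = ∑' n, zetaTerm n s := by
    set R : ℝ := ‖s‖ + 3
    set U : Set ℂ := {z | 1 - ε < z.re} ∩ Metric.ball 0 R with hU
    have hUo : IsOpen U := (isOpen_lt continuous_const Complex.continuous_re).inter
      Metric.isOpen_ball
    have hUc : Convex ℝ U := (convex_halfSpace_re_gt _).inter (convex_ball 0 R)
    have hd : DifferentiableOn ℂ (fun z => ∑' n, zetaTerm n z) U := by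
      refine Complex.differentiableOn_tsum_of_summable_norm
        (u := fun n : ℕ => (R + 1) * (2 * R ^ (2 * ε) * ((n + 1 : ℕ) : ℝ) ^ (-1 - ε)))
        ((hsum.mul_left _).mul_left _) (fun n => (differentiable_zetaTerm n).differentiableOn)
        hUo fun n z hz => ?_
      have hzR : ‖z‖ ≤ R := by simpa using (mem_ball_zero_iff.mp hz.2).le
      refine (norm_zetaTerm_le hε hε2 hz.1 n).trans ?_
      have : ‖z - 1‖ ≤ R + 1 := (norm_sub_le _ _).trans (by simp; linarith)
      gcongr
    have h2 : (2 : ℂ) ∈ U := by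
      refine ⟨by simp; linarith, ?_⟩
      have := norm_nonneg s
      simp [R]; linarith
    have := AnalyticOnNhd.eqOn_of_preconnected_of_eventuallyEq
      (f := fun z => riemannZeta₁ z - 1) (g := fun z => ∑' n, zetaTerm n z) (U := U)
      ((differentiable_riemannZeta₁.sub_const 1).differentiableOn.analyticOnNhd hUo)
      (hd.analyticOnNhd hUo) hUc.isPreconnected h2 ?_
    · exact this ⟨hs, by simp [R]⟩
    · have : {z : ℂ | 1 < z.re} ∈ nhds (2 : ℂ) :=
        (isOpen_lt continuous_const Complex.continuous_re).mem_nhds (by simp)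
      filter_upwards [this] with z hz
      exact (hasSum_zetaTerm_of_one_lt_re hz).tsum_eq.symm
  rw [key]
  refine (tsum_of_norm_bounded (((hsum.hasSum.mul_left (2 * ‖s‖ ^ (2 * ε)))).mul_left ‖s - 1‖)
    (norm_zetaTerm_le hε hε2 hs)).trans (le_of_eq ?_)
  ring

end

noncomputable section

lemma one_le_norm_riemannZeta_prod {x : ℝ} (hx : 0 < x) (t : ℝ) :
    1 ≤ ‖riemannZeta (1 + x)‖ ^ 3 * ‖riemannZeta (1 + x + t * Complex.I)‖ ^ 4 *
      ‖riemannZeta (1 + x + (2 * t : ℝ) * Complex.I)‖ := by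
  have h := DirichletCharacter.norm_LFunction_product_ge_one (N := 1) (1 : DirichletCharacter ℂ 1)
    hx t
  simp only [DirichletCharacter.LFunctionTrivChar, DirichletCharacter.LFunction_modOne_eq,
    norm_mul, norm_pow] at h
  convert h using 4
  · congr 2; ring
  · push_cast; ring

lemma norm_riemannZeta_le {e : ℝ} (he : 0 < e) (he2 : e < 1 / 2) :
    ∃ C : ℝ, 1 ≤ C ∧ (∀ x : ℝ, 0 < x → x ≤ 1 → ‖riemannZeta (1 + x)‖ ≤ C / x) ∧
      ∀ T : ℝ, 1 ≤ T → ∀ s : ℂ, 1 - e < s.re → s.re ≤ 4 → 1 / 2 ≤ |s.im| → |s.im| ≤ 3 * T →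
        ‖riemannZeta s‖ ≤ C * T ^ (2 * e) := by
  obtain ⟨C, hC, h⟩ := norm_riemannZeta₁_sub_one_le he he2
  have hb (s : ℂ) (hs : 1 - e < s.re) (hs1 : s ≠ 1) :
      ‖riemannZeta s‖ ≤ ‖s - 1‖⁻¹ + C * ‖s‖ ^ (2 * e) := by
    have h0 : 0 < ‖s - 1‖ := norm_pos_iff.mpr (sub_ne_zero.mpr hs1)
    have : riemannZeta s = (s - 1)⁻¹ + (s - 1)⁻¹ * (riemannZeta₁ s - 1) := by
      rw [riemannZeta_eq_inv_sub_mul hs1]; ring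
    rw [this]
    refine (norm_add_le _ _).trans ?_
    rw [norm_mul, norm_inv]
    refine add_le_add le_rfl ?_
    calc ‖s - 1‖⁻¹ * ‖riemannZeta₁ s - 1‖ ≤ ‖s - 1‖⁻¹ * (C * ‖s - 1‖ * ‖s‖ ^ (2 * e)) := by
          gcongr; exact h s hs
      _ = C * ‖s‖ ^ (2 * e) := by field_simp
  have hpow (u T : ℝ) (hu : 0 ≤ u) (hT : 1 ≤ T) (huT : u ≤ 7 * T) :
      u ^ (2 * e) ≤ 7 * T ^ (2 * e) := by
    calc u ^ (2 * e) ≤ (7 * T) ^ (2 * e) := by gcongr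
      _ = 7 ^ (2 * e) * T ^ (2 * e) := Real.mul_rpow (by norm_num) (by linarith)
      _ ≤ 7 * T ^ (2 * e) := by
        gcongr
        calc (7 : ℝ) ^ (2 * e) ≤ 7 ^ (1 : ℝ) :=
              Real.rpow_le_rpow_of_exponent_le (by norm_num) (by linarith)
          _ = 7 := by norm_num
  refine ⟨2 + 7 * C, by linarith, fun x hx hx1 => ?_, fun T hT s hs hs4 hi hiT => ?_⟩
  · have h1 := hb (1 + x) (by simp; linarith) (by simp [hx.ne'])
    have h2 : ‖(1 : ℂ) + x - 1‖ = x := by simp [abs_of_pos hx]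
    have h3 : ‖(1 : ℂ) + x‖ ≤ 7 * 1 := by
      refine (norm_add_le _ _).trans ?_
      simp [abs_of_pos hx]; linarith
    rw [h2] at h1
    have h4 := hpow _ 1 (norm_nonneg _) le_rfl h3
    rw [Real.one_rpow] at h4
    rw [le_div_iff₀ hx]
    calc ‖riemannZeta (1 + x)‖ * x ≤ (x⁻¹ + C * (7 * 1)) * x := by
          gcongr
          exact h1.trans (by gcongr)
      _ = 1 + 7 * C * x := by field_simp
      _ ≤ 2 + 7 * C := by nlinarith
  · have hs1 : s ≠ 1 := by rintro rfl; simp at hi; linarith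
    have h0 : 1 / 2 ≤ ‖s - 1‖ := hi.trans (by simpa using Complex.abs_im_le_norm (s - 1))
    have h1 : ‖s - 1‖⁻¹ ≤ 2 := by
      rw [inv_le_comm₀ (by linarith) (by norm_num)]; linarith
    have h2 : ‖s‖ ≤ 7 * T := by
      refine (Complex.norm_le_abs_re_add_abs_im s).trans ?_
      have : |s.re| ≤ 4 := abs_le.mpr ⟨by linarith, hs4⟩
      linarith
    have h3 := hb s hs hs1
    have h4 := hpow _ T (norm_nonneg _) hT h2
    have h5 : 1 ≤ T ^ (2 * e) := Real.one_le_rpow hT (by linarith)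
    nlinarith

lemma norm_deriv_riemannZeta_le {e : ℝ} (he : 0 < e) (he2 : e < 1 / 2) :
    ∃ C : ℝ, 1 ≤ C ∧ ∀ T : ℝ, 1 ≤ T → ∀ s : ℂ, 1 - e / 2 ≤ s.re → s.re ≤ 3 → 1 ≤ |s.im| →
      |s.im| ≤ 2 * T → ‖deriv riemannZeta s‖ ≤ C * T ^ (2 * e) := by
  obtain ⟨C, hC, -, h⟩ := norm_riemannZeta_le he he2
  refine ⟨C / (e / 4), ?_, fun T hT s hs hs3 hi hiT => ?_⟩
  · rw [le_div_iff₀ (by linarith)]; linarith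
  · have hne (z : ℂ) (hz : z ∈ Metric.closedBall s (e / 4)) :
        1 - e < z.re ∧ z.re ≤ 4 ∧ 1 / 2 ≤ |z.im| ∧ |z.im| ≤ 3 * T := by
      rw [mem_closedBall_iff_norm] at hz
      have h1 := abs_le.mp ((Complex.abs_re_le_norm _).trans hz)
      have h2 := (Complex.abs_im_le_norm _).trans hz
      rw [Complex.sub_re] at h1
      rw [Complex.sub_im] at h2
      have h3 := abs_sub_abs_le_abs_sub z.im s.im
      have h4 := abs_sub_abs_le_abs_sub s.im z.im
      rw [abs_sub_comm] at h4
      refine ⟨by linarith, by linarith, by linarith, by linarith⟩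
    have := Complex.norm_deriv_le_of_forall_mem_sphere_norm_le (c := s) (R := e / 4)
      (C := C * T ^ (2 * e)) (f := riemannZeta) (by linarith) ?_ fun z hz => ?_
    · calc _ ≤ _ := this
        _ = _ := by ring
    · refine DifferentiableOn.diffContOnCl fun z hz => ?_
      rw [closure_ball _ (by linarith)] at hz
      refine (differentiableAt_riemannZeta ?_).differentiableWithinAt
      rintro rfl
      have := (hne _ hz).2.2.1
      simp at this; linarith
    · obtain ⟨h1, h2, h3, h4⟩ := hne z (Metric.sphere_subset_closedBall hz)
      exact h T hT z h1 h2 h3 h4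

/-- A zero-free region which is nearly a half plane, together with a bound for `1/ζ` in it: this is
the quantitative form of the nonvanishing of `ζ` on the line `Re s = 1`, away from the pole. -/
lemma exists_le_norm_riemannZeta {e : ℝ} (he : 0 < e) (he2 : e < 1 / 2) :
    ∃ c : ℝ, 0 < c ∧ c ≤ 1 ∧ ∀ T : ℝ, 1 ≤ T → ∀ s : ℂ, 1 - c * T ^ (-(16 * e)) ≤ s.re → s.re ≤ 2 →
      1 ≤ |s.im| → |s.im| ≤ T → c * T ^ (-(14 * e)) ≤ ‖riemannZeta s‖ := by
  obtain ⟨C, hC, hx, hz⟩ := norm_riemannZeta_le he he2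
  obtain ⟨C', hC', hd⟩ := norm_deriv_riemannZeta_le he he2
  set b : ℝ := 1 / (1 + C ^ 4) with hb
  have hb0 : 0 < b := by positivity
  have hb1 : b ≤ 1 := by
    rw [hb, div_le_one (by positivity)]; have : 0 < C ^ 4 := by positivity
    linarith
  -- the lower bound to the right of the line `Re s = 1`
  have hlow (T : ℝ) (hT : 1 ≤ T) (μ : ℝ) (hμ : 0 < μ) (hμ1 : μ ≤ 1) (x : ℝ) (hx0 : μ ^ 4 ≤ x)
      (hx1 : x ≤ 1) (t : ℝ) (ht : 1 ≤ |t|) (htT : |t| ≤ T) :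
      b * μ ^ 3 * T ^ (-(2 * e)) ≤ ‖riemannZeta (1 + x + t * Complex.I)‖ := by
    have hxp : 0 < x := lt_of_lt_of_le (by positivity) hx0
    have hT0 : 0 < T := by linarith
    have h1 := one_le_norm_riemannZeta_prod hxp t
    have h2 := hx x hxp hx1
    have h3 := hz T hT (1 + x + (2 * t : ℝ) * Complex.I) (by simp; linarith) (by simp; linarith)
      (by simp [abs_mul]; linarith) (by simp [abs_mul]; linarith)
    set Z := ‖riemannZeta (1 + x + t * Complex.I)‖
    have hZ : 0 ≤ Z := norm_nonneg _
    have hP : 1 ≤ T ^ (2 * e) := Real.one_le_rpow hT (by linarith)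
    have hn : T ^ (-(2 * e)) = (T ^ (2 * e))⁻¹ := Real.rpow_neg hT0.le _
    set P := T ^ (2 * e)
    rw [hn]
    refine le_of_pow_le_pow_left₀ (n := 4) (by norm_num) hZ ?_
    have h4 : 1 ≤ (C / x) ^ 3 * Z ^ 4 * (C * P) := by
      refine h1.trans ?_
      gcongr
    have h5 : x ^ 3 ≤ C ^ 4 * P * Z ^ 4 := by
      have e1 : (C / x) ^ 3 * Z ^ 4 * (C * P) = C ^ 4 * P * Z ^ 4 / x ^ 3 := by
        field_simp
      rw [e1, le_div_iff₀ (by positivity)] at h4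
      linarith
    have h6 : (μ ^ 4) ^ 3 ≤ C ^ 4 * P * Z ^ 4 := (by gcongr : (μ ^ 4) ^ 3 ≤ x ^ 3).trans h5
    have h7 : (b * μ ^ 3 * P⁻¹) ^ 4 = b ^ 4 * (μ ^ 4) ^ 3 / P ^ 4 := by
      field_simp
    rw [h7, div_le_iff₀ (by positivity)]
    have h8 : b ^ 4 * C ^ 4 ≤ 1 := by
      have : b ^ 4 ≤ b := pow_le_of_le_one hb0.le hb1 (by norm_num)
      calc b ^ 4 * C ^ 4 ≤ b * C ^ 4 := by gcongr
        _ ≤ b * (1 + C ^ 4) := by gcongr; linarith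
        _ = 1 := by rw [hb]; field_simp
    have h9 : P ≤ P ^ 4 := le_self_pow₀ hP (by norm_num)
    calc b ^ 4 * (μ ^ 4) ^ 3 ≤ b ^ 4 * (C ^ 4 * P * Z ^ 4) := by gcongr
      _ = (b ^ 4 * C ^ 4) * (P * Z ^ 4) := by ring
      _ ≤ 1 * (P ^ 4 * Z ^ 4) := by gcongr
      _ = Z ^ 4 * P ^ 4 := by ring
  set a : ℝ := b / (4 * C') * (e / 2) with ha
  have ha0 : 0 < a := by positivity
  have hbC : b / (4 * C') ≤ 1 := by
    rw [div_le_one (by linarith)]; linarith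
  have ha1 : a ≤ 1 := mul_le_one₀ hbC (by linarith) (by linarith)
  have haC : a ≤ b / (4 * C') := mul_le_of_le_one_right (by positivity) (by linarith)
  have hae : a ≤ e / 2 := mul_le_of_le_one_left (by linarith) hbC
  refine ⟨b / 2 * a ^ 4, by positivity, ?_, fun T hT s hs hs2 hi hiT => ?_⟩
  · have : a ^ 4 ≤ 1 := pow_le_one₀ ha0.le ha1
    nlinarith
  have hT0 : 0 < T := by linarith
  set μ : ℝ := a * T ^ (-(4 * e)) with hμ
  have hTe : T ^ (-(4 * e)) ≤ 1 := Real.rpow_le_one_of_one_le_of_nonpos hT (by linarith)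
  have hμ0 : 0 < μ := by positivity
  have hμa : μ ≤ a := mul_le_of_le_one_right ha0.le hTe
  have hμ1 : μ ≤ 1 := hμa.trans ha1
  have hμ4 : μ ^ 4 = a ^ 4 * T ^ (-(16 * e)) := by
    rw [hμ, mul_pow, ← Real.rpow_natCast (T ^ (-(4 * e))), ← Real.rpow_mul hT0.le]
    congr 2; push_cast; ring
  have hμ3 : μ ^ 3 = a ^ 3 * T ^ (-(12 * e)) := by
    rw [hμ, mul_pow, ← Real.rpow_natCast (T ^ (-(4 * e))), ← Real.rpow_mul hT0.le]
    congr 2; push_cast; ring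
  have hgoal : b / 2 * a ^ 4 * T ^ (-(14 * e)) ≤ b / 2 * μ ^ 3 * T ^ (-(2 * e)) := by
    rw [hμ3, show -(14 * e) = -(12 * e) + -(2 * e) by ring, Real.rpow_add hT0]
    have : a ^ 4 ≤ a ^ 3 := pow_le_pow_of_le_one ha0.le ha1 (by norm_num)
    have h3 : 0 < T ^ (-(12 * e)) * T ^ (-(2 * e)) := by positivity
    nlinarith [mul_le_mul_of_nonneg_right this h3.le]
  refine hgoal.trans ?_
  have hsre : 1 - μ ^ 4 ≤ s.re := by
    refine le_trans ?_ hs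
    rw [hμ4]
    have : 0 < a ^ 4 * T ^ (-(16 * e)) := by positivity
    nlinarith
  have hμ4a : μ ^ 4 ≤ e / 2 :=
    (pow_le_of_le_one hμ0.le hμ1 (by norm_num)).trans (hμa.trans hae)
  have hs_eq : s = (s.re : ℂ) + s.im * Complex.I := (Complex.re_add_im s).symm
  rcases le_total (1 + μ ^ 4) s.re with hr | hr
  · have h1 := hlow T hT μ hμ0 hμ1 (s.re - 1) (by linarith) (by linarith) s.im hi hiT
    rw [show (1 : ℂ) + ((s.re - 1 : ℝ) : ℂ) + s.im * Complex.I = s by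
      conv_rhs => rw [hs_eq]
      push_cast; ring] at h1
    refine le_trans ?_ h1
    have : 0 ≤ μ ^ 3 * T ^ (-(2 * e)) := by positivity
    nlinarith
  · -- compare with the point `1 + μ⁴ + it` by means of the bound for the derivative
    set w : ℂ := 1 + (μ ^ 4 : ℝ) + s.im * Complex.I with hw
    have hw0 := hlow T hT μ hμ0 hμ1 (μ ^ 4) le_rfl (pow_le_one₀ hμ0.le hμ1) s.im hi hiT
    set D : Set ℂ := {z | 1 - e / 2 ≤ z.re} ∩ {z | z.re ≤ 3} ∩ {z | z.im = s.im} with hD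
    have hDc : Convex ℝ D := ((convex_halfSpace_re_ge _).inter (convex_halfSpace_re_le _)).inter
      (convex_hyperplane Complex.imLm.isLinear _)
    have hsD : s ∈ D := ⟨⟨by simp; linarith, by simp; linarith⟩, rfl⟩
    have hwD : w ∈ D := by
      have : 0 < μ ^ 4 := by positivity
      refine ⟨⟨?_, ?_⟩, ?_⟩ <;> simp only [hw, Set.mem_ofPred_eq, Complex.add_re, Complex.one_re,
        Complex.ofReal_re, Complex.mul_re, Complex.I_re, Complex.ofReal_im, Complex.I_im,
        Complex.add_im, Complex.one_im, Complex.mul_im] <;> linarith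
    have hdiff : ‖riemannZeta w - riemannZeta s‖ ≤ C' * T ^ (2 * e) * ‖w - s‖ := by
      refine hDc.norm_image_sub_le_of_norm_hasDerivWithin_le
        (f' := deriv riemannZeta) (fun z hz => ?_) (fun z hz => ?_) hsD hwD
      · refine (differentiableAt_riemannZeta ?_).hasDerivAt.hasDerivWithinAt
        rintro rfl
        have := hz.2
        simp only [Set.mem_ofPred_eq, Complex.one_im] at this
        rw [← this] at hi; simp at hi; linarith
      · have h2 : z.im = s.im := hz.2
        exact hd T hT z hz.1.1 hz.1.2 (by rw [h2]; exact hi) (by rw [h2]; linarith)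
    have hws : ‖w - s‖ ≤ 2 * μ ^ 4 := by
      have : w - s = ((1 + μ ^ 4 - s.re : ℝ) : ℂ) := by
        conv_lhs => rw [hs_eq]
        rw [hw]; push_cast; ring
      rw [this, Complex.norm_real, Real.norm_eq_abs, abs_of_nonneg (by linarith)]
      linarith
    have h3 := norm_sub_norm_le (riemannZeta w) (riemannZeta s)
    have h4 : C' * T ^ (2 * e) * ‖w - s‖ ≤ b / 2 * μ ^ 3 * T ^ (-(2 * e)) := by
      calc C' * T ^ (2 * e) * ‖w - s‖ ≤ C' * T ^ (2 * e) * (2 * μ ^ 4) := by gcongr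
        _ = μ ^ 3 * (2 * C' * a) * (T ^ (2 * e) * T ^ (-(4 * e))) := by rw [hμ]; ring
        _ = μ ^ 3 * (2 * C' * a) * T ^ (-(2 * e)) := by
          rw [← Real.rpow_add hT0]; congr 2; ring
        _ ≤ μ ^ 3 * (b / 2) * T ^ (-(2 * e)) := by
          gcongr
          rw [le_div_iff₀ (by positivity)] at haC
          linarith
        _ = _ := by ring
    linarith

/-- For every `ε > 0`, the logarithmic derivative of `(s - 1) ζ(s)` is `O(T ^ ε)` at height at most
`T`, up to a distance `≫ T ^ (-ε)` to the left of the line `Re s = 1`. -/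
theorem exists_norm_logDeriv_riemannZeta₁_le {ε : ℝ} (hε : 0 < ε) :
    ∃ C κ : ℝ, 0 < C ∧ 0 < κ ∧ κ ≤ 1 ∧ ∀ T : ℝ, 1 ≤ T → ∀ s : ℂ,
      1 - κ * T ^ (-ε) ≤ s.re → s.re ≤ 2 → |s.im| ≤ T →
        riemannZeta₁ s ≠ 0 ∧ ‖deriv riemannZeta₁ s / riemannZeta₁ s‖ ≤ C * T ^ ε := by
  set e : ℝ := min (ε / 16) (1 / 4) with he'
  have he : 0 < e := lt_min (by linarith) (by norm_num)
  have he2 : e < 1 / 2 := (min_le_right _ _).trans_lt (by norm_num)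
  have heε : 16 * e ≤ ε := by linarith [min_le_left (ε / 16) (1 / 4 : ℝ)]
  obtain ⟨c, hc, hc1, hlow⟩ := exists_le_norm_riemannZeta he he2
  obtain ⟨C', hC', hd⟩ := norm_deriv_riemannZeta_le he he2
  -- the part of the strip close to the real axis, by compactness
  obtain ⟨δ, hδ, hδ0⟩ : ∃ δ > 0, ∀ s : ℂ, 1 - δ ≤ s.re → s.re ≤ 2 → |s.im| ≤ 1 →
      riemannZeta₁ s ≠ 0 := by
    set K : Set ℂ := Set.Icc 1 2 ×ℂ Set.Icc (-1) 1 with hK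
    have hKc : IsCompact K := isCompact_Icc.reProdIm isCompact_Icc
    have hU : IsOpen {s : ℂ | riemannZeta₁ s ≠ 0} :=
      isOpen_ne_fun differentiable_riemannZeta₁.continuous continuous_const
    have hKU : K ⊆ {s : ℂ | riemannZeta₁ s ≠ 0} := by
      intro s hs
      rw [hK, Complex.mem_reProdIm] at hs
      by_cases h1 : s = 1
      · subst h1; simp
      · have := riemannZeta_ne_zero_of_one_le_re hs.1.1
        rw [riemannZeta_eq_inv_sub_mul h1] at this
        exact (mul_ne_zero_iff.mp this).2
    obtain ⟨δ, hδ, hsub⟩ := hKc.exists_thickening_subset_open hU hKU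
    refine ⟨δ / 2, by linarith, fun s h1 h2 h3 => hsub ?_⟩
    rw [Metric.mem_thickening_iff]
    refine ⟨(max s.re 1 : ℝ) + s.im * Complex.I, ?_, ?_⟩
    · rw [hK, Complex.mem_reProdIm]
      simp only [Complex.add_re, Complex.ofReal_re, Complex.mul_re, Complex.I_re, mul_zero,
        Complex.ofReal_im, Complex.I_im, mul_one, sub_self, add_zero, Complex.add_im,
        Complex.mul_im, zero_add]
      exact ⟨⟨le_max_right _ _, max_le h2 (by norm_num)⟩, abs_le.mp h3⟩
    · rw [dist_eq_norm]
      have : s - ((max s.re 1 : ℝ) + s.im * Complex.I) = ((s.re - max s.re 1 : ℝ) : ℂ) := by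
        apply Complex.ext <;> simp
      rw [this, Complex.norm_real, Real.norm_eq_abs, abs_lt]
      rcases max_cases s.re 1 with ⟨h, _⟩ | ⟨h, _⟩ <;> rw [h] <;> constructor <;> linarith
  obtain ⟨B, hB⟩ : ∃ B, ∀ s : ℂ, 1 - δ ≤ s.re → s.re ≤ 2 → |s.im| ≤ 1 →
      ‖deriv riemannZeta₁ s / riemannZeta₁ s‖ ≤ B := by
    have hKc : IsCompact (Set.Icc (1 - δ) 2 ×ℂ Set.Icc (-1) 1) :=
      isCompact_Icc.reProdIm isCompact_Icc
    obtain ⟨B, hB⟩ := hKc.exists_bound_of_continuousOn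
      (f := fun s => deriv riemannZeta₁ s / riemannZeta₁ s) (by
        refine ContinuousOn.div differentiable_riemannZeta₁.deriv.continuous.continuousOn
          differentiable_riemannZeta₁.continuous.continuousOn fun s hs => ?_
        rw [Complex.mem_reProdIm] at hs
        exact hδ0 s hs.1.1 hs.1.2 (abs_le.mpr hs.2))
    exact ⟨B, fun s h1 h2 h3 => hB s (Complex.mem_reProdIm.mpr ⟨⟨h1, h2⟩, abs_le.mp h3⟩)⟩
  have hmin : 0 < min (min c (e / 2)) δ := lt_min (lt_min hc (by linarith)) hδ
  refine ⟨|B| + C' / c + 1, min (min c (e / 2)) δ, by positivity, hmin,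
    ((min_le_left _ _).trans (min_le_left _ _)).trans hc1, fun T hT s hs hs2 hi => ?_⟩
  have hT0 : 0 < T := by linarith
  have hTε : 1 ≤ T ^ ε := Real.one_le_rpow hT hε.le
  have hTn : T ^ (-ε) ≤ 1 := Real.rpow_le_one_of_one_le_of_nonpos hT (by linarith)
  have hle (a : ℝ) (ha : min (min c (e / 2)) δ ≤ a) : 1 - a ≤ s.re := by
    have : min (min c (e / 2)) δ * T ^ (-ε) ≤ min (min c (e / 2)) δ :=
      mul_le_of_le_one_right hmin.le hTn
    linarith
  rcases le_total |s.im| 1 with h1 | h1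
  · have h2 := hle δ (min_le_right _ _)
    refine ⟨hδ0 s h2 hs2 h1, (hB s h2 hs2 h1).trans ?_⟩
    have : 0 < C' / c := by positivity
    nlinarith [le_abs_self B, abs_nonneg B]
  · have hs1 : s ≠ 1 := by rintro rfl; simp at h1; linarith
    have h3 : c * T ^ (-(14 * e)) ≤ ‖riemannZeta s‖ := by
      refine hlow T hT s (le_trans ?_ hs) hs2 h1 hi
      have e1 : T ^ (-ε) ≤ T ^ (-(16 * e)) :=
        Real.rpow_le_rpow_of_exponent_le hT (by linarith)
      have e2 : min (min c (e / 2)) δ ≤ c := (min_le_left _ _).trans (min_le_left _ _)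
      have e3 : min (min c (e / 2)) δ * T ^ (-ε) ≤ c * T ^ (-(16 * e)) := by gcongr
      linarith
    have h4 := hd T hT s (hle (e / 2) ((min_le_left _ _).trans (min_le_right _ _))) (by linarith)
      h1 (by linarith)
    have hζ0 : 0 < ‖riemannZeta s‖ := lt_of_lt_of_le (by positivity) h3
    have hζ : riemannZeta s ≠ 0 := norm_pos_iff.mp hζ0
    have hζ1 : riemannZeta₁ s ≠ 0 := by
      rw [riemannZeta_eq_inv_sub_mul hs1] at hζ
      exact (mul_ne_zero_iff.mp hζ).2
    refine ⟨hζ1, ?_⟩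
    have hsub : s - 1 ≠ 0 := sub_ne_zero.mpr hs1
    have h5 : deriv riemannZeta₁ s / riemannZeta₁ s = deriv riemannZeta s / riemannZeta s
        + (s - 1)⁻¹ := by
      rw [deriv_riemannZeta_eq_neg_inv_sub_sq_mul_add hs1, riemannZeta_eq_inv_sub_mul hs1]
      field_simp
      ring
    rw [h5]
    have h6 : ‖(s - 1)⁻¹‖ ≤ 1 := by
      rw [norm_inv]
      have : 1 ≤ ‖s - 1‖ := h1.trans (by simpa using Complex.abs_im_le_norm (s - 1))
      exact inv_le_one_of_one_le₀ this
    have h7 : ‖deriv riemannZeta s / riemannZeta s‖ ≤ C' / c * T ^ ε := by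
      rw [norm_div]
      calc ‖deriv riemannZeta s‖ / ‖riemannZeta s‖
          ≤ C' * T ^ (2 * e) / (c * T ^ (-(14 * e))) := by gcongr
        _ = C' / c * T ^ (16 * e) := by
          rw [Real.rpow_neg hT0.le, show 16 * e = 2 * e + 14 * e by ring, Real.rpow_add hT0]
          field_simp
        _ ≤ C' / c * T ^ ε := by gcongr
    refine (norm_add_le _ _).trans ?_
    nlinarith [abs_nonneg B]

end

noncomputable section

/-! ### The prime number theorem with a strong error term -/

/-- The error term `ψ(u) - u` of the prime number theorem, in the variable `v = log u`. -/
def psiErr (v : ℝ) : ℝ := Chebyshev.psi (Real.exp v) - Real.exp v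

lemma measurable_psiErr : Measurable psiErr :=
  (Chebyshev.psi_mono.measurable.comp Real.measurable_exp).sub Real.measurable_exp

lemma psi_exp_le (v : ℝ) : Chebyshev.psi (Real.exp v) ≤ 6 * Real.exp v := by
  refine (Chebyshev.psi_le_const_mul_self (Real.exp_pos v).le).trans ?_
  have : Real.log 4 ≤ 2 := by
    rw [show (4 : ℝ) = 2 ^ 2 by norm_num, Real.log_pow]
    have := Real.log_two_lt_d9
    push_cast; linarith
  have := Real.exp_pos v
  nlinarith

lemma abs_psiErr_le (v : ℝ) : |psiErr v| ≤ 6 * Real.exp v := by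
  have h1 := psi_exp_le v
  have h2 := Chebyshev.psi_nonneg (Real.exp v)
  have h3 := Real.exp_pos v
  unfold psiErr
  rw [abs_le]; constructor <;> linarith

lemma integrableOn_psiErr_mul_cexp {s : ℂ} (hs : 1 < s.re) :
    IntegrableOn (fun v : ℝ => (psiErr v : ℂ) * Complex.exp (-s * v)) (Set.Ioi 0) := by
  refine Integrable.mono' (g := fun v => 6 * Real.exp (-(s.re - 1) * v)) ?_ ?_ ?_
  · exact (exp_neg_integrableOn_Ioi 0 (by linarith)).const_mul 6
  · refine (Measurable.aestronglyMeasurable ?_)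
    exact (Complex.measurable_ofReal.comp measurable_psiErr).mul (by fun_prop)
  · refine Filter.Eventually.of_forall fun v => ?_
    rw [norm_mul, Complex.norm_real, Complex.norm_exp]
    have h := abs_psiErr_le v
    calc _ ≤ 6 * Real.exp v * Real.exp ((-s * v).re) := by gcongr; exact h
      _ = _ := by
        rw [mul_assoc, ← Real.exp_add]; congr 2; simp; ring

lemma image_exp_Ioi_zero : Real.exp '' Set.Ioi 0 = Set.Ioi 1 := by
  ext u
  constructor
  · rintro ⟨v, hv, rfl⟩; exact Real.one_lt_exp_iff.mpr hv
  · intro hu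
    have hu' : (1 : ℝ) < u := hu
    exact ⟨Real.log u, Real.log_pos hu, Real.exp_log (by linarith)⟩

/-- The Laplace transform of the error term of the prime number theorem. -/
lemma integral_psiErr_mul_cexp {s : ℂ} (hs : 1 < s.re) :
    ∫ v in Set.Ioi (0 : ℝ), (psiErr v : ℂ) * Complex.exp (-s * v) =
      (-(deriv riemannZeta₁ s / riemannZeta₁ s) - 1) / s := by
  have hs0 : s ≠ 0 := by rintro rfl; simp at hs; linarith
  have hs1 : s ≠ 1 := by rintro rfl; simp at hs
  have hs1' : s - 1 ≠ 0 := sub_ne_zero.mpr hs1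
  have hζ : riemannZeta s ≠ 0 := riemannZeta_ne_zero_of_one_lt_re hs
  have hζ1 : riemannZeta₁ s ≠ 0 := by
    rw [riemannZeta_eq_inv_sub_mul hs1] at hζ
    exact (mul_ne_zero_iff.mp hζ).2
  have hO : (fun n : ℕ => ∑ k ∈ Finset.Icc 1 n, ArithmeticFunction.vonMangoldt k)
      =O[Filter.atTop] fun n : ℕ => (n : ℝ) ^ (1 : ℝ) := by
    refine Asymptotics.IsBigO.of_bound (Real.log 4 + 4) (Filter.Eventually.of_forall fun n => ?_)
    have h1 := Chebyshev.psi_le_const_mul_self (x := n) (by positivity)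
    have h2 := Chebyshev.psi_nonneg (n : ℝ)
    have h3 : Chebyshev.psi n = ∑ k ∈ Finset.Icc 1 n, ArithmeticFunction.vonMangoldt k := by
      rw [Chebyshev.psi, Nat.floor_natCast]; rfl
    rw [← h3, Real.rpow_one, Real.norm_of_nonneg h2, Real.norm_of_nonneg (by positivity)]
    exact h1
  have h1 := LSeries_eq_mul_integral_of_nonneg (fun n => ArithmeticFunction.vonMangoldt n)
    (r := 1) zero_le_one (s := s) (by simpa using hs) hO
    (fun n => ArithmeticFunction.vonMangoldt_nonneg)
  rw [ArithmeticFunction.LSeries_vonMangoldt_eq_deriv_riemannZeta_div hs, ← image_exp_Ioi_zero,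
    integral_image_eq_integral_abs_deriv_smul measurableSet_Ioi
      (fun x _ => (Real.hasDerivAt_exp x).hasDerivWithinAt) Real.exp_injective.injOn] at h1
  have h2 : ∫ v in Set.Ioi (0 : ℝ), |Real.exp v| • ((∑ k ∈ Finset.Icc 1 ⌊Real.exp v⌋₊,
      (ArithmeticFunction.vonMangoldt k : ℂ)) * (Real.exp v : ℂ) ^ (-(s + 1))) =
      ∫ v in Set.Ioi (0 : ℝ), ((psiErr v : ℂ) * Complex.exp (-s * v)
        + Complex.exp ((1 - s) * v)) := by
    refine integral_congr_ae (Filter.Eventually.of_forall fun v => ?_)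
    have e1 : (∑ k ∈ Finset.Icc 1 ⌊Real.exp v⌋₊, (ArithmeticFunction.vonMangoldt k : ℂ)) =
        (psiErr v : ℂ) + Complex.exp v := by
      rw [psiErr, Chebyshev.psi]
      push_cast
      rw [sub_add_cancel]; rfl
    have e2 : (Real.exp v : ℂ) ^ (-(s + 1)) = Complex.exp (-(s + 1) * v) := by
      rw [Complex.cpow_def_of_ne_zero (by exact_mod_cast (Real.exp_pos v).ne'),
        ← Complex.ofReal_log (Real.exp_pos v).le, Real.log_exp]
      congr 1; ring
    simp only [e1, e2]
    rw [abs_of_pos (Real.exp_pos v), Complex.real_smul]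
    push_cast
    have e3 : Complex.exp (-s * v) = Complex.exp v * Complex.exp (-(s + 1) * v) := by
      rw [← Complex.exp_add]; congr 1; ring
    have e4 : Complex.exp ((1 - s) * v) =
        Complex.exp v * (Complex.exp v * Complex.exp (-(s + 1) * v)) := by
      rw [← Complex.exp_add, ← Complex.exp_add]; congr 1; ring
    rw [e3, e4]; ring
  have hre : (1 - s).re < 0 := by simp; linarith
  rw [h2, integral_add (integrableOn_psiErr_mul_cexp hs)
    (integrableOn_exp_mul_complex_Ioi hre 0), integral_exp_mul_complex_Ioi hre] at h1
  have h5 : deriv riemannZeta s / riemannZeta s =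
      deriv riemannZeta₁ s / riemannZeta₁ s - (s - 1)⁻¹ := by
    rw [deriv_riemannZeta_eq_neg_inv_sub_sq_mul_add hs1, riemannZeta_eq_inv_sub_mul hs1]
    field_simp
    ring
  rw [neg_div, h5] at h1
  have h1s : 1 - s ≠ 0 := sub_ne_zero.mpr (Ne.symm hs1)
  rw [eq_div_iff hs0]
  set J := ∫ v in Set.Ioi (0 : ℝ), (psiErr v : ℂ) * Complex.exp (-s * v)
  simp only [Complex.ofReal_zero, mul_zero, Complex.exp_zero] at h1
  have h6 : J * s = -(deriv riemannZeta₁ s / riemannZeta₁ s - (s - 1)⁻¹) + s / (1 - s) := by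
    rw [h1]; field_simp; ring
  rw [h6]
  have : s / (1 - s) = -1 - (s - 1)⁻¹ := by
    rw [show (s - 1) = -(1 - s) by ring, inv_neg]
    field_simp
    ring
  rw [this]; ring

/-- The integrand of the contour integral computing a Gaussian mean of `psiErr`. -/
def gaussKernel (X δ : ℝ) (s : ℂ) : ℂ := Complex.exp (X * s + δ ^ 2 / 2 * s ^ 2)

lemma norm_gaussKernel (X δ a t : ℝ) :
    ‖gaussKernel X δ (a + t * Complex.I)‖ = Real.exp (X * a + δ ^ 2 / 2 * (a ^ 2 - t ^ 2)) := by
  rw [gaussKernel, Complex.norm_exp]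
  congr 1
  simp [pow_two, Complex.add_re, Complex.mul_re]

lemma integral_gaussKernel (X c v : ℝ) {δ : ℝ} (hδ : 0 < δ) :
    ∫ t : ℝ, Complex.exp (-(c + t * Complex.I) * v) * gaussKernel X δ (c + t * Complex.I) =
      2 * Real.pi * ProbabilityTheory.gaussianPDFReal X (.mk (δ ^ 2) (sq_nonneg δ)) v := by
  have hδ' : (δ : ℂ) ≠ 0 := by exact_mod_cast hδ.ne'
  have hb : (-(δ : ℂ) ^ 2 / 2).re < 0 := by
    rw [show (-(δ : ℂ) ^ 2 / 2) = ((-δ ^ 2 / 2 : ℝ) : ℂ) by push_cast; ring, Complex.ofReal_re]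
    have : 0 < δ ^ 2 := by positivity
    linarith
  have h := integral_cexp_quadratic hb (Complex.I * (X - v) + Complex.I * δ ^ 2 * c)
    ((X - v) * c + δ ^ 2 * c ^ 2 / 2)
  have e (t : ℝ) : Complex.exp (-(c + t * Complex.I) * v) * gaussKernel X δ (c + t * Complex.I) =
      Complex.exp (-(δ : ℂ) ^ 2 / 2 * t ^ 2 + (Complex.I * (X - v) + Complex.I * δ ^ 2 * c) * t
        + ((X - v) * c + δ ^ 2 * c ^ 2 / 2)) := by
    rw [gaussKernel, ← Complex.exp_add]
    congr 1
    have := Complex.I_sq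
    linear_combination (δ : ℂ) ^ 2 / 2 * t ^ 2 * this
  simp_rw [e]
  rw [h, ProbabilityTheory.gaussianPDFReal_def]
  have e1 : ((X : ℂ) - v) * c + δ ^ 2 * c ^ 2 / 2 - (Complex.I * (X - v) + Complex.I * δ ^ 2 * c) ^ 2
      / (4 * (-(δ : ℂ) ^ 2 / 2)) = ((-(v - X) ^ 2 / (2 * δ ^ 2) : ℝ) : ℂ) := by
    have : (Complex.I * ((X : ℂ) - v) + Complex.I * δ ^ 2 * c) ^ 2 = -((X - v) + δ ^ 2 * c) ^ 2 := by
      have := Complex.I_sq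
      linear_combination ((X - v : ℂ) + δ ^ 2 * c) ^ 2 * this
    rw [this]
    push_cast
    field_simp
    ring
  have e2 : ((Real.pi : ℂ) / -(-(δ : ℂ) ^ 2 / 2)) ^ (1 / 2 : ℂ) =
      ((2 * Real.pi * (Real.sqrt (2 * Real.pi * δ ^ 2))⁻¹ : ℝ) : ℂ) := by
    have : (Real.pi : ℂ) / -(-(δ : ℂ) ^ 2 / 2) = ((Real.pi / (δ ^ 2 / 2) : ℝ) : ℂ) := by
      push_cast; congr 1; ring
    rw [this, show (1 / 2 : ℂ) = ((1 / 2 : ℝ) : ℂ) by push_cast; ring,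
      ← Complex.ofReal_cpow (by positivity), ← Real.sqrt_eq_rpow]
    congr 1
    rw [Real.sqrt_eq_iff_mul_self_eq (by positivity) (by positivity)]
    have h3 := Real.mul_self_sqrt (show 0 ≤ 2 * Real.pi * δ ^ 2 by positivity)
    have h4 : Real.sqrt (2 * Real.pi * δ ^ 2) ≠ 0 := by positivity
    have hpi := Real.pi_pos.ne'
    generalize Real.sqrt (2 * Real.pi * δ ^ 2) = q at h3 h4 ⊢
    field_simp
    linarith
  rw [e1, e2]
  push_cast
  ring

lemma integral_psiErr_mul_gaussian {X δ c : ℝ} (hδ : 0 < δ) (hc : 1 < c) :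
    ((∫ v in Set.Ioi (0 : ℝ),
        psiErr v * ProbabilityTheory.gaussianPDFReal X (.mk (δ ^ 2) (sq_nonneg δ)) v : ℝ) : ℂ) =
      (2 * Real.pi : ℂ)⁻¹ * ∫ t : ℝ, (-(deriv riemannZeta₁ (c + t * Complex.I) /
        riemannZeta₁ (c + t * Complex.I)) - 1) / (c + t * Complex.I) *
          gaussKernel X δ (c + t * Complex.I) := by
  have hre (t : ℝ) : 1 < ((c : ℂ) + t * Complex.I).re := by simpa using hc
  have h1 (t : ℝ) : (-(deriv riemannZeta₁ (c + t * Complex.I) /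
        riemannZeta₁ (c + t * Complex.I)) - 1) / (c + t * Complex.I) *
          gaussKernel X δ (c + t * Complex.I) = ∫ v in Set.Ioi (0 : ℝ), (psiErr v : ℂ) *
          (Complex.exp (-(c + t * Complex.I) * v) * gaussKernel X δ (c + t * Complex.I)) := by
    rw [← integral_psiErr_mul_cexp (hre t), ← integral_mul_const]
    congr 1; ext v; ring
  simp_rw [h1]
  have hint : Integrable (Function.uncurry fun (t v : ℝ) => (psiErr v : ℂ) *
      (Complex.exp (-(c + t * Complex.I) * v) * gaussKernel X δ (c + t * Complex.I)))
      (volume.prod (volume.restrict (Set.Ioi 0))) := by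
    have hg : Integrable (fun t : ℝ => Real.exp (X * c + δ ^ 2 / 2 * (c ^ 2 - t ^ 2))) := by
      have := (integrable_exp_neg_mul_sq (b := δ ^ 2 / 2) (by positivity)).const_mul
        (Real.exp (X * c + δ ^ 2 / 2 * c ^ 2))
      refine this.congr (Filter.Eventually.of_forall fun t => ?_)
      simp only
      rw [← Real.exp_add]; congr 1; ring
    have hv : Integrable (fun v : ℝ => 6 * Real.exp (-(c - 1) * v))
        (volume.restrict (Set.Ioi 0)) := (exp_neg_integrableOn_Ioi 0 (by linarith)).const_mul 6
    refine (hg.mul_prod hv).mono' ?_ ?_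
    · refine Measurable.aestronglyMeasurable ?_
      refine Measurable.mul (Complex.measurable_ofReal.comp (measurable_psiErr.comp measurable_snd))
        (Measurable.mul (by fun_prop) ?_)
      unfold gaussKernel; fun_prop
    · refine Filter.Eventually.of_forall fun ⟨t, v⟩ => ?_
      simp only [Function.uncurry]
      rw [norm_mul, norm_mul, norm_gaussKernel, Complex.norm_real, Complex.norm_exp]
      have h := abs_psiErr_le v
      calc _ ≤ 6 * Real.exp v * (Real.exp ((-(c + t * Complex.I) * v).re) *
            Real.exp (X * c + δ ^ 2 / 2 * (c ^ 2 - t ^ 2))) := by gcongr; exact h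
        _ = Real.exp (X * c + δ ^ 2 / 2 * (c ^ 2 - t ^ 2)) *
            (6 * (Real.exp v * Real.exp ((-(c + t * Complex.I) * v).re))) := by ring
        _ = _ := by
          rw [← Real.exp_add v]; congr 3; simp; ring
  rw [integral_integral_swap hint]
  simp_rw [integral_const_mul, integral_gaussKernel X c _ hδ]
  rw [← integral_const_mul, ← integral_complex_ofReal]
  refine integral_congr_ae (Filter.Eventually.of_forall fun v => ?_)
  have : (Real.pi : ℂ) ≠ 0 := by exact_mod_cast Real.pi_pos.ne'
  push_cast
  field_simp

end

noncomputable section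

lemma integral_Ioi_mul_exp_neg_sq {b : ℝ} (hb : 0 < b) (T : ℝ) (hT : 0 ≤ T) :
    IntegrableOn (fun t : ℝ => t * Real.exp (-b * t ^ 2)) (Set.Ioi T) ∧
    ∫ t in Set.Ioi T, t * Real.exp (-b * t ^ 2) = Real.exp (-b * T ^ 2) / (2 * b) := by
  have hd (t : ℝ) : HasDerivAt (fun t : ℝ => -(Real.exp (-b * t ^ 2) / (2 * b)))
      (t * Real.exp (-b * t ^ 2)) t := by
    have h1 : HasDerivAt (fun t : ℝ => -b * t ^ 2) (-b * (2 * t)) t := by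
      simpa using (hasDerivAt_pow 2 t).const_mul (-b)
    refine ((h1.exp.div_const (2 * b)).neg).congr_deriv ?_
    field_simp
  have hl : Filter.Tendsto (fun t : ℝ => -(Real.exp (-b * t ^ 2) / (2 * b))) Filter.atTop
      (nhds 0) := by
    have h2 : Filter.Tendsto (fun t : ℝ => -b * t ^ 2) Filter.atTop Filter.atBot :=
      (Filter.tendsto_pow_atTop two_ne_zero).const_mul_atTop_of_neg (by linarith)
    have := ((Real.tendsto_exp_atBot.comp h2).div_const (2 * b)).neg
    simpa using this
  have hint : IntegrableOn (fun t : ℝ => t * Real.exp (-b * t ^ 2)) (Set.Ioi T) :=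
    integrableOn_Ioi_deriv_of_nonneg' (fun t _ => hd t)
      (fun t ht => mul_nonneg (hT.trans (le_of_lt ht)) (Real.exp_pos _).le) hl
  refine ⟨hint, ?_⟩
  rw [integral_Ioi_of_hasDerivAt_of_tendsto' (fun t _ => hd t) hint hl]
  ring

set_option maxHeartbeats 1600000 in
/-- Gaussian means, with standard deviation `δ`, of the error term in the prime number theorem
are small: the contour is moved to the left of the line `Re s = 1` up to height `T`. -/
lemma exists_abs_gaussian_mean_psiErr_le {ε : ℝ} (hε : 0 < ε) (hε1 : ε ≤ 1) :
    ∃ K κ : ℝ, 0 < K ∧ 0 < κ ∧ ∀ X δ T : ℝ, 1 ≤ X → 0 < δ → δ ≤ 1 → 1 ≤ T →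
      |∫ v in Set.Ioi (0 : ℝ),
          psiErr v * ProbabilityTheory.gaussianPDFReal X (.mk (δ ^ 2) (sq_nonneg δ)) v| ≤
        K * Real.exp X * (T ^ 2 * Real.exp (-(κ * T ^ (-ε) * X)) +
          (T + (δ ^ 2)⁻¹) * Real.exp (-(δ ^ 2 * T ^ 2 / 2))) := by
  obtain ⟨C, κ₀, hC, hκ₀, hκ₁, hA⟩ := exists_norm_logDeriv_riemannZeta₁_le hε
  refine ⟨(C + 1) * 100 * Real.exp 3, κ₀ / 2, by positivity, by positivity,
    fun X δ T hX hδ hδ1 hT => ?_⟩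
  set κ := κ₀ / 2 * T ^ (-ε) with hκ
  have hT0 : 0 < T := by linarith
  have hTn : T ^ (-ε) ≤ 1 := Real.rpow_le_one_of_one_le_of_nonpos hT (by linarith)
  have hκ0 : 0 < κ := by positivity
  have hκ2 : κ ≤ 1 / 2 := by
    have : κ₀ / 2 * T ^ (-ε) ≤ κ₀ / 2 * 1 := by gcongr
    linarith
  set H : ℂ → ℂ := fun s => (-(deriv riemannZeta₁ s / riemannZeta₁ s) - 1) / s with hH
  set F : ℂ → ℂ := fun s => H s * gaussKernel X δ s with hF
  set c : ℝ := 1 + 1 / X with hc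
  have hX0 : 0 < X := by linarith
  have hXi : 1 / X ≤ 1 := by rw [div_le_one hX0]; exact hX
  have hXi0 : 0 < 1 / X := by positivity
  have hc1 : 1 < c := by linarith
  have hc2 : c ≤ 2 := by linarith
  -- bound for `H` at height at most `S`
  have hHb (S : ℝ) (hS : 1 ≤ S) (s : ℂ) (h1 : 1 - κ₀ / 2 * S ^ (-ε) ≤ s.re) (h2 : s.re ≤ 2)
      (h3 : |s.im| ≤ S) : ‖H s‖ ≤ 2 * (C + 1) * S := by
    have hSn : S ^ (-ε) ≤ 1 := Real.rpow_le_one_of_one_le_of_nonpos hS (by linarith)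
    have hSp : 0 < S ^ (-ε) := by positivity
    have h4 := (hA S hS s (by nlinarith) h2 h3).2
    have h5 : 1 / 2 ≤ ‖s‖ := by
      refine le_trans ?_ (Complex.re_le_norm s)
      nlinarith
    have h6 : S ^ ε ≤ S := by
      calc S ^ ε ≤ S ^ (1 : ℝ) := Real.rpow_le_rpow_of_exponent_le hS hε1
        _ = S := Real.rpow_one S
    rw [hH]
    simp only [norm_div]
    rw [div_le_iff₀ (by linarith)]
    have h7 : ‖-(deriv riemannZeta₁ s / riemannZeta₁ s) - 1‖ ≤ C * S + 1 := by
      refine (norm_sub_le _ _).trans ?_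
      rw [norm_neg, norm_one]
      have : C * S ^ ε ≤ C * S := by gcongr
      linarith
    have h8 : (C + 1) * S * 1 ≤ (C + 1) * S * (2 * ‖s‖) := by
      gcongr; linarith
    nlinarith
  have hFd : DifferentiableOn ℂ F (Set.uIcc (1 - κ) c ×ℂ Set.uIcc (-T) T) := by
    intro s hs
    rw [Set.uIcc_of_le (by linarith), Set.uIcc_of_le (by linarith), Complex.mem_reProdIm] at hs
    have hre := hs.1.1
    have hne : riemannZeta₁ s ≠ 0 := by
      refine (hA T hT s ?_ (hs.1.2.trans hc2) (abs_le.mpr hs.2)).1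
      have : 0 < κ₀ * T ^ (-ε) := by positivity
      linarith
    have hs0 : s ≠ 0 := by rintro rfl; simp at hre; linarith
    refine DifferentiableAt.differentiableWithinAt ?_
    have hd : DifferentiableAt ℂ (deriv riemannZeta₁) s := differentiable_riemannZeta₁.deriv s
    have hd' : DifferentiableAt ℂ riemannZeta₁ s := differentiable_riemannZeta₁ s
    rw [hF, hH]
    refine DifferentiableAt.mul ?_ ?_
    · exact (((hd.div hd' hne).neg).sub_const 1).div differentiableAt_id hs0
    · unfold gaussKernel; fun_prop
  have hrect := Complex.integral_boundary_rect_eq_zero_of_differentiableOn F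
    ((1 - κ : ℝ) + (-T : ℝ) * Complex.I) (c + T * Complex.I) (by simpa using hFd)
  simp only [Complex.add_re, Complex.ofReal_re, Complex.mul_re, Complex.I_re, mul_zero,
    Complex.ofReal_im, Complex.I_im, mul_one, sub_self, add_zero, Complex.add_im,
    Complex.mul_im, zero_add] at hrect
  set E₁ := Real.exp (-(κ * X)) with hE₁
  set E₂ := Real.exp (-(δ ^ 2 * T ^ 2 / 2)) with hE₂
  have hE₁0 : 0 < E₁ := Real.exp_pos _
  have hE₂0 : 0 < E₂ := Real.exp_pos _
  have hδ2 : δ ^ 2 ≤ 1 := pow_le_one₀ hδ.le hδ1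
  have hδ20 : 0 < δ ^ 2 := by positivity
  have hXc : X * c = X + 1 := by rw [hc]; field_simp
  have hexp3 : ∀ z : ℝ, z ≤ 3 → Real.exp (X + z) ≤ Real.exp X * Real.exp 3 := fun z hz => by
    rw [← Real.exp_add]; gcongr
  -- the two horizontal sides
  have hhor (t : ℝ) (ht : |t| = T) :
      ‖∫ x in (1 - κ)..c, F (x + t * Complex.I)‖ ≤
        2 * (C + 1) * T * (Real.exp X * Real.exp 3 * E₂) * |c - (1 - κ)| := by
    refine intervalIntegral.norm_integral_le_of_norm_le_const fun x hx => ?_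
    rw [Set.uIoc_of_le (by linarith)] at hx
    rw [hF]
    simp only [norm_mul]
    rw [norm_gaussKernel]
    refine mul_le_mul ?_ ?_ (Real.exp_pos _).le (by positivity)
    · refine hHb T hT _ ?_ ?_ ?_ <;> simp
      · linarith [hx.1]
      · linarith [hx.2]
      · exact ht.le
    · have h1 : X * x + δ ^ 2 / 2 * (x ^ 2 - t ^ 2) ≤ X + 3 + -(δ ^ 2 * T ^ 2 / 2) := by
        have hx1 : X * x ≤ X * c := by gcongr; exact hx.2
        have hx2 : x ^ 2 ≤ 4 := by
          have : 0 < x := by linarith [hx.1]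
          nlinarith [hx.2]
        have ht2 : t ^ 2 = T ^ 2 := by rw [← sq_abs, ht]
        rw [ht2]
        nlinarith
      refine (Real.exp_le_exp.mpr h1).trans ?_
      rw [Real.exp_add, Real.exp_add]
  have hhor' (t : ℝ) (ht : |t| = T) :
      ‖∫ x in (1 - κ)..c, F (x + t * Complex.I)‖ ≤
        4 * (C + 1) * T * (Real.exp X * Real.exp 3 * E₂) := by
    refine (hhor t ht).trans ?_
    have : |c - (1 - κ)| ≤ 2 := by rw [abs_of_nonneg (by linarith)]; linarith
    calc _ ≤ 2 * (C + 1) * T * (Real.exp X * Real.exp 3 * E₂) * 2 := by gcongr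
      _ = _ := by ring
  -- the left side
  have hleft : ‖∫ t in (-T)..T, F ((1 - κ : ℝ) + t * Complex.I)‖ ≤
      2 * (C + 1) * T * (Real.exp X * Real.exp 3 * E₁) * |T - (-T)| := by
    refine intervalIntegral.norm_integral_le_of_norm_le_const fun t ht => ?_
    rw [Set.uIoc_of_le (by linarith)] at ht
    rw [hF]
    simp only [norm_mul]
    rw [norm_gaussKernel]
    refine mul_le_mul ?_ ?_ (Real.exp_pos _).le (by positivity)
    · refine hHb T hT _ ?_ ?_ ?_ <;> simp
      · linarith
      · linarith
      · exact abs_le.mpr ⟨ht.1.le, ht.2⟩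
    · have h1 : X * (1 - κ) + δ ^ 2 / 2 * ((1 - κ) ^ 2 - t ^ 2) ≤ X + 3 + -(κ * X) := by
        have hx2 : (1 - κ) ^ 2 ≤ 1 := by nlinarith
        nlinarith [sq_nonneg t]
      refine (Real.exp_le_exp.mpr h1).trans ?_
      rw [Real.exp_add, Real.exp_add]
  rw [abs_of_nonneg (by linarith), show T - -T = 2 * T by ring] at hleft
  -- the truncated integral on the line `Re s = c`
  have hmid : ‖∫ t in (-T)..T, F (c + t * Complex.I)‖ ≤
      4 * (C + 1) * T ^ 2 * (Real.exp X * Real.exp 3 * E₁) +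
        8 * (C + 1) * T * (Real.exp X * Real.exp 3 * E₂) := by
    have h1 := hhor' (-T) (by rw [abs_neg, abs_of_pos hT0])
    have h2 := hhor' T (abs_of_pos hT0)
    have h3 : Complex.I • ∫ t in (-T)..T, F (c + t * Complex.I) =
        Complex.I • (∫ t in (-T)..T, F ((1 - κ : ℝ) + t * Complex.I))
        + (∫ x in (1 - κ)..c, F (x + T * Complex.I))
        - ∫ x in (1 - κ)..c, F (x + (-T : ℝ) * Complex.I) := by
      linear_combination hrect
    have h4 := congrArg norm h3
    rw [norm_smul, Complex.norm_I, one_mul] at h4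
    rw [h4]
    refine (norm_sub_le _ _).trans ((add_le_add_left (norm_add_le _ _) _).trans ?_)
    rw [norm_smul, Complex.norm_I, one_mul]
    nlinarith
  -- the two tails on the line `Re s = c`
  have hFt (t : ℝ) (ht : T ≤ |t|) : ‖F (c + t * Complex.I)‖ ≤
      2 * (C + 1) * (Real.exp X * Real.exp 3) * (|t| * Real.exp (-(δ ^ 2 / 2) * |t| ^ 2)) := by
    rw [hF]
    simp only [norm_mul]
    rw [norm_gaussKernel]
    have h1 : ‖H (c + t * Complex.I)‖ ≤ 2 * (C + 1) * |t| := by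
      have ht0 : 0 < |t| := by linarith
      refine hHb |t| (hT.trans ht) _ ?_ ?_ ?_ <;> simp
      · have : 0 < κ₀ / 2 * |t| ^ (-ε) := by positivity
        linarith
      · exact hc2
    have h2 : Real.exp (X * c + δ ^ 2 / 2 * (c ^ 2 - t ^ 2)) ≤
        Real.exp X * Real.exp 3 * Real.exp (-(δ ^ 2 / 2) * |t| ^ 2) := by
      rw [← Real.exp_add, ← Real.exp_add, sq_abs]
      refine Real.exp_le_exp.mpr ?_
      have hx2 : c ^ 2 ≤ 4 := by nlinarith
      nlinarith
    calc _ ≤ 2 * (C + 1) * |t| * (Real.exp X * Real.exp 3 * Real.exp (-(δ ^ 2 / 2) * |t| ^ 2)) := by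
          gcongr
      _ = _ := by ring
  obtain ⟨hti, htv⟩ := integral_Ioi_mul_exp_neg_sq (b := δ ^ 2 / 2) (by positivity) T hT0.le
  have hti' := hti.const_mul (2 * (C + 1) * (Real.exp X * Real.exp 3))
  have hFc : Continuous fun t : ℝ => F (c + t * Complex.I) := by
    refine continuous_iff_continuousAt.mpr fun t => ?_
    have hre : 1 < ((c : ℂ) + t * Complex.I).re := by simpa using hc1
    have hs0 : (c : ℂ) + t * Complex.I ≠ 0 := by
      intro h; rw [h] at hre; simp at hre; linarith
    have hs1 : (c : ℂ) + t * Complex.I ≠ 1 := by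
      intro h; rw [h] at hre; simp at hre
    have hne : riemannZeta₁ (c + t * Complex.I) ≠ 0 := by
      have := riemannZeta_ne_zero_of_one_lt_re hre
      rw [riemannZeta_eq_inv_sub_mul hs1] at this
      exact (mul_ne_zero_iff.mp this).2
    have hcs : ContinuousAt F (c + t * Complex.I) := by
      rw [hF, hH]
      refine ContinuousAt.mul ((ContinuousAt.sub (ContinuousAt.neg (ContinuousAt.div
        differentiable_riemannZeta₁.deriv.continuous.continuousAt
        differentiable_riemannZeta₁.continuous.continuousAt hne)) continuousAt_const).div
        continuousAt_id hs0) ?_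
      unfold gaussKernel; fun_prop
    exact ContinuousAt.comp (f := fun t : ℝ => (c : ℂ) + t * Complex.I) hcs (by fun_prop)
  have hright : IntegrableOn (fun t : ℝ => F (c + t * Complex.I)) (Set.Ioi T) ∧
      ‖∫ t in Set.Ioi T, F (c + t * Complex.I)‖ ≤
        2 * (C + 1) * (Real.exp X * Real.exp 3) * ((δ ^ 2)⁻¹ * E₂) := by
    have hae : ∀ᵐ t : ℝ ∂volume.restrict (Set.Ioi T), ‖F (c + t * Complex.I)‖ ≤
        2 * (C + 1) * (Real.exp X * Real.exp 3) * (t * Real.exp (-(δ ^ 2 / 2) * t ^ 2)) := by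
      filter_upwards [ae_restrict_mem measurableSet_Ioi] with t ht
      have ht' : T < t := ht
      have := hFt t (by rw [abs_of_pos (by linarith)]; exact ht'.le)
      rwa [abs_of_pos (by linarith : 0 < t)] at this
    refine ⟨hti'.mono' hFc.aestronglyMeasurable hae, ?_⟩
    refine (norm_integral_le_of_norm_le hti' hae).trans (le_of_eq ?_)
    rw [integral_const_mul, htv, hE₂]
    rw [show -(δ ^ 2 / 2) * T ^ 2 = -(δ ^ 2 * T ^ 2 / 2) by ring]
    field_simp
  have hleft' : IntegrableOn (fun t : ℝ => F (c + t * Complex.I)) (Set.Iic (-T)) ∧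
      ‖∫ t in Set.Iic (-T), F (c + t * Complex.I)‖ ≤
        2 * (C + 1) * (Real.exp X * Real.exp 3) * ((δ ^ 2)⁻¹ * E₂) := by
    have hae : ∀ᵐ t : ℝ ∂volume.restrict (Set.Ioi T), ‖F (c + (-t : ℝ) * Complex.I)‖ ≤
        2 * (C + 1) * (Real.exp X * Real.exp 3) * (t * Real.exp (-(δ ^ 2 / 2) * t ^ 2)) := by
      filter_upwards [ae_restrict_mem measurableSet_Ioi] with t ht
      have ht' : T < t := ht
      have := hFt (-t) (by rw [abs_neg, abs_of_pos (by linarith)]; exact ht'.le)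
      rwa [abs_neg, abs_of_pos (by linarith : 0 < t)] at this
    have hi : IntegrableOn (fun t : ℝ => F (c + (-t : ℝ) * Complex.I)) (Set.Ioi T) :=
      hti'.mono' (hFc.comp continuous_neg).aestronglyMeasurable hae
    constructor
    · have hi' := Iff.mpr integrableOn_Ici_iff_integrableOn_Ioi hi
      have := IntegrableOn.comp_neg_Iic (c := -T) (by rwa [neg_neg])
      simpa using this
    · rw [← integral_comp_neg_Ioi T (fun t : ℝ => F (c + t * Complex.I))]
      refine (norm_integral_le_of_norm_le hti' hae).trans (le_of_eq ?_)
      rw [integral_const_mul, htv, hE₂]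
      rw [show -(δ ^ 2 / 2) * T ^ 2 = -(δ ^ 2 * T ^ 2 / 2) by ring]
      field_simp
  have hsplit : ∫ t : ℝ, F (c + t * Complex.I) = (∫ t in Set.Iic (-T), F (c + t * Complex.I)) +
      (∫ t in (-T)..T, F (c + t * Complex.I)) + ∫ t in Set.Ioi T, F (c + t * Complex.I) := by
    have hmi : IntegrableOn (fun t : ℝ => F (c + t * Complex.I)) (Set.Ioc (-T) T) :=
      hFc.integrableOn_Ioc
    have hu : Set.Ioi (-T) = Set.Ioc (-T) T ∪ Set.Ioi T :=
      (Set.Ioc_union_Ioi_eq_Ioi (by linarith)).symm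
    have hIoi : IntegrableOn (fun t : ℝ => F (c + t * Complex.I)) (Set.Ioi (-T)) := by
      rw [hu]; exact hmi.union hright.1
    rw [← intervalIntegral.integral_Iic_add_Ioi hleft'.1 hIoi, hu,
      setIntegral_union (Set.Ioc_disjoint_Ioi le_rfl) measurableSet_Ioi hmi hright.1,
      intervalIntegral.integral_of_le (by linarith)]
    ring
  have hfin := integral_psiErr_mul_gaussian (X := X) hδ hc1
  have hnorm := congrArg norm hfin
  rw [Complex.norm_real, Real.norm_eq_abs] at hnorm
  rw [hnorm]
  change ‖_ * ∫ t : ℝ, F (c + t * Complex.I)‖ ≤ _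
  rw [hsplit, norm_mul]
  have hpi : ‖(2 * Real.pi : ℂ)⁻¹‖ ≤ 1 := by
    rw [norm_inv, norm_mul, Complex.norm_real, Real.norm_of_nonneg Real.pi_pos.le]
    refine inv_le_one_of_one_le₀ ?_
    have := Real.pi_gt_three
    simp; linarith
  have htot := norm_add₃_le (a := ∫ t in Set.Iic (-T), F (c + t * Complex.I))
    (b := ∫ t in (-T)..T, F (c + t * Complex.I)) (c := ∫ t in Set.Ioi T, F (c + t * Complex.I))
  have hκX : κ * X = κ₀ / 2 * T ^ (-ε) * X := by rw [hκ]
  calc _ ≤ 1 * (2 * (C + 1) * (Real.exp X * Real.exp 3) * ((δ ^ 2)⁻¹ * E₂) +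
        (4 * (C + 1) * T ^ 2 * (Real.exp X * Real.exp 3 * E₁) +
        8 * (C + 1) * T * (Real.exp X * Real.exp 3 * E₂)) +
        2 * (C + 1) * (Real.exp X * Real.exp 3) * ((δ ^ 2)⁻¹ * E₂)) := by
        refine mul_le_mul hpi (htot.trans ?_) (norm_nonneg _) zero_le_one
        linarith [hright.2, hleft'.2]
    _ = (C + 1) * (Real.exp X * Real.exp 3) *
        (4 * (T ^ 2 * E₁) + (8 * T + 4 * (δ ^ 2)⁻¹) * E₂) := by ring
    _ ≤ (C + 1) * (Real.exp X * Real.exp 3) *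
        (100 * (T ^ 2 * E₁) + (100 * T + 100 * (δ ^ 2)⁻¹) * E₂) := by
        gcongr <;> norm_num
    _ = _ := by rw [hE₁, hκX]; ring

end

noncomputable section

lemma exp_neg_le_factorial_div {z : ℝ} (hz : 0 < z) (n : ℕ) :
    Real.exp (-z) ≤ n.factorial / z ^ n := by
  have h := Real.pow_div_factorial_le_exp z hz.le n
  rw [Real.exp_neg, inv_eq_one_div, div_le_div_iff₀ (Real.exp_pos z) (by positivity), one_mul]
  rwa [div_le_iff₀ (by positivity), mul_comm] at h

/-- Gaussian means of `psiErr` with standard deviation `Y ^ (-2A)` around points close to `Y`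
save a factor `Y ^ A`. -/
lemma exists_abs_gaussian_mean_psiErr_le_div_pow (A : ℕ) (hA : 1 ≤ A) :
    ∃ K : ℝ, 0 < K ∧ ∀ X Y δ : ℝ, 2 ≤ Y → |X - Y| ≤ 1 → δ = (1 / Y ^ A) ^ 2 →
      |∫ v in Set.Ioi (0 : ℝ),
          psiErr v * ProbabilityTheory.gaussianPDFReal X (.mk (δ ^ 2) (sq_nonneg δ)) v| ≤
        K * Real.exp Y * (1 / Y ^ A) := by
  have hA0 : (0 : ℝ) < A := by exact_mod_cast hA
  have hA1 : (1 : ℝ) ≤ A := by exact_mod_cast hA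
  obtain ⟨K, κ, hK, hκ, h⟩ := exists_abs_gaussian_mean_psiErr_le (ε := 1 / (8 * A))
    (by positivity) (by rw [div_le_one (by positivity)]; linarith)
  set n := 18 * A with hn
  refine ⟨K * Real.exp 1 * ((n.factorial : ℝ) / (κ / 2) ^ n + 16), by positivity,
    fun X Y δ hY hXY hδ => ?_⟩
  have hY0 : 0 < Y := by linarith
  have hY1 : 1 ≤ Y := by linarith
  have hXY' := abs_le.mp hXY
  have hYA : 1 ≤ Y ^ A := one_le_pow₀ hY1
  have hδ0 : 0 < δ := by rw [hδ]; positivity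
  have hδ1 : δ ≤ 1 := by
    rw [hδ]; exact pow_le_one₀ (by positivity) (by rw [div_le_one (by positivity)]; exact hYA)
  have h1 := h X δ (Y ^ (4 * A)) (by linarith) hδ0 hδ1 (one_le_pow₀ hY1)
  have hT : (Y ^ (4 * A)) ^ (-(1 / (8 * (A : ℝ)))) = (√Y)⁻¹ := by
    rw [← Real.rpow_natCast, ← Real.rpow_mul hY0.le, Real.sqrt_eq_rpow, ← Real.rpow_neg hY0.le]
    congr 1
    push_cast
    field_simp
    norm_num
  have hδT : δ ^ 2 * (Y ^ (4 * A)) ^ 2 = Y ^ (4 * A) := by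
    rw [hδ]; field_simp
    ring
  have hδi : (δ ^ 2)⁻¹ = Y ^ (4 * A) := by
    rw [hδ]; field_simp
    ring
  rw [hT, hδT, hδi] at h1
  refine h1.trans ?_
  have hsq : 0 < √Y := Real.sqrt_pos.mpr hY0
  have hss : √Y * √Y = Y := Real.mul_self_sqrt hY0.le
  -- the main saving
  have e1 : (Y ^ (4 * A)) ^ 2 * Real.exp (-(κ * (√Y)⁻¹ * X)) ≤
      (n.factorial : ℝ) / (κ / 2) ^ n * (1 / Y ^ A) := by
    have hz : κ / 2 * √Y ≤ κ * (√Y)⁻¹ * X := by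
      have : Y / 2 ≤ X := by linarith
      calc κ / 2 * √Y = κ * (√Y)⁻¹ * ((√Y * √Y) / 2) := by field_simp
        _ ≤ κ * (√Y)⁻¹ * X := by rw [hss]; gcongr
    have h3 : Real.exp (-(κ * (√Y)⁻¹ * X)) ≤ n.factorial / (κ / 2 * √Y) ^ n :=
      (Real.exp_le_exp.mpr (neg_le_neg hz)).trans (exp_neg_le_factorial_div (by positivity) n)
    have h4 : (√Y) ^ n = Y ^ (9 * A) := by
      rw [hn, show 18 * A = 2 * (9 * A) by ring, pow_mul, Real.sq_sqrt hY0.le]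
    rw [mul_pow, h4] at h3
    calc _ ≤ (Y ^ (4 * A)) ^ 2 * (n.factorial / ((κ / 2) ^ n * Y ^ (9 * A))) := by gcongr
      _ = _ := by
        have : Y ^ (9 * A) = Y ^ A * (Y ^ (4 * A)) ^ 2 := by ring
        rw [this]; field_simp
  have e2 : (Y ^ (4 * A) + Y ^ (4 * A)) * Real.exp (-(Y ^ (4 * A) / 2)) ≤ 16 * (1 / Y ^ A) := by
    set w := Y ^ (4 * A) with hw
    have hw0 : 0 < w := by positivity
    have h3 := exp_neg_le_factorial_div (z := w / 2) (by positivity) 2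
    have hwA : Y ^ A ≤ w := pow_le_pow_right₀ hY1 (by omega)
    calc (w + w) * Real.exp (-(w / 2)) ≤ (w + w) * ((2 : ℕ).factorial / (w / 2) ^ 2) := by gcongr
      _ = 16 * (1 / w) := by simp [Nat.factorial]; field_simp; norm_num
      _ ≤ 16 * (1 / Y ^ A) := by gcongr
  have e3 : Real.exp X ≤ Real.exp Y * Real.exp 1 := by
    rw [← Real.exp_add]; gcongr; linarith
  calc _ ≤ K * (Real.exp Y * Real.exp 1) *
        ((n.factorial : ℝ) / (κ / 2) ^ n * (1 / Y ^ A) + 16 * (1 / Y ^ A)) := by gcongr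
    _ = _ := by ring

lemma integral_exp_mul_gaussianReal (X δ a : ℝ) :
    ∫ v, Real.exp (a * v) ∂(ProbabilityTheory.gaussianReal X (.mk (δ ^ 2) (sq_nonneg δ))) =
      Real.exp (X * a + δ ^ 2 * a ^ 2 / 2) := by
  have := congrFun (ProbabilityTheory.mgf_id_gaussianReal (μ := X)
    (v := .mk (δ ^ 2) (sq_nonneg δ))) a
  simpa [ProbabilityTheory.mgf] using this

set_option maxHeartbeats 1000000 in
/-- The prime number theorem with an error term saving an arbitrary power of `log u`, in the
variable `Y = log u`: as `ψ` is monotone, `ψ(exp Y)` is compared with Gaussian means of `ψ` around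
points slightly to the right and to the left of `Y`. -/
lemma exists_abs_psiErr_le (A : ℕ) (hA : 1 ≤ A) :
    ∃ K : ℝ, 0 < K ∧ ∀ Y : ℝ, 2 ≤ Y → |psiErr Y| ≤ K * Real.exp Y * (1 / Y ^ A) := by
  obtain ⟨K, hK, h⟩ := exists_abs_gaussian_mean_psiErr_le_div_pow A hA
  refine ⟨K + 100 + A.factorial, by positivity, fun Y hY => ?_⟩
  have hY0 : 0 < Y := by linarith
  set η := 1 / Y ^ A with hη
  have hYA : 2 ≤ Y ^ A := by
    calc (2 : ℝ) ≤ Y := hY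
      _ ≤ Y ^ A := le_self_pow₀ (by linarith) (by omega)
  have hη0 : 0 < η := by positivity
  have hη2 : η ≤ 1 / 2 := by rw [hη]; gcongr
  set δ := η ^ 2 with hδ
  have hδ0 : 0 < δ := by positivity
  have hδη : δ ≤ η := by rw [hδ]; nlinarith
  have hYη : Real.exp (-Y) ≤ A.factorial * η := by
    have := exp_neg_le_factorial_div hY0 A
    rw [hη]; calc _ ≤ _ := this
      _ = _ := by ring
  have hηe : Real.exp (-(1 / η)) ≤ η := by
    have := exp_neg_le_factorial_div (z := 1 / η) (by positivity) 1
    simpa using this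
  have hvar : (NNReal.mk (δ ^ 2) (sq_nonneg δ)) ≠ 0 := by
    intro h0
    have h1 : δ ^ 2 = 0 := congrArg NNReal.toReal h0
    have h2 : δ ^ 2 ≠ 0 := by positivity
    exact h2 h1
  set f : ℝ → ℝ := fun v => Chebyshev.psi (Real.exp v) with hf
  have hf0 (v : ℝ) : 0 ≤ f v := Chebyshev.psi_nonneg _
  have hfm : Monotone f := Chebyshev.psi_mono.comp Real.exp_strictMono.monotone
  have hf6 (v : ℝ) : f v ≤ 6 * Real.exp v := psi_exp_le v
  -- the Gaussian mean of `psiErr` in terms of those of `f` and of `exp`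
  have hmean (X : ℝ) : ∃ m : ℝ,
      (∫ v in Set.Ioi (0 : ℝ), psiErr v *
          ProbabilityTheory.gaussianPDFReal X (.mk (δ ^ 2) (sq_nonneg δ)) v) =
        (∫ v, f v ∂(ProbabilityTheory.gaussianReal X (.mk (δ ^ 2) (sq_nonneg δ)))) - m ∧
      Integrable f (ProbabilityTheory.gaussianReal X (.mk (δ ^ 2) (sq_nonneg δ))) ∧
      Real.exp (X + δ ^ 2 / 2) - 1 ≤ m ∧ m ≤ Real.exp (X + δ ^ 2 / 2) := by
    set P := ProbabilityTheory.gaussianReal X (.mk (δ ^ 2) (sq_nonneg δ)) with hP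
    have hexp : Integrable (fun v => Real.exp v) P := by
      simpa using ProbabilityTheory.integrable_exp_mul_gaussianReal (μ := X)
        (v := .mk (δ ^ 2) (sq_nonneg δ)) 1
    have hfi : Integrable f P := by
      refine (hexp.const_mul 6).mono' hfm.measurable.aestronglyMeasurable
        (Filter.Eventually.of_forall fun v => ?_)
      rw [Real.norm_of_nonneg (hf0 v)]; exact hf6 v
    have hE : ∫ v, Real.exp v ∂P = Real.exp (X + δ ^ 2 / 2) := by
      simpa using integral_exp_mul_gaussianReal X δ 1
    refine ⟨∫ v in Set.Ioi 0, Real.exp v ∂P, ?_, hfi, ?_, ?_⟩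
    · rw [← integral_indicator measurableSet_Ioi]
      have e1 : (∫ v, (Set.Ioi (0 : ℝ)).indicator (fun v => psiErr v *
          ProbabilityTheory.gaussianPDFReal X (.mk (δ ^ 2) (sq_nonneg δ)) v) v) =
          ∫ v, (Set.Ioi (0 : ℝ)).indicator psiErr v ∂P := by
        rw [hP, ProbabilityTheory.integral_gaussianReal_eq_integral_smul hvar]
        refine integral_congr_ae (Filter.Eventually.of_forall fun v => ?_)
        by_cases hv : v ∈ Set.Ioi (0 : ℝ) <;> simp [hv, mul_comm]
      rw [e1, ← integral_indicator (μ := P) measurableSet_Ioi, ← integral_sub hfi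
        (hexp.indicator measurableSet_Ioi)]
      refine integral_congr_ae (Filter.Eventually.of_forall fun v => ?_)
      by_cases hv : v ∈ Set.Ioi (0 : ℝ)
      · simp [hv, psiErr, hf]
      · have : f v = 0 := by
          refine Chebyshev.psi_eq_zero_of_le_one ?_
          rw [Real.exp_le_one_iff]; simpa using hv
        simp [hv, this]
    · have h1 := integral_add_compl (μ := P) (s := Set.Ioi (0 : ℝ)) measurableSet_Ioi hexp
      have h2 : ∫ v in (Set.Ioi (0 : ℝ))ᶜ, Real.exp v ∂P ≤ 1 := by
        have h3 : ∫ v in (Set.Ioi (0 : ℝ))ᶜ, Real.exp v ∂P ≤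
            ∫ v in (Set.Ioi (0 : ℝ))ᶜ, (1 : ℝ) ∂P := by
          refine setIntegral_mono_on hexp.integrableOn (integrable_const _).integrableOn
            measurableSet_Ioi.compl fun v hv => ?_
          rw [Real.exp_le_one_iff]; simpa using hv
        refine h3.trans ?_
        rw [setIntegral_const, smul_eq_mul, mul_one]
        exact measureReal_le_one
      rw [hE] at h1
      linarith
    · rw [← hE]
      exact setIntegral_le_integral hexp (Filter.Eventually.of_forall fun v => (Real.exp_pos v).le)
  have hexpη {z : ℝ} (hz : |z| ≤ 1) : |Real.exp z - 1| ≤ 2 * |z| := Real.abs_exp_sub_one_le hz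
  have heY : 0 < Real.exp Y := Real.exp_pos Y
  have hδη2 : δ ^ 2 / 2 ≤ η / 2 := by nlinarith
  have hdi : 1 / δ * η = 1 / η := by rw [hδ]; field_simp
  have hint (X a : ℝ) := ProbabilityTheory.integrable_exp_mul_gaussianReal (μ := X)
    (v := .mk (δ ^ 2) (sq_nonneg δ)) a
  -- upper bound
  have hup : psiErr Y ≤ (K + 100 + A.factorial) * Real.exp Y * η := by
    obtain ⟨m, h1, hfi, h2, h3⟩ := hmean (Y + η)
    set P := ProbabilityTheory.gaussianReal (Y + η) (.mk (δ ^ 2) (sq_nonneg δ)) with hP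
    have h4 := (abs_le.mp (h (Y + η) Y δ hY (by
      rw [add_sub_cancel_left, abs_of_pos hη0]; linarith) rfl)).2
    rw [h1] at h4
    have h5 : f Y - f Y * (Real.exp (Y / δ) *
        Real.exp ((Y + η) * (-(1 / δ)) + δ ^ 2 * (-(1 / δ)) ^ 2 / 2)) ≤ ∫ v, f v ∂P := by
      rw [← integral_exp_mul_gaussianReal, ← integral_const_mul, ← integral_const_mul]
      have hi := (((hint (Y + η) (-(1 / δ))).const_mul (Real.exp (Y / δ))).const_mul (f Y))
      have e : f Y = ∫ v, f Y ∂P := by simp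
      nth_rewrite 1 [e]
      rw [← integral_sub (integrable_const _) hi]
      refine integral_mono ((integrable_const _).sub hi) hfi fun v => ?_
      simp only
      have e6 : Real.exp (Y / δ) * Real.exp (-(1 / δ) * v) = Real.exp ((Y - v) / δ) := by
        rw [← Real.exp_add]; congr 1; ring
      rw [e6]
      rcases le_total Y v with hv | hv
      · have := hfm hv
        have : 0 ≤ f Y * Real.exp ((Y - v) / δ) := mul_nonneg (hf0 Y) (Real.exp_pos _).le
        linarith
      · have h6 : 1 ≤ Real.exp ((Y - v) / δ) :=
          Real.one_le_exp (div_nonneg (by linarith) hδ0.le)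
        nlinarith [hf0 v, hf0 Y]
    have h7 : Real.exp (Y / δ) *
        Real.exp ((Y + η) * (-(1 / δ)) + δ ^ 2 * (-(1 / δ)) ^ 2 / 2) ≤ 2 * η := by
      rw [← Real.exp_add]
      have e : Y / δ + ((Y + η) * (-(1 / δ)) + δ ^ 2 * (-(1 / δ)) ^ 2 / 2) =
          -(1 / η) + 1 / 2 := by
        rw [← hdi]; field_simp; ring
      rw [e, Real.exp_add]
      have h8 : Real.exp (1 / 2) ≤ 2 := by
        have h9 := (abs_le.mp (hexpη (z := 1 / 4) (by norm_num [abs_of_pos]))).2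
        rw [abs_of_pos (by norm_num : (0 : ℝ) < 1 / 4)] at h9
        have h10 : Real.exp (1 / 4) ≤ 1 + 1 / 3 := by
          have := Real.exp_bound_div_one_sub_of_interval (x := 1 / 4) (by norm_num) (by norm_num)
          norm_num at this ⊢; linarith
        rw [show (1 / 2 : ℝ) = 1 / 4 + 1 / 4 by norm_num, Real.exp_add]
        nlinarith [Real.exp_pos (1 / 4 : ℝ)]
      calc _ ≤ η * 2 := by gcongr
        _ = _ := by ring
    have h9 : Real.exp (Y + η + δ ^ 2 / 2) ≤ Real.exp Y * (1 + 4 * η) := by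
      have h10 := (abs_le.mp (hexpη (z := η + δ ^ 2 / 2) (by
        rw [abs_of_pos (by positivity)]; linarith))).2
      rw [abs_of_pos (by positivity)] at h10
      rw [add_assoc, Real.exp_add]
      gcongr
      linarith
    have e : psiErr Y = f Y - Real.exp Y := rfl
    have h11 : f Y * (Real.exp (Y / δ) *
        Real.exp ((Y + η) * (-(1 / δ)) + δ ^ 2 * (-(1 / δ)) ^ 2 / 2)) ≤
        6 * Real.exp Y * (2 * η) := mul_le_mul (hf6 Y) h7 (by positivity) (by positivity)
    rw [e]
    have : 0 < Real.exp Y * η := by positivity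
    have : 0 ≤ (A.factorial : ℝ) * (Real.exp Y * η) := by positivity
    nlinarith
  have hlo : -((K + 100 + A.factorial) * Real.exp Y * η) ≤ psiErr Y := by
    obtain ⟨m, h1, hfi, h2, h3⟩ := hmean (Y - η)
    set P := ProbabilityTheory.gaussianReal (Y - η) (.mk (δ ^ 2) (sq_nonneg δ)) with hP
    have h4 := (abs_le.mp (h (Y - η) Y δ hY (by
      rw [show Y - η - Y = -η by ring, abs_neg, abs_of_pos hη0]; linarith) rfl)).1
    rw [h1] at h4
    have h5 : ∫ v, f v ∂P ≤ f Y + 6 * (Real.exp (-(Y / δ)) *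
        Real.exp ((Y - η) * (1 + 1 / δ) + δ ^ 2 * (1 + 1 / δ) ^ 2 / 2)) := by
      rw [← integral_exp_mul_gaussianReal, ← integral_const_mul, ← integral_const_mul]
      have hi := (((hint (Y - η) (1 + 1 / δ)).const_mul (Real.exp (-(Y / δ)))).const_mul 6)
      have e : f Y = ∫ v, f Y ∂P := by simp
      rw [e, ← integral_add (integrable_const _) hi]
      refine integral_mono hfi ((integrable_const _).add hi) fun v => ?_
      simp only
      rcases le_total v Y with hv | hv
      · have := hfm hv
        have : 0 < 6 * (Real.exp (-(Y / δ)) * Real.exp ((1 + 1 / δ) * v)) := by positivity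
        linarith
      · have h6 : Real.exp v ≤ Real.exp (-(Y / δ)) * Real.exp ((1 + 1 / δ) * v) := by
          rw [← Real.exp_add]
          refine Real.exp_le_exp.mpr ?_
          have : 0 ≤ (v - Y) / δ := div_nonneg (by linarith) hδ0.le
          have e : -(Y / δ) + (1 + 1 / δ) * v = v + (v - Y) / δ := by ring
          linarith
        linarith [hf6 v, hf0 Y]
    have h7 : Real.exp (-(Y / δ)) *
        Real.exp ((Y - η) * (1 + 1 / δ) + δ ^ 2 * (1 + 1 / δ) ^ 2 / 2) ≤ 8 * Real.exp Y * η := by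
      rw [← Real.exp_add]
      have e : -(Y / δ) + ((Y - η) * (1 + 1 / δ) + δ ^ 2 * (1 + 1 / δ) ^ 2 / 2) =
          Y + (-(1 / η)) + ((1 + δ) ^ 2 / 2 - η) := by
        rw [← hdi]; field_simp; ring
      rw [e, Real.exp_add, Real.exp_add]
      have h8 : Real.exp ((1 + δ) ^ 2 / 2 - η) ≤ 8 := by
        have : (1 + δ) ^ 2 / 2 - η ≤ 2 := by nlinarith
        refine (Real.exp_le_exp.mpr this).trans ?_
        rw [show (2 : ℝ) = 1 + 1 by norm_num, Real.exp_add]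
        nlinarith [Real.exp_one_lt_d9, Real.exp_pos 1]
      calc _ ≤ Real.exp Y * η * 8 := by gcongr
        _ = _ := by ring
    have h9 : Real.exp Y * (1 - 2 * η) ≤ Real.exp (Y - η + δ ^ 2 / 2) := by
      have h10 := (abs_le.mp (hexpη (z := -η) (by rw [abs_neg, abs_of_pos hη0]; linarith))).1
      rw [abs_neg, abs_of_pos hη0] at h10
      calc Real.exp Y * (1 - 2 * η) ≤ Real.exp Y * Real.exp (-η) := by gcongr; linarith
        _ = Real.exp (Y - η) := by rw [← Real.exp_add]; congr 1
        _ ≤ _ := by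
          refine Real.exp_le_exp.mpr ?_
          have : 0 ≤ δ ^ 2 := sq_nonneg δ
          linarith
    have h11 : 1 ≤ A.factorial * (Real.exp Y * η) := by
      calc (1 : ℝ) = Real.exp Y * Real.exp (-Y) := by rw [← Real.exp_add]; simp
        _ ≤ Real.exp Y * (A.factorial * η) := by gcongr
        _ = _ := by ring
    have e : psiErr Y = f Y - Real.exp Y := rfl
    rw [e]
    have : 0 < Real.exp Y * η := by positivity
    nlinarith
  exact abs_le.mpr ⟨hlo, hup⟩

/-- The **prime number theorem** with an error term saving an arbitrary power of `log u`. -/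
theorem exists_abs_theta_sub_le (A : ℕ) (hA : 1 ≤ A) :
    ∃ C : ℝ, 0 < C ∧ ∀ u : ℝ, 2 ≤ u → |Chebyshev.theta u - u| ≤ C * (u / Real.log u ^ A) := by
  obtain ⟨K, hK, h⟩ := exists_abs_psiErr_le A hA
  refine ⟨K + 2 * ((A + 1).factorial * 2 ^ (A + 1)) + 2 * 2 ^ A, by positivity, fun u hu => ?_⟩
  have hu0 : 0 < u := by linarith
  have hl0 : 0 < Real.log u := Real.log_pos (by linarith)
  have hq : 0 < u / Real.log u ^ A := by positivity
  rcases le_total 2 (Real.log u) with hl | hl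
  · have h1 := h (Real.log u) hl
    rw [psiErr, Real.exp_log hu0] at h1
    have h2 := Chebyshev.psi_sub_theta_le (x := u) (by linarith)
    have h3 := Chebyshev.theta_le_psi u
    have h4 : √u * Real.log u ≤ (A + 1).factorial * 2 ^ (A + 1) * (u / Real.log u ^ A) := by
      have h5 := exp_neg_le_factorial_div (z := Real.log u / 2) (by positivity) (A + 1)
      have h6 : Real.exp (-(Real.log u / 2)) = √u / u := by
        rw [Real.exp_neg, ← Real.log_sqrt hu0.le, Real.exp_log (Real.sqrt_pos.mpr hu0)]
        have := Real.mul_self_sqrt hu0.le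
        have h7 : 0 < √u := Real.sqrt_pos.mpr hu0
        field_simp
        linarith
      rw [h6, div_le_iff₀ hu0] at h5
      calc √u * Real.log u ≤ (A + 1).factorial / (Real.log u / 2) ^ (A + 1) * u * Real.log u := by
            gcongr
        _ = _ := by rw [div_pow]; field_simp; ring
    have h7 := abs_le.mp h1
    have h8 : K * u * (1 / Real.log u ^ A) = K * (u / Real.log u ^ A) := by ring
    rw [h8] at h7
    have : 0 < 2 * 2 ^ A * (u / Real.log u ^ A) := by positivity
    have : 0 < 2 * ((A + 1).factorial * 2 ^ (A + 1)) * (u / Real.log u ^ A) := by positivity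
    rw [abs_le]; constructor <;> linarith
  · have h1 := Chebyshev.theta_le_log4_mul_x hu0.le
    have h2 := Chebyshev.theta_nonneg u
    have h3 : Real.log 4 ≤ 2 := by
      rw [show (4 : ℝ) = 2 ^ 2 by norm_num, Real.log_pow]
      have := Real.log_two_lt_d9
      push_cast; linarith
    have h4 : u ≤ 2 ^ A * (u / Real.log u ^ A) := by
      calc u = Real.log u ^ A * (u / Real.log u ^ A) := by field_simp
        _ ≤ _ := by gcongr
    have h5 : |Chebyshev.theta u - u| ≤ 2 * u := by
      rw [abs_le]; constructor <;> nlinarith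
    have : 0 < 2 * ((A + 1).factorial * 2 ^ (A + 1)) * (u / Real.log u ^ A) := by positivity
    have : 0 < K * (u / Real.log u ^ A) := by positivity
    linarith

end

noncomputable section

/-! ### Sums over primes of smooth decreasing functions -/

lemma sum_primes_mul_log_eq {y : ℝ} (hy : 2 ≤ y) {φ φ' : ℝ → ℝ}
    (hφ : ∀ u ∈ Set.Icc 2 y, HasDerivAt φ (φ' u) u) (hφc : ContinuousOn φ' (Set.Icc 2 y)) :
    ∑ p ∈ (Finset.Icc 1 ⌊y⌋₊).filter Nat.Prime, φ p * Real.log p =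
      φ y * Chebyshev.theta y - ∫ u in (2 : ℝ)..y, φ' u * Chebyshev.theta u := by
  set c : ℕ → ℝ := fun k => if k.Prime then Real.log k else 0 with hc
  have hθ (u : ℝ) : Chebyshev.theta u = ∑ k ∈ Finset.Icc 0 ⌊u⌋₊, c k := by
    rw [Chebyshev.theta_eq_sum_Icc, Finset.sum_filter]
  have hd : Set.EqOn (deriv φ) φ' (Set.Icc 2 y) := fun u hu => (hφ u hu).deriv
  have hint : IntegrableOn (deriv φ) (Set.Icc 2 y) :=
    (hφc.integrableOn_compact isCompact_Icc).congr_fun (fun u hu => (hd hu).symm) measurableSet_Icc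
  have h := sum_mul_eq_sub_sub_integral_mul c (f := φ) (a := 2) (b := y) (by norm_num) hy
    (fun u hu => (hφ u hu).differentiableAt) hint
  simp_rw [← hθ] at h
  have h1 : ∫ t in Set.Ioc 2 y, deriv φ t * Chebyshev.theta t =
      ∫ u in (2 : ℝ)..y, φ' u * Chebyshev.theta u := by
    rw [intervalIntegral.integral_of_le hy]
    exact setIntegral_congr_fun measurableSet_Ioc fun u hu => by
      simp only [hd (Set.Ioc_subset_Icc_self hu)]
  have h2 : Chebyshev.theta 2 = Real.log 2 := by
    rw [Chebyshev.theta_eq_sum_Icc]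
    have : (Finset.Icc 0 ⌊(2 : ℝ)⌋₊).filter Nat.Prime = {2} := by
      rw [show ⌊(2 : ℝ)⌋₊ = 2 by norm_num]; decide
    rw [this]; simp
  have hfl : 2 ≤ ⌊y⌋₊ := Nat.le_floor (by exact_mod_cast hy)
  have h3 : ∑ p ∈ (Finset.Icc 1 ⌊y⌋₊).filter Nat.Prime, φ p * Real.log p =
      φ 2 * Real.log 2 + ∑ k ∈ Finset.Ioc ⌊(2 : ℝ)⌋₊ ⌊y⌋₊, φ k * c k := by
    have e1 : (Finset.Icc 1 ⌊y⌋₊).filter Nat.Prime =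
        insert 2 ((Finset.Ioc 2 ⌊y⌋₊).filter Nat.Prime) := by
      ext p
      simp only [Finset.mem_filter, Finset.mem_Icc, Finset.mem_insert, Finset.mem_Ioc]
      constructor
      · rintro ⟨⟨-, h⟩, hp⟩
        rcases hp.two_le.eq_or_lt with h' | h'
        · exact Or.inl h'.symm
        · exact Or.inr ⟨⟨h', h⟩, hp⟩
      · rintro (rfl | ⟨⟨h, h'⟩, hp⟩)
        · exact ⟨⟨by norm_num, hfl⟩, Nat.prime_two⟩
        · exact ⟨⟨by omega, h'⟩, hp⟩
    rw [e1, Finset.sum_insert (by simp), show ⌊(2 : ℝ)⌋₊ = 2 by norm_num, Finset.sum_filter]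
    push_cast
    congr 1
    refine Finset.sum_congr rfl fun k _ => ?_
    simp only [hc]; split_ifs <;> simp
  rw [h3, h, h1, h2]; ring

/-- The prime number theorem for the weighted sum of a nonnegative decreasing function, by partial
summation. -/
theorem exists_abs_sum_primes_mul_log_sub_integral_le (A : ℕ) (hA : 1 ≤ A) :
    ∃ C : ℝ, 0 < C ∧ ∀ (y : ℝ) (φ φ' : ℝ → ℝ), 2 ≤ y →
      (∀ u ∈ Set.Icc 2 y, HasDerivAt φ (φ' u) u) → ContinuousOn φ' (Set.Icc 2 y) →
      (∀ u ∈ Set.Icc 2 y, φ' u ≤ 0) → (∀ u ∈ Set.Icc 2 y, 0 ≤ φ u) →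
      |∑ p ∈ (Finset.Icc 1 ⌊y⌋₊).filter Nat.Prime, φ p * Real.log p - ∫ u in (2 : ℝ)..y, φ u| ≤
        C * (φ 2 + ∫ u in (2 : ℝ)..y, φ u / Real.log u ^ A) := by
  obtain ⟨C, hC, hθ⟩ := exists_abs_theta_sub_le A hA
  have hl2 : 0 < Real.log 2 := Real.log_pos (by norm_num)
  refine ⟨2 + C * (2 / Real.log 2 ^ A) + C, by positivity, fun y φ φ' hy hφ hφc hφ' hφ0 => ?_⟩
  have huIcc : Set.uIcc 2 y = Set.Icc 2 y := Set.uIcc_of_le hy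
  have hlog {u : ℝ} (hu : u ∈ Set.Icc 2 y) : 0 < Real.log u := Real.log_pos (by linarith [hu.1])
  have hφcont : ContinuousOn φ (Set.Icc 2 y) :=
    fun u hu => (hφ u hu).continuousAt.continuousWithinAt
  set E : ℝ → ℝ := fun u => C * (u / Real.log u ^ A) with hE
  set E' : ℝ → ℝ := fun u => C * (1 / Real.log u ^ A - A / Real.log u ^ (A + 1)) with hE'
  have hEd (u : ℝ) (hu : u ∈ Set.Icc 2 y) : HasDerivAt E (E' u) u := by
    have hu0 : u ≠ 0 := by linarith [hu.1]
    have hl := hlog hu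
    have h1 := (Real.hasDerivAt_log hu0).pow A
    refine (((hasDerivAt_id u).div h1 (by rw [Pi.pow_apply]; exact (pow_pos hl A).ne')).const_mul C).congr_deriv ?_
    rw [hE']
    obtain ⟨B, rfl⟩ : ∃ B, A = B + 1 := ⟨A - 1, by omega⟩
    simp only [Nat.add_sub_cancel, id, Pi.pow_apply]
    field_simp
    ring
  have hlogc : ContinuousOn Real.log (Set.Icc 2 y) :=
    Real.continuousOn_log.mono fun u hu => by
      have := hu.1; simp only [Set.mem_compl_iff, Set.mem_singleton_iff]; linarith
  have hlogA (n : ℕ) : ContinuousOn (fun u => (Real.log u ^ n)) (Set.Icc 2 y) := hlogc.pow n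
  have hE'c : ContinuousOn E' (Set.Icc 2 y) :=
    continuousOn_const.mul ((continuousOn_const.div (hlogA A) fun u hu => (pow_pos (hlog hu) _).ne').sub
      (continuousOn_const.div (hlogA (A + 1)) fun u hu => (pow_pos (hlog hu) _).ne'))
  have hEc : ContinuousOn E (Set.Icc 2 y) :=
    fun u hu => (hEd u hu).continuousAt.continuousWithinAt
  have hθi : IntervalIntegrable (fun u => φ' u * Chebyshev.theta u) volume 2 y := by
    have h1 : IntervalIntegrable Chebyshev.theta volume 2 y :=
      (Chebyshev.theta_mono.monotoneOn _).intervalIntegrable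
    exact h1.continuousOn_mul (huIcc ▸ hφc)
  have ii {f : ℝ → ℝ} (hf : ContinuousOn f (Set.Icc 2 y)) : IntervalIntegrable f volume 2 y :=
    ContinuousOn.intervalIntegrable (huIcc ▸ hf)
  have hp1 := intervalIntegral.integral_mul_deriv_eq_deriv_mul (a := 2) (b := y)
    (u := fun u : ℝ => u) (u' := fun _ => 1) (v := φ) (v' := φ')
    (fun u hu => hasDerivAt_id u) (fun u hu => hφ u (huIcc ▸ hu)) (ii continuousOn_const) (ii hφc)
  have hp2 := intervalIntegral.integral_mul_deriv_eq_deriv_mul (a := 2) (b := y)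
    (u := E) (u' := E') (v := φ) (v' := φ')
    (fun u hu => hEd u (huIcc ▸ hu)) (fun u hu => hφ u (huIcc ▸ hu)) (ii hE'c) (ii hφc)
  simp only [one_mul] at hp1
  rw [sum_primes_mul_log_eq hy hφ hφc]
  have hidφ : IntervalIntegrable (fun u => u * φ' u) volume 2 y :=
    ii (continuousOn_id.mul hφc)
  have hD : φ y * Chebyshev.theta y - (∫ u in (2 : ℝ)..y, φ' u * Chebyshev.theta u)
      - ∫ u in (2 : ℝ)..y, φ u = φ y * (Chebyshev.theta y - y) + 2 * φ 2 -
        ∫ u in (2 : ℝ)..y, (φ' u * Chebyshev.theta u - u * φ' u) := by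
    rw [intervalIntegral.integral_sub hθi hidφ]; linarith
  rw [hD]
  have hI : |∫ u in (2 : ℝ)..y, (φ' u * Chebyshev.theta u - u * φ' u)| ≤
      ∫ u in (2 : ℝ)..y, -(E u * φ' u) := by
    rw [← Real.norm_eq_abs]
    refine intervalIntegral.norm_integral_le_of_norm_le hy ?_ (ii (hEc.mul hφc).neg)
    refine Filter.Eventually.of_forall fun u hu => ?_
    have hu' := Set.Ioc_subset_Icc_self hu
    rw [show φ' u * Chebyshev.theta u - u * φ' u = φ' u * (Chebyshev.theta u - u) by ring,
      norm_mul, Real.norm_eq_abs, Real.norm_eq_abs, abs_of_nonpos (hφ' u hu')]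
    have := mul_le_mul_of_nonneg_left (hθ u hu'.1) (neg_nonneg.mpr (hφ' u hu'))
    linarith
  rw [intervalIntegral.integral_neg, hp2] at hI
  have hI2 : ∫ u in (2 : ℝ)..y, E' u * φ u ≤ C * ∫ u in (2 : ℝ)..y, φ u / Real.log u ^ A := by
    rw [← intervalIntegral.integral_const_mul]
    refine intervalIntegral.integral_mono_on hy (ii (hE'c.mul hφcont)) (ii (continuousOn_const.mul
      (hφcont.div (hlogA A) fun u hu => (pow_pos (hlog hu) _).ne'))) fun u hu => ?_
    have hl := hlog hu
    have h0 := hφ0 u hu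
    have h1 : E' u ≤ C * (1 / Real.log u ^ A) := by
      rw [hE']
      have : 0 ≤ (A : ℝ) / Real.log u ^ (A + 1) := by positivity
      have h2 : 1 / Real.log u ^ A - A / Real.log u ^ (A + 1) ≤ 1 / Real.log u ^ A := by linarith
      exact mul_le_mul_of_nonneg_left h2 hC.le
    calc E' u * φ u ≤ C * (1 / Real.log u ^ A) * φ u := by gcongr
      _ = _ := by ring
  have hy1 : |φ y * (Chebyshev.theta y - y)| ≤ E y * φ y := by
    rw [abs_mul, abs_of_nonneg (hφ0 y ⟨hy, le_rfl⟩), mul_comm]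
    exact mul_le_mul_of_nonneg_right (hθ y hy) (hφ0 y ⟨hy, le_rfl⟩)
  have h2 := hφ0 2 ⟨le_rfl, hy⟩
  have hJ : 0 ≤ ∫ u in (2 : ℝ)..y, φ u / Real.log u ^ A :=
    intervalIntegral.integral_nonneg hy fun u hu =>
      div_nonneg (hφ0 u hu) (pow_nonneg (hlog hu).le _)
  have hE2 : E 2 = C * (2 / Real.log 2 ^ A) := rfl
  have hE20 : 0 ≤ E 2 := by rw [hE2]; positivity
  rw [← hE2]
  have habs := abs_sub (φ y * (Chebyshev.theta y - y) + 2 * φ 2)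
    (∫ u in (2 : ℝ)..y, (φ' u * Chebyshev.theta u - u * φ' u))
  have habs2 := abs_add_le (φ y * (Chebyshev.theta y - y)) (2 * φ 2)
  rw [abs_of_nonneg (by linarith : 0 ≤ 2 * φ 2)] at habs2
  have : 0 ≤ E 2 * ∫ u in (2 : ℝ)..y, φ u / Real.log u ^ A := mul_nonneg hE20 hJ
  have : 0 ≤ C * φ 2 := mul_nonneg hC.le h2
  nlinarith

/-- `log x / log u` grows at most like a small power of `x / u`. -/
lemma exists_log_div_log_le {β : ℝ} (hβ : 0 < β) :
    ∃ C : ℝ, 1 ≤ C ∧ ∀ u x : ℝ, 2 ≤ u → u ≤ x →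
      1 / Real.log u ≤ C * (x / u) ^ β / Real.log x := by
  have hl2 : 0 < Real.log 2 := Real.log_pos (by norm_num)
  refine ⟨1 + 1 / (β * Real.log 2), by have : 0 < 1 / (β * Real.log 2) := by positivity
                                       linarith, fun u x hu hx => ?_⟩
  have hu0 : 0 < u := by linarith
  have hx0 : 0 < x := by linarith
  have hlu : Real.log 2 ≤ Real.log u := Real.log_le_log (by norm_num) hu
  have hlu0 : 0 < Real.log u := hl2.trans_le hlu
  have hlx0 : 0 < Real.log x := Real.log_pos (by linarith)
  have hr : 1 ≤ x / u := by rw [one_le_div hu0]; exact hx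
  rw [div_le_div_iff₀ hlu0 hlx0, one_mul]
  have h1 : Real.log x = Real.log u + Real.log (x / u) := by
    rw [Real.log_div hx0.ne' hu0.ne']; ring
  have h2 : Real.log (x / u) ≤ (x / u) ^ β / β := Real.log_le_rpow_div (by linarith) hβ
  have h3 : 1 ≤ (x / u) ^ β := Real.one_le_rpow hr hβ.le
  have h4 : (x / u) ^ β / β ≤ 1 / (β * Real.log 2) * (x / u) ^ β * Real.log u := by
    calc (x / u) ^ β / β = 1 / (β * Real.log 2) * (x / u) ^ β * Real.log 2 := by field_simp
      _ ≤ _ := by gcongr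
  nlinarith

/-- A Chebyshev bound: `∑_{p ≤ y} p^{-σ} ≪ y^{1-σ} / log y` for `0 < σ < 1`. -/
theorem exists_sum_primes_rpow_neg_le {σ : ℝ} (hσ0 : 0 < σ) (hσ1 : σ < 1) :
    ∃ C : ℝ, 0 < C ∧ ∀ y : ℝ, 2 ≤ y →
      ∑ p ∈ (Finset.Icc 1 ⌊y⌋₊).filter Nat.Prime, (p : ℝ) ^ (-σ) ≤
        C * (y ^ (1 - σ) / Real.log y) := by
  obtain ⟨C, hC, h⟩ := exists_abs_sum_primes_mul_log_sub_integral_le 1 le_rfl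
  set β := (1 - σ) / 2 with hβ
  have hβ0 : 0 < β := by rw [hβ]; linarith
  obtain ⟨B, hB, hlog⟩ := exists_log_div_log_le hβ0
  have hl2 : 0 < Real.log 2 := Real.log_pos (by norm_num)
  set D := (1 + C / Real.log 2) with hD
  refine ⟨C * (B * 1) + D * (B / β), by positivity, fun y hy => ?_⟩
  have hy0 : 0 < y := by linarith
  have hly : 0 < Real.log y := Real.log_pos (by linarith)
  have huIcc : Set.uIcc 2 y = Set.Icc 2 y := Set.uIcc_of_le hy
  have hlogu {u : ℝ} (hu : u ∈ Set.Icc 2 y) : 0 < Real.log u := Real.log_pos (by linarith [hu.1])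
  have hu0 {u : ℝ} (hu : u ∈ Set.Icc 2 y) : 0 < u := by linarith [hu.1]
  set φ : ℝ → ℝ := fun u => u ^ (-σ) / Real.log u with hφ
  set φ' : ℝ → ℝ := fun u => (-σ * u ^ (-σ - 1) * Real.log u - u ^ (-σ) * u⁻¹) / Real.log u ^ 2
  have hlogc : ContinuousOn Real.log (Set.Icc 2 y) :=
    Real.continuousOn_log.mono fun u hu => (hu0 hu).ne'
  have hpc (a : ℝ) : ContinuousOn (fun u : ℝ => u ^ a) (Set.Icc 2 y) :=
    fun u hu => (Real.continuousAt_rpow_const u a (Or.inl (hu0 hu).ne')).continuousWithinAt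
  have hφd (u : ℝ) (hu : u ∈ Set.Icc 2 y) : HasDerivAt φ (φ' u) u :=
    (Real.hasDerivAt_rpow_const (Or.inl (hu0 hu).ne')).div (Real.hasDerivAt_log (hu0 hu).ne')
      (hlogu hu).ne'
  have hφc : ContinuousOn φ (Set.Icc 2 y) :=
    fun u hu => (hφd u hu).continuousAt.continuousWithinAt
  have hφ0 (u : ℝ) (hu : u ∈ Set.Icc 2 y) : 0 ≤ φ u :=
    div_nonneg (Real.rpow_nonneg (hu0 hu).le _) (hlogu hu).le
  have h1 := h y φ φ' hy hφd ?_ ?_ hφ0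
  rotate_left
  · refine ContinuousOn.div ?_ (hlogc.pow 2) fun u hu => (pow_pos (hlogu hu) _).ne'
    exact ((continuousOn_const.mul (hpc _)).mul hlogc).sub
      ((hpc _).mul (continuousOn_id.inv₀ fun u hu => (hu0 hu).ne'))
  · intro u hu
    refine div_nonpos_of_nonpos_of_nonneg ?_ (by positivity)
    have e1 : 0 ≤ σ * u ^ (-σ - 1) * Real.log u := by
      have := hlogu hu; have := hu0 hu; positivity
    have e2 : 0 ≤ u ^ (-σ) * u⁻¹ := by have := hu0 hu; positivity
    linarith
  have hsum : ∑ p ∈ (Finset.Icc 1 ⌊y⌋₊).filter Nat.Prime, φ p * Real.log p =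
      ∑ p ∈ (Finset.Icc 1 ⌊y⌋₊).filter Nat.Prime, (p : ℝ) ^ (-σ) := by
    refine Finset.sum_congr rfl fun p hp => ?_
    have hp2 : (1 : ℝ) < p := by exact_mod_cast (Finset.mem_filter.mp hp).2.one_lt
    have := Real.log_pos hp2
    simp only [hφ]
    field_simp
  rw [hsum] at h1
  have ii {f : ℝ → ℝ} (hf : ContinuousOn f (Set.Icc 2 y)) : IntervalIntegrable f volume 2 y :=
    ContinuousOn.intervalIntegrable (huIcc ▸ hf)
  -- both integrals are bounded through `log y / log u ≪ (y / u) ^ β`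
  have hφle (u : ℝ) (hu : u ∈ Set.Icc 2 y) : φ u ≤ B * y ^ β / Real.log y * u ^ (-σ - β) := by
    have h2 := hlog u y hu.1 hu.2
    have h3 : 0 < u ^ (-σ) := Real.rpow_pos_of_pos (hu0 hu) _
    calc φ u = u ^ (-σ) * (1 / Real.log u) := by rw [hφ]; ring
      _ ≤ u ^ (-σ) * (B * (y / u) ^ β / Real.log y) := by gcongr
      _ = _ := by
        rw [Real.div_rpow hy0.le (hu0 hu).le, sub_eq_add_neg, Real.rpow_add (hu0 hu),
          Real.rpow_neg (hu0 hu).le β]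
        ring
  have hint : ∫ u in (2 : ℝ)..y, φ u ≤ B / β * (y ^ (1 - σ) / Real.log y) := by
    have h2 : ∫ u in (2 : ℝ)..y, φ u ≤
        ∫ u in (2 : ℝ)..y, B * y ^ β / Real.log y * u ^ (-σ - β) :=
      intervalIntegral.integral_mono_on hy (ii hφc) (ii (continuousOn_const.mul (hpc _))) hφle
    have e : -σ - β + 1 = β := by rw [hβ]; ring
    rw [intervalIntegral.integral_const_mul, integral_rpow (Or.inl (by linarith)), e] at h2
    refine h2.trans ?_
    have h3 : (0 : ℝ) ≤ 2 ^ β := by positivity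
    calc _ ≤ B * y ^ β / Real.log y * (y ^ β / β) := by
          gcongr; linarith
      _ = B / β * (y ^ (β + β) / Real.log y) := by rw [Real.rpow_add hy0]; ring
      _ = _ := by rw [show β + β = 1 - σ by rw [hβ]; ring]
  have hint2 : ∫ u in (2 : ℝ)..y, φ u / Real.log u ^ 1 ≤
      1 / Real.log 2 * ∫ u in (2 : ℝ)..y, φ u := by
    rw [← intervalIntegral.integral_const_mul]
    refine intervalIntegral.integral_mono_on hy (ii (hφc.div (hlogc.pow 1) fun u hu =>
      (pow_pos (hlogu hu) _).ne')) (ii (continuousOn_const.mul hφc)) fun u hu => ?_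
    have h2 : Real.log 2 ≤ Real.log u := Real.log_le_log (by norm_num) hu.1
    have := hφ0 u hu
    rw [pow_one, div_eq_mul_one_div, mul_comm]
    gcongr
  have h2φ : φ 2 ≤ B * 1 * (y ^ (1 - σ) / Real.log y) := by
    have h2 := hφle 2 ⟨le_rfl, hy⟩
    refine h2.trans ?_
    have e1 : (2 : ℝ) ^ (-σ - β) ≤ 1 :=
      Real.rpow_le_one_of_one_le_of_nonpos (by norm_num) (by linarith)
    have e2 : y ^ β ≤ y ^ (1 - σ) :=
      Real.rpow_le_rpow_of_exponent_le (by linarith) (by rw [hβ]; linarith)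
    calc _ ≤ B * y ^ (1 - σ) / Real.log y * 1 := by gcongr
      _ = _ := by ring
  have h3 := (abs_le.mp h1).2
  set Q := y ^ (1 - σ) / Real.log y
  set J := ∫ u in (2 : ℝ)..y, φ u
  have h4 : C * ∫ u in (2 : ℝ)..y, φ u / Real.log u ^ 1 ≤ C / Real.log 2 * J := by
    calc _ ≤ C * (1 / Real.log 2 * J) := by gcongr
      _ = _ := by ring
  have h5 : C * φ 2 ≤ C * (B * 1 * Q) := by gcongr
  have h6 : D * J ≤ D * (B / β * Q) := by gcongr
  have h7 : D * J = J + C / Real.log 2 * J := by rw [hD]; ring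
  linarith

end

noncomputable section

/-! ### The Bessel function `I₀` and the moments of its logarithm -/

lemma besselIZero_eq_integral_restrict (t : ℝ) : besselIZero t =
    ∫ θ, Real.exp (t * Real.cos (2 * Real.pi * θ)) ∂(volume.restrict (Set.Ioc (0 : ℝ) 1)) := by
  rw [besselIZero, intervalIntegral.integral_of_le zero_le_one]

instance isProbabilityMeasure_restrict_Ioc_zero_one :
    IsProbabilityMeasure (volume.restrict (Set.Ioc (0 : ℝ) 1)) := ⟨by simp⟩

lemma integral_cos_two_pi : ∫ θ in (0 : ℝ)..1, Real.cos (2 * Real.pi * θ) = 0 := by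
  rw [intervalIntegral.integral_comp_mul_left _ (by positivity)]
  simp

lemma integrableExpSet_cos_eq_univ :
    ProbabilityTheory.integrableExpSet (fun θ : ℝ => Real.cos (2 * Real.pi * θ))
      (volume.restrict (Set.Ioc (0 : ℝ) 1)) = Set.univ := by
  refine Set.eq_univ_of_forall fun t => ?_
  exact ProbabilityTheory.integrable_exp_mul_of_mem_Icc (a := -1) (b := 1) (by fun_prop)
    (Filter.Eventually.of_forall fun θ => ⟨Real.neg_one_le_cos _, Real.cos_le_one _⟩)

/-- The derivative of `besselIZero`, as an integral. -/
def besselIOne (t : ℝ) : ℝ :=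
  ∫ θ, Real.cos (2 * Real.pi * θ) * Real.exp (t * Real.cos (2 * Real.pi * θ))
    ∂(volume.restrict (Set.Ioc (0 : ℝ) 1))

lemma hasDerivAt_besselIZero (t : ℝ) : HasDerivAt besselIZero (besselIOne t) t := by
  have h := ProbabilityTheory.hasDerivAt_mgf (X := fun θ : ℝ => Real.cos (2 * Real.pi * θ))
    (μ := volume.restrict (Set.Ioc (0 : ℝ) 1)) (t := t)
    (by rw [integrableExpSet_cos_eq_univ, interior_univ]; trivial)
  have e : besselIZero = ProbabilityTheory.mgf (fun θ : ℝ => Real.cos (2 * Real.pi * θ))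
      (volume.restrict (Set.Ioc (0 : ℝ) 1)) := by
    ext s; rw [besselIZero_eq_integral_restrict, ProbabilityTheory.mgf]
  rw [e]; exact h

lemma continuous_besselIZero : Continuous besselIZero :=
  continuous_iff_continuousAt.mpr fun t => (hasDerivAt_besselIZero t).continuousAt

lemma continuous_besselIOne : Continuous besselIOne := by
  refine continuous_iff_continuousAt.mpr fun t => ?_
  have h := ProbabilityTheory.hasDerivAt_integral_pow_mul_exp_real
    (X := fun θ : ℝ => Real.cos (2 * Real.pi * θ))
    (μ := volume.restrict (Set.Ioc (0 : ℝ) 1)) (t := t)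
    (by rw [integrableExpSet_cos_eq_univ, interior_univ]; trivial) 1
  simp only [pow_one] at h
  exact h.continuousAt

lemma besselIOne_nonneg {t : ℝ} (ht : 0 ≤ t) : 0 ≤ besselIOne t := by
  have h : ∫ θ in (0 : ℝ)..1, Real.cos (2 * Real.pi * θ) ≤ ∫ θ in (0 : ℝ)..1,
      Real.cos (2 * Real.pi * θ) * Real.exp (t * Real.cos (2 * Real.pi * θ)) := by
    refine intervalIntegral.integral_mono_on zero_le_one
      (Continuous.intervalIntegrable (by fun_prop) _ _)
      (Continuous.intervalIntegrable (by fun_prop) _ _) fun θ _ => ?_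
    set c := Real.cos (2 * Real.pi * θ)
    rcases le_total 0 c with hc | hc
    · have := Real.one_le_exp (mul_nonneg ht hc)
      nlinarith
    · have := Real.exp_le_one_iff.mpr (mul_nonpos_of_nonneg_of_nonpos ht hc)
      nlinarith
  rw [integral_cos_two_pi, intervalIntegral.integral_of_le zero_le_one] at h
  exact h

lemma one_lt_besselIZero {t : ℝ} (ht : t ≠ 0) : 1 < besselIZero t := by
  have h : 0 < ∫ θ in (0 : ℝ)..1, (Real.exp (t * Real.cos (2 * Real.pi * θ)) -
      (1 + t * Real.cos (2 * Real.pi * θ))) := by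
    refine intervalIntegral.integral_pos zero_lt_one (by fun_prop) (fun θ _ => ?_)
      ⟨0, by simp, ?_⟩
    · linarith [Real.add_one_le_exp (t * Real.cos (2 * Real.pi * θ))]
    · simp only [mul_zero, Real.cos_zero, mul_one]
      linarith [Real.add_one_lt_exp ht]
  rw [intervalIntegral.integral_sub (Continuous.intervalIntegrable (by fun_prop) _ _)
    (Continuous.intervalIntegrable (by fun_prop) _ _),
    intervalIntegral.integral_add (by simp) (Continuous.intervalIntegrable (by fun_prop) _ _),
    intervalIntegral.integral_const_mul, integral_cos_two_pi] at h
  simp at h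
  exact h

lemma besselIZero_zero : besselIZero 0 = 1 := by simp [besselIZero]

lemma one_le_besselIZero (t : ℝ) : 1 ≤ besselIZero t := by
  rcases eq_or_ne t 0 with rfl | h
  · exact besselIZero_zero.ge
  · exact (one_lt_besselIZero h).le

lemma besselIZero_le_exp_abs (t : ℝ) : besselIZero t ≤ Real.exp |t| := by
  rw [besselIZero]
  have h : ∫ θ in (0 : ℝ)..1, Real.exp (t * Real.cos (2 * Real.pi * θ)) ≤
      ∫ θ in (0 : ℝ)..1, Real.exp |t| := by
    refine intervalIntegral.integral_mono_on zero_le_one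
      (Continuous.intervalIntegrable (by fun_prop) _ _) (by simp) fun θ _ => ?_
    refine Real.exp_le_exp.mpr ((le_abs_self _).trans ?_)
    rw [abs_mul]
    exact mul_le_of_le_one_right (abs_nonneg t) (Real.abs_cos_le_one _)
  simpa using h

/-- Hoeffding's lemma for `cos (2πθ)`. -/
lemma besselIZero_le_exp_sq (t : ℝ) : besselIZero t ≤ Real.exp (t ^ 2 / 2) := by
  have h := (ProbabilityTheory.hasSubgaussianMGF_of_mem_Icc_of_integral_eq_zero
    (X := fun θ : ℝ => Real.cos (2 * Real.pi * θ))
    (μ := volume.restrict (Set.Ioc (0 : ℝ) 1)) (a := -1) (b := 1) (by fun_prop)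
    (Filter.Eventually.of_forall fun θ => ⟨Real.neg_one_le_cos _, Real.cos_le_one _⟩) (by
      rw [← intervalIntegral.integral_of_le zero_le_one, integral_cos_two_pi])).mgf_le t
  rw [ProbabilityTheory.mgf, ← besselIZero_eq_integral_restrict] at h
  refine h.trans (le_of_eq ?_)
  congr 1
  have : ‖(1 : ℝ) - -1‖ = 2 := by norm_num
  push_cast
  rw [this]; ring

/-- The function `log I₀`. -/
def logBessel (t : ℝ) : ℝ := Real.log (besselIZero t)

lemma logBessel_nonneg (t : ℝ) : 0 ≤ logBessel t := Real.log_nonneg (one_le_besselIZero t)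

lemma logBessel_pos {t : ℝ} (ht : t ≠ 0) : 0 < logBessel t := Real.log_pos (one_lt_besselIZero ht)

lemma besselIZero_pos (t : ℝ) : 0 < besselIZero t := zero_lt_one.trans_le (one_le_besselIZero t)

lemma logBessel_le_abs (t : ℝ) : logBessel t ≤ |t| := by
  rw [logBessel, Real.log_le_iff_le_exp (besselIZero_pos t)]
  exact besselIZero_le_exp_abs t

lemma logBessel_le_sq (t : ℝ) : logBessel t ≤ t ^ 2 / 2 := by
  rw [logBessel, Real.log_le_iff_le_exp (besselIZero_pos t)]
  exact besselIZero_le_exp_sq t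

lemma hasDerivAt_logBessel (t : ℝ) :
    HasDerivAt logBessel (besselIOne t / besselIZero t) t :=
  (hasDerivAt_besselIZero t).log (besselIZero_pos t).ne'

lemma continuous_logBessel : Continuous logBessel :=
  continuous_iff_continuousAt.mpr fun t => (hasDerivAt_logBessel t).continuousAt

lemma exists_one_add_abs_log_pow_le (m : ℕ) {γ : ℝ} (hγ : 0 < γ) :
    ∃ C : ℝ, 0 < C ∧ ∀ v : ℝ, 0 < v → (1 + |Real.log v|) ^ m ≤ C * (v ^ γ + v ^ (-γ)) := by
  refine ⟨m.factorial / γ ^ m * Real.exp γ, by positivity, fun v hv => ?_⟩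
  have h1 : Real.exp (γ * |Real.log v|) ≤ v ^ γ + v ^ (-γ) := by
    rw [Real.rpow_def_of_pos hv, Real.rpow_def_of_pos hv]
    rcases abs_cases (Real.log v) with ⟨h, -⟩ | ⟨h, -⟩ <;> rw [h]
    · have := Real.exp_pos (Real.log v * -γ)
      rw [mul_comm γ]; linarith
    · have := Real.exp_pos (Real.log v * γ)
      rw [show γ * -Real.log v = Real.log v * -γ by ring]; linarith
  have h2 := Real.pow_div_factorial_le_exp (γ * (1 + |Real.log v|)) (by positivity) m
  rw [div_le_iff₀ (by positivity), mul_pow, mul_add, mul_one, Real.exp_add] at h2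
  calc (1 + |Real.log v|) ^ m = (γ ^ m * (1 + |Real.log v|) ^ m) / γ ^ m := by field_simp
    _ ≤ (Real.exp γ * Real.exp (γ * |Real.log v|) * m.factorial) / γ ^ m := by gcongr
    _ = m.factorial / γ ^ m * Real.exp γ * Real.exp (γ * |Real.log v|) := by ring
    _ ≤ _ := by gcongr

/-- A weighted moment of `v ↦ log I₀(v ^ (-σ))` is finite, with room to spare at the origin. -/
lemma integrableOn_logBessel_mul {σ : ℝ} (hσ : 1 / 2 < σ) (hσ1 : σ < 1) (m : ℕ) :
    IntegrableOn (fun v : ℝ => logBessel (v ^ (-σ)) *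
      ((1 + v ^ (-((1 - σ) / 2))) * (1 + |Real.log v|) ^ m)) (Set.Ioi 0) := by
  set β := (1 - σ) / 2 with hβ
  have hβ0 : 0 < β := by rw [hβ]; linarith
  set γ := min ((1 - σ) / 4) ((2 * σ - 1) / 2) with hγ
  have hγ0 : 0 < γ := lt_min (by linarith) (by linarith)
  have hγ1 : γ ≤ (1 - σ) / 4 := min_le_left _ _
  have hγ2 : γ ≤ (2 * σ - 1) / 2 := min_le_right _ _
  obtain ⟨C, hC, h⟩ := exists_one_add_abs_log_pow_le m hγ0
  have hmeas : Measurable (fun v : ℝ => logBessel (v ^ (-σ)) *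
      ((1 + v ^ (-β)) * (1 + |Real.log v|) ^ m)) := by
    refine Measurable.mul (continuous_logBessel.measurable.comp (by fun_prop)) ?_
    refine Measurable.mul (by fun_prop) ?_
    exact (measurable_const.add Real.measurable_log.abs).pow_const m
  have hnn (v : ℝ) (hv : 0 < v) : 0 ≤ logBessel (v ^ (-σ)) *
      ((1 + v ^ (-β)) * (1 + |Real.log v|) ^ m) := by
    have := logBessel_nonneg (v ^ (-σ)); positivity
  rw [← Set.Ioc_union_Ioi_eq_Ioi (zero_le_one : (0 : ℝ) ≤ 1)]
  refine IntegrableOn.union ?_ ?_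
  · have hi : IntegrableOn (fun v : ℝ => 4 * C * v ^ (-(σ + β + γ))) (Set.Ioc 0 1) :=
      ((intervalIntegral.intervalIntegrable_rpow' (by linarith)).1).const_mul _
    refine hi.mono' hmeas.aestronglyMeasurable ?_
    filter_upwards [ae_restrict_mem measurableSet_Ioc] with v hv
    have hv0 : 0 < v := hv.1
    rw [Real.norm_of_nonneg (hnn v hv0)]
    have h1 : logBessel (v ^ (-σ)) ≤ v ^ (-σ) := by
      have := logBessel_le_abs (v ^ (-σ)); rwa [abs_of_pos (by positivity)] at this
    have h2 : 1 ≤ v ^ (-β) := Real.one_le_rpow_of_pos_of_le_one_of_nonpos hv0 hv.2 (by linarith)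
    have h3 : v ^ γ ≤ v ^ (-γ) := Real.rpow_le_rpow_of_exponent_ge hv0 hv.2 (by linarith)
    have h4 := h v hv0
    calc _ ≤ v ^ (-σ) * ((v ^ (-β) + v ^ (-β)) * (C * (v ^ (-γ) + v ^ (-γ)))) := by
          gcongr
          exact h4.trans (by gcongr)
      _ = 4 * C * (v ^ (-σ) * v ^ (-β) * v ^ (-γ)) := by ring
      _ = _ := by
        rw [← Real.rpow_add hv0, ← Real.rpow_add hv0]; congr 2; ring
  · have hi : IntegrableOn (fun v : ℝ => 2 * C * v ^ (-(2 * σ) + γ)) (Set.Ioi 1) :=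
      (integrableOn_Ioi_rpow_of_lt (by linarith) zero_lt_one).const_mul _
    refine hi.mono' hmeas.aestronglyMeasurable ?_
    filter_upwards [ae_restrict_mem measurableSet_Ioi] with v hv
    have hv1 : 1 < v := hv
    have hv0 : 0 < v := by linarith
    rw [Real.norm_of_nonneg (hnn v hv0)]
    have h1 : logBessel (v ^ (-σ)) ≤ v ^ (-(2 * σ)) / 2 := by
      refine (logBessel_le_sq (v ^ (-σ))).trans (le_of_eq ?_)
      rw [← Real.rpow_natCast, ← Real.rpow_mul hv0.le]; congr 2; push_cast; ring
    have h2 : v ^ (-β) ≤ 1 := Real.rpow_le_one_of_one_le_of_nonpos hv1.le (by linarith)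
    have h3 : v ^ (-γ) ≤ v ^ γ := Real.rpow_le_rpow_of_exponent_le hv1.le (by linarith)
    have h4 := h v hv0
    calc _ ≤ v ^ (-(2 * σ)) / 2 * ((1 + 1) * (C * (v ^ γ + v ^ γ))) := by
          gcongr
          exact h4.trans (by gcongr)
      _ = 2 * C * (v ^ (-(2 * σ)) * v ^ γ) := by ring
      _ = _ := by rw [← Real.rpow_add hv0]

/-- The coefficients `∫₀^∞ log I₀(v ^ (-σ)) (-log v) ^ n dv` of the expansion of the cumulant
generating function of `log |ζ(σ + it; y)|`. -/
def besselMoment (σ : ℝ) (n : ℕ) : ℝ :=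
  ∫ v in Set.Ioi (0 : ℝ), logBessel (v ^ (-σ)) * (-Real.log v) ^ n

lemma integrableOn_logBessel_mul_log_pow {σ : ℝ} (hσ : 1 / 2 < σ) (hσ1 : σ < 1) (n : ℕ) :
    IntegrableOn (fun v : ℝ => logBessel (v ^ (-σ)) * (-Real.log v) ^ n) (Set.Ioi 0) := by
  refine (integrableOn_logBessel_mul hσ hσ1 n).mono' ?_ ?_
  · refine Measurable.aestronglyMeasurable ?_
    exact (continuous_logBessel.measurable.comp (by fun_prop)).mul
      (Real.measurable_log.neg.pow_const n)
  · filter_upwards [ae_restrict_mem measurableSet_Ioi] with v hv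
    have hv0 : (0 : ℝ) < v := hv
    have h0 := logBessel_nonneg (v ^ (-σ))
    rw [norm_mul, Real.norm_of_nonneg h0, norm_pow, norm_neg, Real.norm_eq_abs]
    gcongr
    have h1 : 0 < v ^ (-((1 - σ) / 2)) := by positivity
    have h2 : |Real.log v| ^ n ≤ (1 + |Real.log v|) ^ n := by gcongr; linarith
    have h3 : 0 ≤ (1 + |Real.log v|) ^ n := by positivity
    nlinarith

lemma besselMoment_zero_pos {σ : ℝ} (hσ : 1 / 2 < σ) (hσ1 : σ < 1) : 0 < besselMoment σ 0 := by
  have hi := integrableOn_logBessel_mul_log_pow hσ hσ1 0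
  rw [besselMoment, setIntegral_pos_iff_support_of_nonneg_ae ?_ hi]
  · have : Set.Ioi (0 : ℝ) ⊆
        Function.support (fun v : ℝ => logBessel (v ^ (-σ)) * (-Real.log v) ^ 0) ∩ Set.Ioi 0 := by
      intro v hv
      have hv0 : (0 : ℝ) < v := hv
      refine ⟨?_, hv⟩
      have := logBessel_pos (Real.rpow_pos_of_pos hv0 (-σ)).ne'
      simpa using this.ne'
    refine lt_of_lt_of_le ?_ (measure_mono this)
    simp
  · refine Filter.Eventually.of_forall fun v => ?_
    simpa using logBessel_nonneg _

lemma besselConst_eq_mul_besselMoment {σ : ℝ} (hσ : 1 / 2 < σ) :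
    besselConst σ = σ * besselMoment σ 0 := by
  have h := integral_comp_rpow_Ioi (fun t : ℝ => Real.log (besselIZero t) / t ^ (1 / σ + 1))
    (p := -σ) (by linarith)
  rw [besselConst, ← h, besselMoment, ← integral_const_mul]
  refine setIntegral_congr_fun measurableSet_Ioi fun v hv => ?_
  have hv0 : (0 : ℝ) < v := hv
  simp only [smul_eq_mul, pow_zero, mul_one]
  rw [abs_neg, abs_of_pos (by linarith), ← Real.rpow_mul hv0.le, logBessel]
  have e : -σ * (1 / σ + 1) = -σ - 1 := by
    have : σ ≠ 0 := by linarith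
    field_simp
    ring
  rw [e]
  have : v ^ (-σ - 1) ≠ 0 := by positivity
  field_simp

end

noncomputable section

/-! ### The sum of `log I₀((x / p) ^ σ)` over primes -/

lemma one_div_add_sub_sum {a b : ℝ} (ha : a ≠ 0) (hab : a + b ≠ 0) (m : ℕ) :
    1 / (a + b) - ∑ n ∈ Finset.range m, (-b) ^ n / a ^ (n + 1) =
      (-b) ^ m / (a ^ m * (a + b)) := by
  induction m with
  | zero => simp
  | succ m ih =>
    rw [Finset.sum_range_succ, ← sub_sub, ih]
    field_simp
    ring

lemma exists_one_div_log_pow_le {β : ℝ} (hβ : 0 < β) (n : ℕ) :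
    ∃ B : ℝ, 1 ≤ B ∧ ∀ u x : ℝ, 2 ≤ u → 2 ≤ x →
      1 / Real.log u ^ n ≤ B * (1 + (u / x) ^ (-β)) / Real.log x ^ n := by
  obtain ⟨C, hC, h⟩ := exists_log_div_log_le (show 0 < β / (n + 1) by positivity)
  refine ⟨C ^ n, one_le_pow₀ hC, fun u x hu hx => ?_⟩
  have hu0 : 0 < u := by linarith
  have hx0 : 0 < x := by linarith
  have hlu : 0 < Real.log u := Real.log_pos (by linarith)
  have hlx : 0 < Real.log x := Real.log_pos (by linarith)
  have hpos : 0 < (u / x) ^ (-β) := by positivity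
  rcases le_total u x with hux | hux
  · have h1 := h u x hu hux
    have h2 : (1 / Real.log u) ^ n ≤ (C * (x / u) ^ (β / (n + 1)) / Real.log x) ^ n := by gcongr
    rw [one_div, inv_pow, ← one_div, div_pow, mul_pow, ← Real.rpow_mul_natCast (by positivity)]
      at h2
    refine h2.trans ?_
    have h3 : (x / u) ^ (β / (n + 1) * n) ≤ (u / x) ^ (-β) := by
      rw [Real.rpow_neg (by positivity), ← Real.inv_rpow (by positivity), inv_div]
      refine Real.rpow_le_rpow_of_exponent_le (by rw [one_le_div hu0]; exact hux) ?_
      rw [div_mul_eq_mul_div, div_le_iff₀ (by positivity)]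
      nlinarith
    gcongr
    linarith
  · have h1 : Real.log x ≤ Real.log u := Real.log_le_log hx0 hux
    have hC' : 1 ≤ C ^ n := one_le_pow₀ hC
    calc 1 / Real.log u ^ n ≤ 1 / Real.log x ^ n := by gcongr
      _ ≤ _ := by gcongr; nlinarith

lemma exists_log_pow_le (m : ℕ) {γ : ℝ} (hγ : 0 < γ) :
    ∃ C : ℝ, 0 < C ∧ ∀ x : ℝ, 1 ≤ x → Real.log x ^ m ≤ C * x ^ γ := by
  obtain ⟨C, hC, h⟩ := exists_one_add_abs_log_pow_le m hγ
  refine ⟨2 * C, by positivity, fun x hx => ?_⟩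
  have hl := Real.log_nonneg hx
  have h1 := h x (by linarith)
  have h2 : x ^ (-γ) ≤ x ^ γ := Real.rpow_le_rpow_of_exponent_le hx (by linarith)
  rw [abs_of_nonneg hl] at h1
  calc Real.log x ^ m ≤ (1 + Real.log x) ^ m := by gcongr; linarith
    _ ≤ C * (x ^ γ + x ^ (-γ)) := h1
    _ ≤ C * (x ^ γ + x ^ γ) := by gcongr
    _ = _ := by ring

lemma logBessel_rpow_neg_le {v : ℝ} (hv : 0 < v) (σ : ℝ) :
    logBessel (v ^ (-σ)) ≤ v ^ (-(2 * σ)) / 2 := by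
  refine (logBessel_le_sq (v ^ (-σ))).trans (le_of_eq ?_)
  rw [← Real.rpow_natCast, ← Real.rpow_mul hv.le]; congr 2; push_cast; ring

/-- The expansion of `∫_2^y log I₀((x / u) ^ σ) du / log u` in powers of `1 / log x`. -/
lemma exists_abs_integral_logBessel_sub_le {σ : ℝ} (hσ : 1 / 2 < σ) (hσ1 : σ < 1) (M : ℕ) :
    ∃ C : ℝ, 0 < C ∧ ∀ x y : ℝ, 2 ≤ x → 2 ≤ y → x ≤ y ^ 2 →
      |(∫ u in (2 : ℝ)..y, logBessel ((u / x) ^ (-σ)) / Real.log u) -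
        x * ∑ n ∈ Finset.range (M + 1), besselMoment σ n / Real.log x ^ (n + 1)| ≤
      C * x * (1 / Real.log x ^ (M + 2) + (x / y) ^ (2 * σ - 1) / Real.log x) := by
  set β := (1 - σ) / 2 with hβ
  have hβ0 : 0 < β := by rw [hβ]; linarith
  obtain ⟨B, hB, hlog⟩ := exists_one_div_log_pow_le hβ0 1
  obtain ⟨P, hP, hpow⟩ := exists_log_pow_le (M + 1) hβ0
  set W : ℝ → ℝ := fun v => logBessel (v ^ (-σ)) *
      ((1 + v ^ (-β)) * (1 + |Real.log v|) ^ (M + 1)) with hW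
  have hWi : IntegrableOn W (Set.Ioi 0) := integrableOn_logBessel_mul hσ hσ1 (M + 1)
  have hW0 (v : ℝ) (hv : v ∈ Set.Ioi (0 : ℝ)) : 0 ≤ W v := by
    have := logBessel_nonneg (v ^ (-σ))
    have : (0 : ℝ) < v := hv
    rw [hW]; positivity
  set K := ∫ v in Set.Ioi (0 : ℝ), W v with hK
  have hK0 : 0 ≤ K := setIntegral_nonneg measurableSet_Ioi hW0
  set l2 := Real.log 2 with hl2
  have hl2p : 0 < l2 := Real.log_pos (by norm_num)
  set Q := ∑ n ∈ Finset.range (M + 1), 1 / l2 ^ n with hQ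
  have hQ0 : 0 ≤ Q := Finset.sum_nonneg fun n _ => by positivity
  refine ⟨B * K + 1 / (2 * σ - 1) + Q * K * 2 ^ β * P + 1, ?_, fun x y hx hy hxy => ?_⟩
  · have : 0 < 1 / (2 * σ - 1) := one_div_pos.mpr (by linarith)
    positivity
  have hx0 : 0 < x := by linarith
  have hy0 : 0 < y := by linarith
  set L := Real.log x with hL
  have hL2 : l2 ≤ L := Real.log_le_log (by norm_num) hx
  have hLp : 0 < L := hl2p.trans_le hL2
  set G : ℝ → ℝ := fun v => logBessel (v ^ (-σ)) with hG
  have hG0 (v : ℝ) : 0 ≤ G v := logBessel_nonneg _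
  have hGm : Measurable G := continuous_logBessel.measurable.comp (by fun_prop)
  set F : ℝ → ℝ := fun v => G v / Real.log (x * v) with hF
  have hFm : Measurable F := hGm.div (Real.measurable_log.comp (measurable_const.mul measurable_id))
  have h2x : 0 < 2 / x := by positivity
  have hyx : 2 / x ≤ y / x := by gcongr
  have hsub : Set.Ioi (2 / x) ⊆ Set.Ioi 0 := Set.Ioi_subset_Ioi h2x.le
  -- the change of variable `u = x v`
  have hcv : (∫ u in (2 : ℝ)..y, logBessel ((u / x) ^ (-σ)) / Real.log u) =
      x * ∫ v in (2 / x)..(y / x), F v := by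
    have h := intervalIntegral.integral_comp_div (a := 2) (b := y) F hx0.ne'
    rw [smul_eq_mul] at h
    rw [← h]
    refine intervalIntegral.integral_congr fun u _ => ?_
    simp only [hF, hG]
    rw [mul_div_cancel₀ _ hx0.ne']
  have hinv (v : ℝ) (hv : v ∈ Set.Ioi (2 / x)) :
      0 < Real.log (x * v) ∧ 1 / Real.log (x * v) ≤ B * (1 + v ^ (-β)) / L := by
    have hv2 : 2 < x * v := by rw [mul_comm]; exact (div_lt_iff₀ hx0).mp hv
    refine ⟨Real.log_pos (by linarith), ?_⟩
    have h := hlog (x * v) x hv2.le hx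
    rwa [pow_one, pow_one, mul_div_cancel_left₀ _ hx0.ne'] at h
  have hone (v : ℝ) (n : ℕ) (hn : n ≤ M + 1) : |Real.log v| ^ n ≤ (1 + |Real.log v|) ^ (M + 1) := by
    calc |Real.log v| ^ n ≤ (1 + |Real.log v|) ^ n := by gcongr; linarith
      _ ≤ _ := pow_le_pow_right₀ (by linarith [abs_nonneg (Real.log v)]) hn
  have hFi : IntegrableOn F (Set.Ioi (2 / x)) := by
    refine ((hWi.mono_set hsub).const_mul (B / L)).mono' hFm.aestronglyMeasurable ?_
    filter_upwards [ae_restrict_mem measurableSet_Ioi] with v hv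
    obtain ⟨h1, h2⟩ := hinv v hv
    have hv0 : (0 : ℝ) < v := hsub hv
    rw [Real.norm_of_nonneg (div_nonneg (hG0 v) h1.le)]
    have h3 := hone v 0 (by omega)
    rw [pow_zero] at h3
    calc F v = G v * (1 / Real.log (x * v)) := by rw [hF]; ring
      _ ≤ G v * (B * (1 + v ^ (-β)) / L) := mul_le_mul_of_nonneg_left h2 (hG0 v)
      _ = B / L * (G v * ((1 + v ^ (-β)) * 1)) := by ring
      _ ≤ B / L * (G v * ((1 + v ^ (-β)) * (1 + |Real.log v|) ^ (M + 1))) := by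
        have := hG0 v
        gcongr
  have hGi (n : ℕ) : IntegrableOn (fun v => G v * (-Real.log v) ^ n) (Set.Ioi 0) :=
    integrableOn_logBessel_mul_log_pow hσ hσ1 n
  set S : ℝ → ℝ := fun v => ∑ n ∈ Finset.range (M + 1), G v * (-Real.log v) ^ n / L ^ (n + 1)
    with hS
  have hSi : IntegrableOn S (Set.Ioi 0) := by
    refine integrable_finsetSum _ fun n _ => ?_
    exact Integrable.div_const (hGi n) _
  have hSint : ∫ v in Set.Ioi (0 : ℝ), S v =
      ∑ n ∈ Finset.range (M + 1), besselMoment σ n / L ^ (n + 1) := by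
    rw [hS, integral_finsetSum _ fun n _ => Integrable.div_const (hGi n) _]
    refine Finset.sum_congr rfl fun n _ => ?_
    rw [integral_div, besselMoment]
  -- the three errors
  -- the remainder of the geometric expansion of `1 / (log x + log v)`
  have hA : |∫ v in Set.Ioi (2 / x), (F v - S v)| ≤ B * K / L ^ (M + 2) := by
    have h1 : ‖∫ v in Set.Ioi (2 / x), (F v - S v)‖ ≤
        ∫ v in Set.Ioi (2 / x), B / L ^ (M + 2) * W v := by
      refine norm_integral_le_of_norm_le ((hWi.mono_set hsub).const_mul _) ?_
      filter_upwards [ae_restrict_mem measurableSet_Ioi] with v hv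
      obtain ⟨h1, h2⟩ := hinv v hv
      have hv0 : (0 : ℝ) < v := hsub hv
      rw [Real.log_mul hx0.ne' hv0.ne'] at h1 h2
      have e : F v - S v = G v * ((-Real.log v) ^ (M + 1) / (L ^ (M + 1) * (L + Real.log v))) := by
        rw [← one_div_add_sub_sum hLp.ne' h1.ne', mul_sub, Finset.mul_sum]
        simp only [hF, hS]
        rw [Real.log_mul hx0.ne' hv0.ne']
        congr 1
        · ring
        · exact Finset.sum_congr rfl fun n _ => by ring
      rw [e, norm_mul, norm_div, norm_pow, norm_neg, Real.norm_of_nonneg (hG0 v),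
        Real.norm_of_nonneg (by positivity : 0 ≤ L ^ (M + 1) * (L + Real.log v)), Real.norm_eq_abs]
      have h3 := hone v (M + 1) le_rfl
      have h4 := hG0 v
      calc G v * (|Real.log v| ^ (M + 1) / (L ^ (M + 1) * (L + Real.log v)))
          = G v * (|Real.log v| ^ (M + 1) / L ^ (M + 1) * (1 / (L + Real.log v))) := by
            field_simp
        _ ≤ G v * ((1 + |Real.log v|) ^ (M + 1) / L ^ (M + 1) * (B * (1 + v ^ (-β)) / L)) := by
            gcongr
        _ = B / L ^ (M + 2) * W v := by rw [hW]; simp only [hG]; field_simp; ring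
    rw [integral_const_mul] at h1
    refine h1.trans ?_
    have h2 : ∫ v in Set.Ioi (2 / x), W v ≤ K :=
      setIntegral_mono_set hWi ((ae_restrict_mem measurableSet_Ioi).mono hW0) hsub.eventuallyLE
    calc _ ≤ B / L ^ (M + 2) * K := by gcongr
      _ = _ := by ring
  -- the range `v < 2 / x`, where a small negative power of `v` beats the powers of `log x`
  have hBd : |∫ v in Set.Ioc 0 (2 / x), S v| ≤ Q * K * 2 ^ β * P / L ^ (M + 2) := by
    have h1 : ‖∫ v in Set.Ioc 0 (2 / x), S v‖ ≤
        ∫ v in Set.Ioc 0 (2 / x), Q / L * (2 / x) ^ β * W v := by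
      refine norm_integral_le_of_norm_le ((hWi.mono_set Set.Ioc_subset_Ioi_self).const_mul _) ?_
      filter_upwards [ae_restrict_mem measurableSet_Ioc] with v hv
      have hv0 : (0 : ℝ) < v := hv.1
      have h4 := hG0 v
      have h5 : 1 ≤ (2 / x) ^ β * (1 + v ^ (-β)) := by
        have : 1 ≤ (2 / x) ^ β * v ^ (-β) := by
          rw [Real.rpow_neg hv0.le, ← div_eq_mul_inv, ← Real.div_rpow h2x.le hv0.le]
          exact Real.one_le_rpow (by rw [one_le_div hv0]; exact hv.2) hβ0.le
        have : 0 ≤ (2 / x) ^ β := by positivity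
        linarith
      calc ‖S v‖ ≤ ∑ n ∈ Finset.range (M + 1), ‖G v * (-Real.log v) ^ n / L ^ (n + 1)‖ :=
            norm_sum_le _ _
        _ ≤ ∑ n ∈ Finset.range (M + 1), 1 / l2 ^ n * (G v * (1 + |Real.log v|) ^ (M + 1) / L) := by
            refine Finset.sum_le_sum fun n hn => ?_
            rw [norm_div, norm_mul, norm_pow, norm_pow, norm_neg, Real.norm_of_nonneg hLp.le,
              Real.norm_of_nonneg (hG0 v), Real.norm_eq_abs]
            have h3 := hone v n (by rw [Finset.mem_range] at hn; omega)
            calc _ = 1 / L ^ n * (G v * |Real.log v| ^ n / L) := by field_simp; ring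
              _ ≤ _ := by gcongr
        _ = Q * (G v * (1 + |Real.log v|) ^ (M + 1) / L) * 1 := by
            rw [hQ, Finset.sum_mul, mul_one]
        _ ≤ Q * (G v * (1 + |Real.log v|) ^ (M + 1) / L) * ((2 / x) ^ β * (1 + v ^ (-β))) := by
            gcongr
        _ = Q / L * (2 / x) ^ β * W v := by rw [hW]; ring
    rw [integral_const_mul] at h1
    refine h1.trans ?_
    have h2 : ∫ v in Set.Ioc 0 (2 / x), W v ≤ K :=
      setIntegral_mono_set hWi ((ae_restrict_mem measurableSet_Ioi).mono hW0)
        Set.Ioc_subset_Ioi_self.eventuallyLE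
    have h3 := hpow x (by linarith)
    have h4 : (x ^ β)⁻¹ ≤ P / L ^ (M + 1) := by
      rw [inv_le_comm₀ (by positivity) (by positivity), inv_div, div_le_iff₀ hP]
      linarith
    calc _ ≤ Q / L * (2 / x) ^ β * K := by gcongr
      _ = Q / L * (2 ^ β * (x ^ β)⁻¹) * K := by
        rw [Real.div_rpow (by norm_num) hx0.le]; rfl
      _ ≤ Q / L * (2 ^ β * (P / L ^ (M + 1))) * K := by gcongr
      _ = _ := by field_simp; ring
  have hCd : |∫ v in Set.Ioi (y / x), F v| ≤ 1 / (2 * σ - 1) * ((x / y) ^ (2 * σ - 1) / L) := by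
    have hyx0 : 0 < y / x := by positivity
    have hly : L ≤ 2 * Real.log y := by
      have := Real.log_le_log hx0 hxy
      rwa [Real.log_pow] at this
    have h1 : ‖∫ v in Set.Ioi (y / x), F v‖ ≤
        ∫ v in Set.Ioi (y / x), 1 / L * v ^ (-(2 * σ)) := by
      refine norm_integral_le_of_norm_le
        ((integrableOn_Ioi_rpow_of_lt (by linarith) hyx0).const_mul _) ?_
      filter_upwards [ae_restrict_mem measurableSet_Ioi] with v hv
      have hv' : y / x < v := hv
      have hv0 : 0 < v := hyx0.trans hv'
      have hv2 : y < x * v := by rw [mul_comm]; exact (div_lt_iff₀ hx0).mp hv'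
      have h2 : L / 2 ≤ Real.log (x * v) := by
        have := Real.log_le_log hy0 hv2.le
        linarith
      have h3 : 0 < Real.log (x * v) := by linarith
      rw [Real.norm_of_nonneg (div_nonneg (hG0 v) h3.le)]
      have h4 := logBessel_rpow_neg_le hv0 σ
      calc F v ≤ (v ^ (-(2 * σ)) / 2) / (L / 2) := by
            simp only [hF, hG]; gcongr
        _ = _ := by field_simp
    rw [integral_const_mul, integral_Ioi_rpow_of_lt (by linarith) hyx0] at h1
    refine h1.trans (le_of_eq ?_)
    have e : (x / y) ^ (2 * σ - 1) = (y / x) ^ (-(2 * σ) + 1) := by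
      rw [show -(2 * σ) + 1 = -(2 * σ - 1) by ring, Real.rpow_neg (by positivity),
        ← Real.inv_rpow (by positivity), inv_div]
    rw [e, show -(2 * σ) + 1 = -(2 * σ - 1) by ring]
    have : 2 * σ - 1 ≠ 0 := by linarith
    field_simp
  have hsplit : (∫ v in (2 / x)..(y / x), F v) - ∫ v in Set.Ioi (0 : ℝ), S v =
      (∫ v in Set.Ioi (2 / x), (F v - S v)) - (∫ v in Set.Ioi (y / x), F v) -
        ∫ v in Set.Ioc 0 (2 / x), S v := by
    have e1 : (∫ v in Set.Ioi (2 / x), F v) =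
        (∫ v in Set.Ioc (2 / x) (y / x), F v) + ∫ v in Set.Ioi (y / x), F v := by
      rw [← setIntegral_union (Set.Ioc_disjoint_Ioi le_rfl) measurableSet_Ioi
        (hFi.mono_set Set.Ioc_subset_Ioi_self) (hFi.mono_set (Set.Ioi_subset_Ioi hyx)),
        Set.Ioc_union_Ioi_eq_Ioi hyx]
    have e2 : (∫ v in Set.Ioi (0 : ℝ), S v) =
        (∫ v in Set.Ioc 0 (2 / x), S v) + ∫ v in Set.Ioi (2 / x), S v := by
      rw [← setIntegral_union (Set.Ioc_disjoint_Ioi le_rfl) measurableSet_Ioi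
        (hSi.mono_set Set.Ioc_subset_Ioi_self) (hSi.mono_set hsub),
        Set.Ioc_union_Ioi_eq_Ioi h2x.le]
    rw [integral_sub hFi (hSi.mono_set hsub), intervalIntegral.integral_of_le hyx, e1, e2]
    ring
  rw [hcv, ← hSint, ← mul_sub, hsplit, abs_mul, abs_of_pos hx0]
  have ht : |(∫ v in Set.Ioi (2 / x), (F v - S v)) - (∫ v in Set.Ioi (y / x), F v) -
      ∫ v in Set.Ioc 0 (2 / x), S v| ≤ B * K / L ^ (M + 2) +
        1 / (2 * σ - 1) * ((x / y) ^ (2 * σ - 1) / L) + Q * K * 2 ^ β * P / L ^ (M + 2) :=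
    (abs_sub _ _).trans (add_le_add ((abs_sub _ _).trans (add_le_add hA hCd)) hBd)
  have h5 : 0 ≤ (x / y) ^ (2 * σ - 1) / L := by positivity
  have h6 : 0 ≤ 1 / L ^ (M + 2) := by positivity
  have h7 : 0 < 1 / (2 * σ - 1) := one_div_pos.mpr (by linarith)
  have h8 : 0 ≤ Q * K * 2 ^ β * P := by positivity
  have h9 : 0 ≤ B * K := by positivity
  rw [mul_comm _ x, mul_assoc]
  refine mul_le_mul_of_nonneg_left (ht.trans ?_) hx0.le
  have e : B * K / L ^ (M + 2) + Q * K * 2 ^ β * P / L ^ (M + 2) =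
    (B * K + Q * K * 2 ^ β * P) * (1 / L ^ (M + 2)) := by ring
  nlinarith [mul_nonneg h7.le h6, mul_nonneg h8 h5, mul_nonneg h9 h5]

/-- The sum over primes of `log I₀((x / p) ^ σ)`, in powers of `1 / log x`. -/
theorem exists_abs_sum_logBessel_sub_le {σ : ℝ} (hσ : 1 / 2 < σ) (hσ1 : σ < 1) (M : ℕ) :
    ∃ C : ℝ, 0 < C ∧ ∀ x y : ℝ, 2 ≤ x → 2 ≤ y → x ≤ y ^ 2 →
      |∑ p ∈ (Finset.Icc 1 ⌊y⌋₊).filter Nat.Prime, logBessel ((p / x) ^ (-σ)) -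
        x * ∑ n ∈ Finset.range (M + 1), besselMoment σ n / Real.log x ^ (n + 1)| ≤
      C * x * (1 / Real.log x ^ (M + 2) + (x / y) ^ (2 * σ - 1) / Real.log x) := by
  obtain ⟨C₁, hC₁, h₁⟩ := exists_abs_integral_logBessel_sub_le hσ hσ1 M
  obtain ⟨C₂, hC₂, h₂⟩ := exists_abs_sum_primes_mul_log_sub_integral_le (M + 1) (by omega)
  set β := (1 - σ) / 2 with hβ
  have hβ0 : 0 < β := by rw [hβ]; linarith
  obtain ⟨B, hB, hlog⟩ := exists_one_div_log_pow_le hβ0 (M + 2)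
  obtain ⟨P, hP, hpow⟩ := exists_log_pow_le (M + 2) (show 0 < 1 - σ by linarith)
  set W : ℝ → ℝ := fun v => logBessel (v ^ (-σ)) *
      ((1 + v ^ (-β)) * (1 + |Real.log v|) ^ 0) with hW
  have hWi : IntegrableOn W (Set.Ioi 0) := integrableOn_logBessel_mul hσ hσ1 0
  have hW0 (v : ℝ) (hv : v ∈ Set.Ioi (0 : ℝ)) : 0 ≤ W v := by
    have := logBessel_nonneg (v ^ (-σ))
    have : (0 : ℝ) < v := hv
    rw [hW]; positivity
  set K := ∫ v in Set.Ioi (0 : ℝ), W v with hK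
  have hK0 : 0 ≤ K := setIntegral_nonneg measurableSet_Ioi hW0
  have hl2 : 0 < Real.log 2 := Real.log_pos (by norm_num)
  refine ⟨C₁ + C₂ * (P / Real.log 2 + B * K), by positivity, fun x y hx hy hxy => ?_⟩
  have hx0 : 0 < x := by linarith
  have hy0 : 0 < y := by linarith
  set L := Real.log x with hL
  have hLp : 0 < L := Real.log_pos (by linarith)
  have huIcc : Set.uIcc 2 y = Set.Icc 2 y := Set.uIcc_of_le hy
  have hlogu {u : ℝ} (hu : u ∈ Set.Icc 2 y) : 0 < Real.log u := Real.log_pos (by linarith [hu.1])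
  have hu0 {u : ℝ} (hu : u ∈ Set.Icc 2 y) : 0 < u := by linarith [hu.1]
  have hlogc : ContinuousOn Real.log (Set.Icc 2 y) :=
    Real.continuousOn_log.mono fun u hu => (hu0 hu).ne'
  have hpc (a : ℝ) : ContinuousOn (fun u : ℝ => (u / x) ^ a) (Set.Icc 2 y) :=
    fun u hu => ((Real.continuousAt_rpow_const (u / x) a (Or.inl (by
      have := hu0 hu; positivity))).comp (f := fun u : ℝ => u / x)
        (by fun_prop)).continuousWithinAt
  -- partial summation for the decreasing function `φ`, each prime having weight `φ p * log p`
  set φ : ℝ → ℝ := fun u => logBessel ((u / x) ^ (-σ)) / Real.log u with hφ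
  set g : ℝ → ℝ := fun u => besselIOne ((u / x) ^ (-σ)) / besselIZero ((u / x) ^ (-σ)) *
    (-σ * (u / x) ^ (-σ - 1) * (1 / x)) with hg
  set φ' : ℝ → ℝ := fun u =>
    (g u * Real.log u - logBessel ((u / x) ^ (-σ)) * u⁻¹) / Real.log u ^ 2 with hφ'
  have hφd (u : ℝ) (hu : u ∈ Set.Icc 2 y) : HasDerivAt φ (φ' u) u := by
    have hux : u / x ≠ 0 := by have := hu0 hu; positivity
    have h1 : HasDerivAt (fun u : ℝ => (u / x) ^ (-σ)) (-σ * (u / x) ^ (-σ - 1) * (1 / x)) u :=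
      (Real.hasDerivAt_rpow_const (p := -σ) (Or.inl hux)).comp (h := fun u : ℝ => u / x) u
        ((hasDerivAt_id u).div_const x)
    exact ((hasDerivAt_logBessel _).comp u h1).div (Real.hasDerivAt_log (hu0 hu).ne')
      (hlogu hu).ne'
  have hφ0 (u : ℝ) (hu : u ∈ Set.Icc 2 y) : 0 ≤ φ u :=
    div_nonneg (logBessel_nonneg _) (hlogu hu).le
  have h3 := h₂ y φ φ' hy hφd ?_ ?_ hφ0
  rotate_left
  · refine ContinuousOn.div ?_ (hlogc.pow 2) fun u hu => (pow_pos (hlogu hu) _).ne'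
    refine ContinuousOn.sub (ContinuousOn.mul ?_ hlogc) (ContinuousOn.mul
      (continuous_logBessel.comp_continuousOn (hpc _))
      (continuousOn_id.inv₀ fun u hu => (hu0 hu).ne'))
    refine ContinuousOn.mul ?_ ((continuousOn_const.mul (hpc _)).mul continuousOn_const)
    exact (continuous_besselIOne.comp_continuousOn (hpc _)).div
      (continuous_besselIZero.comp_continuousOn (hpc _)) fun u _ => (besselIZero_pos _).ne'
  · intro u hu
    have hup := hu0 hu
    have hlp := hlogu hu
    refine div_nonpos_of_nonpos_of_nonneg ?_ (by positivity)
    have e1 : 0 ≤ besselIOne ((u / x) ^ (-σ)) / besselIZero ((u / x) ^ (-σ)) *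
        (σ * (u / x) ^ (-σ - 1) * (1 / x)) * Real.log u := by
      have := besselIOne_nonneg (t := (u / x) ^ (-σ)) (by positivity)
      have := besselIZero_pos ((u / x) ^ (-σ))
      positivity
    have e2 : 0 ≤ logBessel ((u / x) ^ (-σ)) * u⁻¹ := by
      have := logBessel_nonneg ((u / x) ^ (-σ)); positivity
    have e3 : g u * Real.log u = -(besselIOne ((u / x) ^ (-σ)) / besselIZero ((u / x) ^ (-σ)) *
        (σ * (u / x) ^ (-σ - 1) * (1 / x)) * Real.log u) := by rw [hg]; ring
    linarith
  have hsum : ∑ p ∈ (Finset.Icc 1 ⌊y⌋₊).filter Nat.Prime, φ p * Real.log p =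
      ∑ p ∈ (Finset.Icc 1 ⌊y⌋₊).filter Nat.Prime, logBessel ((p / x) ^ (-σ)) := by
    refine Finset.sum_congr rfl fun p hp => ?_
    have hp2 : (1 : ℝ) < p := by exact_mod_cast (Finset.mem_filter.mp hp).2.one_lt
    have := Real.log_pos hp2
    simp only [hφ]
    field_simp
  rw [hsum] at h3
  have ii {f : ℝ → ℝ} (hf : ContinuousOn f (Set.Icc 2 y)) : IntervalIntegrable f volume 2 y :=
    ContinuousOn.intervalIntegrable (huIcc ▸ hf)
  have hφc : ContinuousOn φ (Set.Icc 2 y) :=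
    fun u hu => (hφd u hu).continuousAt.continuousWithinAt
  -- the error term of partial summation, after the change of variable `u = x v`
  have hint : ∫ u in (2 : ℝ)..y, φ u / Real.log u ^ (M + 1) ≤ B * K * x / L ^ (M + 2) := by
    have hWc : ContinuousOn (fun u => W (u / x)) (Set.Icc 2 y) := by
      simp only [hW, pow_zero, mul_one]
      exact (continuous_logBessel.comp_continuousOn (hpc _)).mul (continuousOn_const.add (hpc _))
    have h4 : ∫ u in (2 : ℝ)..y, φ u / Real.log u ^ (M + 1) ≤
        ∫ u in (2 : ℝ)..y, B / L ^ (M + 2) * W (u / x) := by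
      refine intervalIntegral.integral_mono_on hy (ii (hφc.div (hlogc.pow _) fun u hu =>
        (pow_pos (hlogu hu) _).ne')) (ii (continuousOn_const.mul hWc)) fun u hu => ?_
      have h5 := hlog u x hu.1 hx
      have hlp := hlogu hu
      have h6 := logBessel_nonneg ((u / x) ^ (-σ))
      calc φ u / Real.log u ^ (M + 1) =
          logBessel ((u / x) ^ (-σ)) * (1 / Real.log u ^ (M + 2)) := by
            rw [hφ]; field_simp; ring
        _ ≤ logBessel ((u / x) ^ (-σ)) * (B * (1 + (u / x) ^ (-β)) / L ^ (M + 2)) := by gcongr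
        _ = _ := by rw [hW]; simp only [pow_zero, mul_one]; ring
    have h5 := intervalIntegral.integral_comp_div (a := 2) (b := y) W hx0.ne'
    rw [intervalIntegral.integral_const_mul, h5, smul_eq_mul,
      intervalIntegral.integral_of_le (a := 2 / x) (by gcongr)] at h4
    refine h4.trans ?_
    have h6 : ∫ v in Set.Ioc (2 / x) (y / x), W v ≤ K :=
      setIntegral_mono_set hWi ((ae_restrict_mem measurableSet_Ioi).mono hW0)
        (Set.Ioc_subset_Ioi_self.trans (Set.Ioi_subset_Ioi (by positivity))).eventuallyLE
    calc _ ≤ B / L ^ (M + 2) * (x * K) := by gcongr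
      _ = _ := by ring
  -- the boundary term is at most of order `x ^ σ`, which is of lower order as `σ < 1`
  have hφ2 : φ 2 ≤ P / Real.log 2 * x / L ^ (M + 2) := by
    have h4 : logBessel ((2 / x) ^ (-σ)) ≤ x ^ σ := by
      refine (logBessel_le_abs _).trans ?_
      rw [abs_of_pos (by positivity), Real.rpow_neg (by positivity),
        ← Real.inv_rpow (by positivity), inv_div]
      gcongr
      linarith
    have h5 := hpow x (by linarith)
    have h6 : x ^ σ ≤ P * x / L ^ (M + 2) := by
      rw [le_div_iff₀ (by positivity)]
      calc x ^ σ * L ^ (M + 2) ≤ x ^ σ * (P * x ^ (1 - σ)) := by gcongr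
        _ = P * (x ^ σ * x ^ (1 - σ)) := by ring
        _ = P * x := by rw [← Real.rpow_add hx0]; simp
    calc φ 2 ≤ (P * x / L ^ (M + 2)) / Real.log 2 := by
          simp only [hφ]; gcongr; exact h4.trans h6
      _ = _ := by ring
  have h4 := h₁ x y hx hy hxy
  have h5 : 0 ≤ (x / y) ^ (2 * σ - 1) / L := by positivity
  have h6 : 0 ≤ 1 / L ^ (M + 2) := by positivity
  refine (abs_sub_le _ (∫ u in (2 : ℝ)..y, φ u) _).trans ((add_le_add h3 h4).trans ?_)
  have h7 : C₂ * (φ 2 + ∫ u in (2 : ℝ)..y, φ u / Real.log u ^ (M + 1)) ≤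
      C₂ * (P / Real.log 2 * x / L ^ (M + 2) + B * K * x / L ^ (M + 2)) := by gcongr
  have h8 : 0 ≤ C₂ * (P / Real.log 2 + B * K) * x * ((x / y) ^ (2 * σ - 1) / L) := by positivity
  have e : C₂ * (P / Real.log 2 * x / L ^ (M + 2) + B * K * x / L ^ (M + 2)) =
    C₂ * (P / Real.log 2 + B * K) * x * (1 / L ^ (M + 2)) := by ring
  rw [e] at h7
  linarith

end

noncomputable section

/-! ### The moments of a single Euler factor -/

/-- **Parseval's identity** for an absolutely convergent power series on the unit circle. -/
lemma integral_norm_sq_tsum_eq {a : ℕ → ℝ} (ha : Summable a) (ha0 : ∀ j, 0 ≤ a j) :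
    ∫ θ in (0 : ℝ)..1, ‖∑' j, (a j : ℂ) * Complex.exp (2 * Real.pi * Complex.I * θ) ^ j‖ ^ 2 =
      ∑' j, a j ^ 2 := by
  set e : ℝ → ℂ := fun θ => Complex.exp (2 * Real.pi * Complex.I * θ) with he
  have hec : Continuous e := by fun_prop
  have hen (θ : ℝ) : ‖e θ‖ = 1 := by
    simp only [he]
    rw [show (2 : ℂ) * Real.pi * Complex.I * θ = ((2 * Real.pi * θ : ℝ) : ℂ) * Complex.I by
      push_cast; ring, Complex.norm_exp_ofReal_mul_I]
  have hterm (j : ℕ) (θ : ℝ) : ‖(a j : ℂ) * e θ ^ j‖ = a j := by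
    rw [norm_mul, norm_pow, hen, one_pow, mul_one, Complex.norm_real, Real.norm_of_nonneg (ha0 j)]
  set g : ℝ → ℂ := fun θ => ∑' j, (a j : ℂ) * e θ ^ j with hg
  have hgc : Continuous g :=
    continuous_tsum (fun j => by fun_prop) ha fun j θ => (hterm j θ).le
  have hgs (θ : ℝ) : HasSum (fun j => (a j : ℂ) * e θ ^ j) (g θ) :=
    (Summable.of_norm_bounded ha fun j => (hterm j θ).le).hasSum
  -- integrate the series termwise against a bounded continuous function
  have key (h : ℝ → ℂ) (hh : Continuous h) (B : ℝ) (hB : ∀ θ, ‖h θ‖ ≤ B) :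
      HasSum (fun j => (a j : ℂ) * ∫ θ in (0 : ℝ)..1, e θ ^ j * h θ)
        (∫ θ in (0 : ℝ)..1, g θ * h θ) := by
    have := intervalIntegral.hasSum_integral_of_dominated_convergence
      (F := fun j θ => (a j : ℂ) * e θ ^ j * h θ) (f := fun θ => g θ * h θ) (μ := volume)
      (a := 0) (b := 1) (fun j _ => a j * B) (fun j => by
        refine Continuous.aestronglyMeasurable ?_; fun_prop)
      (fun j => Filter.Eventually.of_forall fun θ _ => by
        rw [norm_mul, hterm]; exact mul_le_mul_of_nonneg_left (hB θ) (ha0 j))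
      (Filter.Eventually.of_forall fun θ _ => ha.mul_right B) (by simp)
      (Filter.Eventually.of_forall fun θ _ => (hgs θ).mul_right _)
    refine this.congr_fun fun j => ?_
    rw [← intervalIntegral.integral_const_mul]
    simp only [mul_assoc]
  have horth (j m : ℕ) : ∫ θ in (0 : ℝ)..1, e θ ^ j * starRingEnd ℂ (e θ) ^ m =
      if j = m then 1 else 0 := by
    have e1 (θ : ℝ) : e θ ^ j * starRingEnd ℂ (e θ) ^ m =
        Complex.exp ((2 * Real.pi * Complex.I * ((j : ℂ) - m)) * θ) := by
      simp only [he]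
      rw [← Complex.exp_conj, ← Complex.exp_nat_mul, ← Complex.exp_nat_mul, ← Complex.exp_add]
      congr 1
      simp only [map_mul, Complex.conj_I, Complex.conj_ofReal, map_ofNat]
      ring
    simp_rw [e1]
    split_ifs with hjm
    · simp [hjm]
    · have hne : (2 * Real.pi * Complex.I * ((j : ℂ) - m)) ≠ 0 := by
        refine mul_ne_zero Complex.two_pi_I_ne_zero (sub_ne_zero.mpr ?_)
        exact_mod_cast hjm
      rw [integral_exp_mul_complex hne]
      have : Complex.exp (2 * Real.pi * Complex.I * ((j : ℂ) - m) * ((1 : ℝ) : ℂ)) = 1 := by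
        have := Complex.exp_int_mul_two_pi_mul_I ((j : ℤ) - m)
        rw [← this]; congr 1; push_cast; ring
      rw [this]; simp
  have hcoef (m : ℕ) : ∫ θ in (0 : ℝ)..1, g θ * starRingEnd ℂ (e θ) ^ m = a m := by
    have h1 := key (fun θ => starRingEnd ℂ (e θ) ^ m) (by fun_prop) 1 fun θ => by
      rw [norm_pow, RCLike.norm_conj, hen, one_pow]
    simp_rw [horth] at h1
    refine h1.unique ?_
    have := hasSum_ite_eq m (a m : ℂ)
    refine this.congr_fun fun j => ?_
    split_ifs with h
    · rw [h, mul_one]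
    · rw [mul_zero]
  have hgB (θ : ℝ) : ‖g θ‖ ≤ ∑' j, a j :=
    tsum_of_norm_bounded ha.hasSum fun j => (hterm j θ).le
  -- apply this to the conjugate of the sum itself
  have h2 := key (fun θ => starRingEnd ℂ (g θ)) (by fun_prop) (∑' j, a j) fun θ => by
    rw [RCLike.norm_conj]; exact hgB θ
  have h3 (m : ℕ) : ∫ θ in (0 : ℝ)..1, e θ ^ m * starRingEnd ℂ (g θ) = a m := by
    have := congrArg (starRingEnd ℂ) (hcoef m)
    rw [intervalIntegral.integral_of_le zero_le_one, ← integral_conj, Complex.conj_ofReal] at this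
    rw [← this, intervalIntegral.integral_of_le zero_le_one]
    refine integral_congr_ae (Filter.Eventually.of_forall fun θ => ?_)
    simp [mul_comm]
  simp_rw [h3] at h2
  have h4 : (∫ θ in (0 : ℝ)..1, g θ * starRingEnd ℂ (g θ)) =
      ((∫ θ in (0 : ℝ)..1, ‖g θ‖ ^ 2 : ℝ) : ℂ) := by
    rw [← intervalIntegral.integral_ofReal]
    refine intervalIntegral.integral_congr fun θ _ => ?_
    simp only [Complex.mul_conj, Complex.normSq_eq_norm_sq]
  rw [h4] at h2
  have h5 : HasSum (fun j => a j ^ 2) (∫ θ in (0 : ℝ)..1, ‖g θ‖ ^ 2) := by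
    have : HasSum (fun j => ((a j ^ 2 : ℝ) : ℂ)) ((∫ θ in (0 : ℝ)..1, ‖g θ‖ ^ 2 : ℝ) : ℂ) := by
      refine h2.congr_fun fun j => ?_
      push_cast; ring
    exact Complex.hasSum_ofReal.mp this
  exact h5.tsum_eq.symm

/-- The coefficient of `z ^ j` in `(1 - z) ^ (-κ)`. -/
def negBinom (κ : ℝ) (j : ℕ) : ℝ := Ring.multichoose κ j

lemma negBinom_zero (κ : ℝ) : negBinom κ 0 = 1 := Ring.multichoose_zero_right κ

lemma negBinom_nonneg {κ : ℝ} (hκ : 0 < κ) (j : ℕ) : 0 ≤ negBinom κ j := by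
  have h := Ring.factorial_nsmul_multichoose_eq_ascPochhammer κ j
  rw [Polynomial.ascPochhammer_smeval_eq_eval, nsmul_eq_mul] at h
  have h1 := ascPochhammer_pos j κ hκ
  rw [← h] at h1
  exact (pos_of_mul_pos_right h1 (by positivity)).le

lemma hasSum_negBinom_mul_pow (κ : ℝ) {z : ℂ} (hz : ‖z‖ < 1) :
    HasSum (fun j => (negBinom κ j : ℂ) * z ^ j) ((1 - z) ^ (-κ : ℂ)) := by
  have h := (Complex.one_div_one_sub_cpow_hasFPowerSeriesOnBall_zero (κ : ℂ)).hasSum (y := z)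
    (by simpa [enorm_eq_nnnorm, ← NNReal.coe_lt_coe] using hz)
  rw [zero_add, one_div, ← Complex.cpow_neg] at h
  refine h.congr_fun fun j => ?_
  rw [FormalMultilinearSeries.ofScalars_apply_eq, smul_eq_mul, negBinom, Ring.choose]
  congr 1
  rw [show (κ : ℂ) + j - 1 - j + 1 = (κ : ℂ) by ring]
  exact Ring.map_multichoose (algebraMap ℝ ℂ) κ j

lemma hasSum_negBinom_mul_pow_real (κ : ℝ) {u : ℝ} (hu0 : 0 ≤ u) (hu : u < 1) :
    HasSum (fun j => negBinom κ j * u ^ j) ((1 - u) ^ (-κ)) := by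
  have h := hasSum_negBinom_mul_pow κ (z := u) (by rwa [Complex.norm_real, Real.norm_of_nonneg hu0])
  rw [← Complex.hasSum_ofReal, Complex.ofReal_cpow (by linarith)]
  push_cast
  exact h

/-- `∑ⱼ cⱼ² u ^ (2j)` for the coefficients `cⱼ` of `(1 - z) ^ (-κ)`: the moment of order `2κ` of
the Euler factor `|1 - u e(θ)|⁻¹` for uniformly distributed `θ`. -/
def localMoment (κ u : ℝ) : ℝ := ∑' j, (negBinom κ j * u ^ j) ^ 2

lemma localMoment_eq_integral {κ u : ℝ} (hκ : 0 < κ) (hu0 : 0 ≤ u) (hu : u < 1) :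
    localMoment κ u = ∫ θ in (0 : ℝ)..1,
      ‖1 - (u : ℂ) * Complex.exp (2 * Real.pi * Complex.I * θ)‖ ^ (-(2 * κ)) := by
  rw [localMoment, ← integral_norm_sq_tsum_eq (hasSum_negBinom_mul_pow_real κ hu0 hu).summable
    fun j => mul_nonneg (negBinom_nonneg hκ j) (pow_nonneg hu0 j)]
  refine intervalIntegral.integral_congr fun θ _ => ?_
  set e := Complex.exp (2 * Real.pi * Complex.I * θ) with he
  have hen : ‖e‖ = 1 := by
    rw [he, show (2 : ℂ) * Real.pi * Complex.I * θ = ((2 * Real.pi * θ : ℝ) : ℂ) * Complex.I by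
      push_cast; ring, Complex.norm_exp_ofReal_mul_I]
  have hz : ‖(u : ℂ) * e‖ < 1 := by
    rw [norm_mul, hen, mul_one, Complex.norm_real, Real.norm_of_nonneg hu0]; exact hu
  have h := (hasSum_negBinom_mul_pow κ hz).tsum_eq
  have e1 : ∑' j, ((negBinom κ j * u ^ j : ℝ) : ℂ) * e ^ j = (1 - (u : ℂ) * e) ^ (-κ : ℂ) := by
    rw [← h]
    refine tsum_congr fun j => ?_
    push_cast; ring
  rw [e1, ← Complex.ofReal_neg, Complex.norm_cpow_real, ← Real.rpow_mul_natCast (norm_nonneg _)]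
  congr 1; push_cast; ring

lemma one_le_localMoment {κ u : ℝ} (hκ : 0 < κ) (hu0 : 0 ≤ u) (hu : u < 1) :
    1 ≤ localMoment κ u := by
  have h0 (j : ℕ) : 0 ≤ negBinom κ j * u ^ j :=
    mul_nonneg (negBinom_nonneg hκ j) (pow_nonneg hu0 j)
  have hs := (hasSum_negBinom_mul_pow_real κ hu0 hu).summable
  have hs2 : Summable fun j => (negBinom κ j * u ^ j) ^ 2 := by
    refine Summable.of_nonneg_of_le (fun j => by positivity) (fun j => ?_)
      (hs.mul_left (∑' j, negBinom κ j * u ^ j))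
    rw [sq]
    exact mul_le_mul_of_nonneg_right (hs.le_tsum j fun i _ => h0 i) (h0 j)
  have := hs2.le_tsum 0 fun i _ => by positivity
  rw [localMoment]
  simpa [negBinom_zero] using this

/-- The moment of order `k` of an Euler factor is close to `I₀(k u)`. -/
lemma abs_log_localMoment_sub_le {k u : ℝ} (hk : 0 < k) (hu0 : 0 ≤ u) (hu : u ≤ 4 / 5) :
    |Real.log (localMoment (k / 2) u) - logBessel (k * u)| ≤ 5 / 2 * k * u ^ 2 := by
  have hu1 : u < 1 := by linarith
  have hE := one_le_localMoment (half_pos hk) hu0 hu1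
  set δ := 5 / 2 * k * u ^ 2 with hδ
  -- pointwise in `θ`, keep only the linear term of `-log (1 - z)`
  have hpt (θ : ℝ) : |Real.log (‖1 - (u : ℂ) * Complex.exp (2 * Real.pi * Complex.I * θ)‖ ^ (-k)) -
      k * u * Real.cos (2 * Real.pi * θ)| ≤ δ ∧
      0 < ‖1 - (u : ℂ) * Complex.exp (2 * Real.pi * Complex.I * θ)‖ := by
    set e := Complex.exp (2 * Real.pi * Complex.I * θ) with he
    have he' : e = Complex.exp (((2 * Real.pi * θ : ℝ) : ℂ) * Complex.I) := by
      rw [he]; congr 1; push_cast; ring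
    have hzn : ‖(u : ℂ) * e‖ = u := by
      rw [norm_mul, he', Complex.norm_exp_ofReal_mul_I, mul_one, Complex.norm_real,
        Real.norm_of_nonneg hu0]
    have hz : ‖(u : ℂ) * e‖ < 1 := by rw [hzn]; exact hu1
    have h1 := Complex.norm_log_one_sub_inv_sub_self_le hz
    have h2 := (Complex.abs_re_le_norm _).trans h1
    have hre : ((u : ℂ) * e).re = u * Real.cos (2 * Real.pi * θ) := by
      rw [Complex.re_ofReal_mul, he', Complex.exp_ofReal_mul_I_re]
    rw [Complex.sub_re, Complex.log_re, hre, hzn, norm_inv, Real.log_inv] at h2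
    have hpos : 0 < ‖1 - (u : ℂ) * e‖ := by
      rw [norm_pos_iff, sub_ne_zero]
      intro h
      rw [← h] at hz; simp at hz
    refine ⟨?_, hpos⟩
    rw [Real.log_rpow hpos, show -k * Real.log ‖1 - (u : ℂ) * e‖ -
      k * u * Real.cos (2 * Real.pi * θ) = k * (-Real.log ‖1 - (u : ℂ) * e‖ -
        u * Real.cos (2 * Real.pi * θ)) by ring, abs_mul, abs_of_pos hk]
    have h3 : (1 - u)⁻¹ ≤ 5 := by
      rw [inv_le_comm₀ (by linarith) (by norm_num)]; linarith
    calc _ ≤ k * (u ^ 2 * (1 - u)⁻¹ / 2) := by gcongr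
      _ ≤ k * (u ^ 2 * 5 / 2) := by gcongr
      _ = δ := by rw [hδ]; ring
  have hI := localMoment_eq_integral (half_pos hk) hu0 hu1
  rw [show 2 * (k / 2) = k by ring] at hI
  have hcont : Continuous fun θ : ℝ =>
      ‖1 - (u : ℂ) * Complex.exp (2 * Real.pi * Complex.I * θ)‖ ^ (-k) :=
    Continuous.rpow_const (by fun_prop) fun θ => Or.inl (hpt θ).2.ne'
  have hi1 := hcont.intervalIntegrable (μ := volume) 0 1
  have hi2 (c : ℝ) : IntervalIntegrable
      (fun θ => c * Real.exp (k * u * Real.cos (2 * Real.pi * θ))) volume 0 1 :=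
    Continuous.intervalIntegrable (by fun_prop) _ _
  have hup : localMoment (k / 2) u ≤ Real.exp δ * besselIZero (k * u) := by
    rw [hI, besselIZero, ← intervalIntegral.integral_const_mul]
    refine intervalIntegral.integral_mono_on zero_le_one hi1 (hi2 _) fun θ _ => ?_
    obtain ⟨h1, h2⟩ := hpt θ
    rw [← Real.exp_add, ← Real.log_le_iff_le_exp (Real.rpow_pos_of_pos h2 _)]
    linarith [(abs_le.mp h1).2]
  have hlo : Real.exp (-δ) * besselIZero (k * u) ≤ localMoment (k / 2) u := by
    rw [hI, besselIZero, ← intervalIntegral.integral_const_mul]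
    refine intervalIntegral.integral_mono_on zero_le_one (hi2 _) hi1 fun θ _ => ?_
    obtain ⟨h1, h2⟩ := hpt θ
    rw [← Real.exp_add, ← Real.le_log_iff_exp_le (Real.rpow_pos_of_pos h2 _)]
    linarith [(abs_le.mp h1).1]
  have hB := besselIZero_pos (k * u)
  have h1 := Real.log_le_log (by linarith) hup
  have h2 := Real.log_le_log (by positivity) hlo
  rw [Real.log_mul (Real.exp_pos _).ne' hB.ne', Real.log_exp] at h1 h2
  rw [abs_le, logBessel]
  constructor <;> linarith

lemma natCast_rpow_neg_le {σ : ℝ} (hσ : 2 / 5 ≤ σ) {p : ℕ} (hp : p.Prime) :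
    (p : ℝ) ^ (-σ) ≤ 4 / 5 := by
  have h2 : (2 : ℝ) ≤ p := by exact_mod_cast hp.two_le
  calc (p : ℝ) ^ (-σ) ≤ (2 : ℝ) ^ (-σ) :=
        Real.rpow_le_rpow_of_nonpos (by norm_num) h2 (by linarith)
    _ ≤ (2 : ℝ) ^ (-(2 / 5 : ℝ)) := Real.rpow_le_rpow_of_exponent_le (by norm_num) (by linarith)
    _ ≤ 4 / 5 := by
      rw [Real.rpow_neg (by norm_num), inv_le_comm₀ (by positivity) (by norm_num)]
      refine (pow_le_pow_iff_left₀ (by norm_num) (by positivity) (n := 5) (by norm_num)).mp ?_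
      rw [← Real.rpow_natCast (n := 5) (x := (2 : ℝ) ^ (2 / 5 : ℝ)), ← Real.rpow_mul (by norm_num)]
      norm_num

/-- The logarithm of the moment of order `k` of the random model of `|ζ(σ + it; y)|`. -/
def cumulant (σ y k : ℝ) : ℝ :=
  ∑ p ∈ (Finset.Icc 1 ⌊y⌋₊).filter Nat.Prime, Real.log (localMoment (k / 2) ((p : ℝ) ^ (-σ)))

lemma cumulant_nonneg {σ y k : ℝ} (hσ : 1 / 2 < σ) (hk : 0 < k) : 0 ≤ cumulant σ y k := by
  refine Finset.sum_nonneg fun p hp => ?_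
  have hp' := (Finset.mem_filter.mp hp).2
  have h1 := natCast_rpow_neg_le (σ := σ) (by linarith) hp'
  exact Real.log_nonneg (one_le_localMoment (half_pos hk) (by positivity) (by linarith))

/-- The cumulant generating function of the random model, in powers of `1 / log x`, where
`k = x ^ σ`. -/
theorem exists_abs_cumulant_sub_le {σ : ℝ} (hσ : 1 / 2 < σ) (hσ1 : σ < 1) (M : ℕ) :
    ∃ C : ℝ, 0 < C ∧ ∀ x y : ℝ, 2 ≤ x → 2 ≤ y → x ≤ y ^ 2 →
      |cumulant σ y (x ^ σ) -
        x * ∑ n ∈ Finset.range (M + 1), besselMoment σ n / Real.log x ^ (n + 1)| ≤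
      C * x * (1 / Real.log x ^ (M + 2) + (x / y) ^ (2 * σ - 1) / Real.log x) := by
  obtain ⟨C₁, hC₁, h₁⟩ := exists_abs_sum_logBessel_sub_le hσ hσ1 M
  obtain ⟨P, hP, hpow⟩ := exists_log_pow_le (M + 2) (show 0 < 1 - σ by linarith)
  have hsum : Summable fun n : ℕ => (n : ℝ) ^ (-(2 * σ)) :=
    Real.summable_nat_rpow.mpr (by linarith)
  set Z := ∑' n : ℕ, (n : ℝ) ^ (-(2 * σ)) with hZ
  have hZ0 : 0 ≤ Z := tsum_nonneg fun n => by positivity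
  refine ⟨C₁ + 5 / 2 * Z * P, by positivity, fun x y hx hy hxy => ?_⟩
  have hx0 : 0 < x := by linarith
  have hL : 0 < Real.log x := Real.log_pos (by linarith)
  have h1 := h₁ x y hx hy hxy
  have h2 : |cumulant σ y (x ^ σ) -
      ∑ p ∈ (Finset.Icc 1 ⌊y⌋₊).filter Nat.Prime, logBessel ((p / x) ^ (-σ))| ≤
      5 / 2 * x ^ σ * Z := by
    rw [cumulant, ← Finset.sum_sub_distrib]
    refine (Finset.abs_sum_le_sum_abs _ _).trans ?_
    calc _ ≤ ∑ p ∈ (Finset.Icc 1 ⌊y⌋₊).filter Nat.Prime,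
          5 / 2 * x ^ σ * (p : ℝ) ^ (-(2 * σ)) := by
          refine Finset.sum_le_sum fun p hp => ?_
          have hp' := (Finset.mem_filter.mp hp).2
          have hp0 : (0 : ℝ) < p := by exact_mod_cast hp'.pos
          have h3 := abs_log_localMoment_sub_le (k := x ^ σ) (u := (p : ℝ) ^ (-σ)) (by positivity)
            (by positivity) (natCast_rpow_neg_le (by linarith) hp')
          have e1 : x ^ σ * (p : ℝ) ^ (-σ) = (p / x) ^ (-σ) := by
            rw [Real.div_rpow hp0.le hx0.le, Real.rpow_neg hx0.le, div_inv_eq_mul, mul_comm]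
          have e2 : ((p : ℝ) ^ (-σ)) ^ 2 = (p : ℝ) ^ (-(2 * σ)) := by
            rw [← Real.rpow_mul_natCast hp0.le]; congr 1; push_cast; ring
          rwa [e1, e2] at h3
      _ ≤ _ := by
          rw [← Finset.mul_sum]
          have := hsum.sum_le_tsum ((Finset.Icc 1 ⌊y⌋₊).filter Nat.Prime)
            fun n _ => by positivity
          gcongr
  have h3 := hpow x (by linarith)
  have h4 : x ^ σ ≤ P * x * (1 / Real.log x ^ (M + 2)) := by
    rw [mul_one_div, le_div_iff₀ (by positivity)]
    calc x ^ σ * Real.log x ^ (M + 2) ≤ x ^ σ * (P * x ^ (1 - σ)) := by gcongr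
      _ = P * (x ^ σ * x ^ (1 - σ)) := by ring
      _ = P * x := by rw [← Real.rpow_add hx0]; simp
  refine (abs_sub_le _ _ _).trans ((add_le_add h2 h1).trans ?_)
  have h5 : 5 / 2 * x ^ σ * Z ≤ 5 / 2 * (P * x * (1 / Real.log x ^ (M + 2))) * Z := by gcongr
  have h6 : 0 ≤ 5 / 2 * Z * P * x * ((x / y) ^ (2 * σ - 1) / Real.log x) := by positivity
  linarith

end

noncomputable section

/-! ### Moments of the short Euler product -/

lemma abs_log_natCast_sub_log_natCast_ge {X m n : ℕ} (hm : m ∈ Finset.Icc 1 X)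
    (hn : n ∈ Finset.Icc 1 X) (hmn : m ≠ n) : 1 / (X : ℝ) ≤ |Real.log m - Real.log n| := by
  rw [Finset.mem_Icc] at hm hn
  wlog h : n < m generalizing m n
  · rw [abs_sub_comm]
    exact this hn hm hmn.symm (by omega)
  have hm0 : (0 : ℝ) < m := by exact_mod_cast hm.1
  have hn0 : (0 : ℝ) < n := by exact_mod_cast hn.1
  have hX : (m : ℝ) ≤ X := by exact_mod_cast hm.2
  have h1 : (n : ℝ) + 1 ≤ m := by exact_mod_cast h
  have h2 := Real.one_sub_inv_le_log_of_pos (show 0 < (m : ℝ) / n by positivity)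
  rw [Real.log_div hm0.ne' hn0.ne', inv_div] at h2
  refine le_trans ?_ (le_abs_self _)
  refine le_trans ?_ h2
  calc 1 / (X : ℝ) ≤ 1 / m := by gcongr
    _ ≤ (m - n) / m := by gcongr; linarith
    _ = _ := by field_simp

lemma abs_integral_cos_mul_le {l : ℝ} (hl : l ≠ 0) (a b : ℝ) :
    |∫ t in a..b, Real.cos (t * l)| ≤ 2 / |l| := by
  rw [intervalIntegral.integral_comp_mul_right _ hl, integral_cos, smul_eq_mul, abs_mul, abs_inv,
    inv_mul_eq_div]
  gcongr
  refine (abs_sub _ _).trans ?_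
  linarith [Real.abs_sin_le_one (b * l), Real.abs_sin_le_one (a * l)]

/-- The mean square of a Dirichlet polynomial. -/
lemma abs_integral_norm_sq_sub_le {a : ℕ → ℝ} (ha : ∀ n, 0 ≤ a n) (X : ℕ) (T : ℝ) :
    |(∫ t in T..2 * T, ‖∑ n ∈ Finset.Icc 1 X,
        (a n : ℂ) * Complex.exp (((-(t * Real.log n) : ℝ) : ℂ) * Complex.I)‖ ^ 2) -
        T * ∑ n ∈ Finset.Icc 1 X, a n ^ 2| ≤
      2 * (X : ℝ) ^ 2 * ∑ n ∈ Finset.Icc 1 X, a n ^ 2 := by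
  set s := Finset.Icc 1 X with hs
  have hexp (t : ℝ) : ‖∑ n ∈ s,
      (a n : ℂ) * Complex.exp (((-(t * Real.log n) : ℝ) : ℂ) * Complex.I)‖ ^ 2 =
      ∑ m ∈ s, ∑ n ∈ s, a m * a n * Real.cos (t * (Real.log m - Real.log n)) := by
    rw [← Complex.normSq_eq_norm_sq, Complex.normSq_apply, Complex.re_sum, Complex.im_sum,
      Finset.sum_mul_sum, Finset.sum_mul_sum, ← Finset.sum_add_distrib]
    refine Finset.sum_congr rfl fun m _ => ?_
    rw [← Finset.sum_add_distrib]
    refine Finset.sum_congr rfl fun n _ => ?_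
    rw [Complex.re_ofReal_mul, Complex.re_ofReal_mul, Complex.im_ofReal_mul, Complex.im_ofReal_mul,
      Complex.exp_ofReal_mul_I_re, Complex.exp_ofReal_mul_I_re, Complex.exp_ofReal_mul_I_im,
      Complex.exp_ofReal_mul_I_im, Real.cos_neg, Real.cos_neg, Real.sin_neg, Real.sin_neg, mul_sub,
      Real.cos_sub]
    ring
  have hint : ∫ t in T..2 * T, ∑ m ∈ s, ∑ n ∈ s,
      a m * a n * Real.cos (t * (Real.log m - Real.log n)) =
      ∑ m ∈ s, ∑ n ∈ s, a m * a n *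
        ∫ t in T..2 * T, Real.cos (t * (Real.log m - Real.log n)) := by
    rw [intervalIntegral.integral_finsetSum fun m _ =>
      Continuous.intervalIntegrable (by fun_prop) _ _]
    refine Finset.sum_congr rfl fun m _ => ?_
    rw [intervalIntegral.integral_finsetSum fun n _ =>
      Continuous.intervalIntegrable (by fun_prop) _ _]
    exact Finset.sum_congr rfl fun n _ => intervalIntegral.integral_const_mul _ _
  simp_rw [hexp]
  rw [hint]
  have hdiag : T * ∑ n ∈ s, a n ^ 2 =
      ∑ m ∈ s, ∑ n ∈ s, a m * a n * (if m = n then T else 0) := by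
    rw [Finset.mul_sum]
    refine Finset.sum_congr rfl fun m hm => ?_
    simp only [mul_ite, mul_zero]
    rw [Finset.sum_ite_eq s m, if_pos hm]
    ring
  rw [hdiag, ← Finset.sum_sub_distrib]
  simp_rw [← Finset.sum_sub_distrib, ← mul_sub]
  have hbd (m n : ℕ) (hm : m ∈ s) (hn : n ∈ s) :
      |(∫ t in T..2 * T, Real.cos (t * (Real.log m - Real.log n))) - if m = n then T else 0| ≤
        2 * X := by
    split_ifs with h
    · subst h
      simp only [sub_self, mul_zero, Real.cos_zero, intervalIntegral.integral_const, smul_eq_mul,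
        mul_one]
      rw [show 2 * T - T - T = 0 by ring, abs_zero]
      positivity
    · have h1 := abs_log_natCast_sub_log_natCast_ge hm hn h
      have hX : (0 : ℝ) < X := by
        have := Finset.mem_Icc.mp hm
        exact_mod_cast (by omega : 0 < X)
      have h0 : 0 < |Real.log m - Real.log n| := lt_of_lt_of_le (by positivity) h1
      rw [sub_zero]
      refine (abs_integral_cos_mul_le (abs_pos.mp h0) _ _).trans ?_
      rw [div_le_iff₀ h0]
      calc (2 : ℝ) = 2 * X * (1 / X) := by field_simp
        _ ≤ _ := by gcongr
  calc _ ≤ ∑ m ∈ s, ∑ n ∈ s, a m * a n * (2 * X) := by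
        refine (Finset.abs_sum_le_sum_abs _ _).trans (Finset.sum_le_sum fun m hm => ?_)
        refine (Finset.abs_sum_le_sum_abs _ _).trans (Finset.sum_le_sum fun n hn => ?_)
        rw [abs_mul, abs_of_nonneg (mul_nonneg (ha m) (ha n))]
        exact mul_le_mul_of_nonneg_left (hbd m n hm hn) (mul_nonneg (ha m) (ha n))
    _ = 2 * X * (∑ n ∈ s, a n) ^ 2 := by
        simp_rw [← Finset.sum_mul, ← Finset.mul_sum]
        rw [← Finset.sum_mul]
        ring
    _ ≤ 2 * X * (X * ∑ n ∈ s, a n ^ 2) := by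
        have := sq_sum_le_card_mul_sum_sq (s := s) (f := a)
        rw [hs, Nat.card_Icc, Nat.add_sub_cancel] at this
        gcongr
    _ = _ := by ring

/-- The mean square of a Dirichlet series with nonnegative coefficients, most of whose mass sits on
a short initial segment. -/
lemma integral_norm_sq_tsum_mem_Icc {a : ℕ → ℝ} (ha : ∀ n, 0 ≤ a n)
    (hs : Summable a) {X : ℕ} {T : ℝ} (hT : 0 < T) (hX : 20 * (X : ℝ) ^ 2 ≤ T)
    (htail : ∑' n, a n - ∑ n ∈ Finset.Icc 1 X, a n ≤ 1 / 5) (hE : 1 ≤ ∑' n, a n ^ 2) :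
    (∫ t in T..2 * T, ‖∑' n : ℕ,
      (a n : ℂ) * Complex.exp (((-(t * Real.log n) : ℝ) : ℂ) * Complex.I)‖ ^ 2) ∈
        Set.Icc (T * (1 / 2 * ∑' n, a n ^ 2)) (T * (2 * ∑' n, a n ^ 2)) := by
  set F : ℝ → ℂ := fun t => ∑' n : ℕ,
      (a n : ℂ) * Complex.exp (((-(t * Real.log n) : ℝ) : ℂ) * Complex.I) with hF
  set D : ℝ → ℂ := fun t => ∑ n ∈ Finset.Icc 1 X,
      (a n : ℂ) * Complex.exp (((-(t * Real.log n) : ℝ) : ℂ) * Complex.I) with hD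
  have hterm (n : ℕ) (t : ℝ) :
      ‖(a n : ℂ) * Complex.exp (((-(t * Real.log n) : ℝ) : ℂ) * Complex.I)‖ = a n := by
    rw [norm_mul, Complex.norm_exp_ofReal_mul_I, mul_one, Complex.norm_real,
      Real.norm_of_nonneg (ha n)]
  have hFc : Continuous F := continuous_tsum (fun n => by fun_prop) hs fun n t => (hterm n t).le
  have hDc : Continuous D := by fun_prop
  have hFs (t : ℝ) : Summable fun n : ℕ =>
      (a n : ℂ) * Complex.exp (((-(t * Real.log n) : ℝ) : ℂ) * Complex.I) :=
    Summable.of_norm_bounded hs fun n => (hterm n t).le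
  have hsc := hs.comp_injective
    (Subtype.val_injective (p := fun n => n ∉ Finset.Icc 1 X))
  have hr0 : 0 ≤ ∑' n, a n - ∑ n ∈ Finset.Icc 1 X, a n :=
    sub_nonneg.mpr (hs.sum_le_tsum _ fun n _ => ha n)
  set r := ∑' n, a n - ∑ n ∈ Finset.Icc 1 X, a n with hr
  have hcompl : ∑' n : {n // n ∉ Finset.Icc 1 X}, a n = r := by
    rw [hr, ← hs.sum_add_tsum_subtype_compl (Finset.Icc 1 X)]; ring
  -- the sum is uniformly close to its initial segment `D`
  have hFD (t : ℝ) : ‖F t - D t‖ ≤ 1 / 5 := by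
    refine le_trans ?_ htail
    rw [← hcompl]
    have : F t - D t = ∑' n : {n // n ∉ Finset.Icc 1 X},
        (a n : ℂ) * Complex.exp (((-(t * Real.log n) : ℝ) : ℂ) * Complex.I) := by
      simp only [hF, hD]
      rw [← (hFs t).sum_add_tsum_subtype_compl (Finset.Icc 1 X)]; ring
    rw [this]
    exact tsum_of_norm_bounded hsc.hasSum fun n => (hterm n t).le
  have hsq : Summable fun n => a n ^ 2 := by
    refine Summable.of_nonneg_of_le (fun n => by positivity) (fun n => ?_)
      (hs.mul_left (∑' n, a n))
    rw [sq]
    exact mul_le_mul_of_nonneg_right (hs.le_tsum n fun i _ => ha i) (ha n)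
  set E := ∑' n, a n ^ 2 with hEd
  set S := ∑ n ∈ Finset.Icc 1 X, a n ^ 2 with hS
  have hSE : S ≤ E := hsq.sum_le_tsum _ fun n _ => by positivity
  have hES : E - 1 / 25 ≤ S := by
    have h1 : E - S = ∑' n : {n // n ∉ Finset.Icc 1 X}, a n ^ 2 := by
      rw [hEd, ← hsq.sum_add_tsum_subtype_compl (Finset.Icc 1 X)]; ring
    have h2 : ∑' n : {n // n ∉ Finset.Icc 1 X}, a n ^ 2 ≤
        ∑' n : {n // n ∉ Finset.Icc 1 X}, r * a n := by
      refine (hsq.comp_injective Subtype.val_injective).tsum_le_tsum (fun n => ?_) (hsc.mul_left r)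
      rw [sq]
      refine mul_le_mul_of_nonneg_right ?_ (ha n)
      rw [← hcompl]
      exact hsc.le_tsum n fun i _ => ha i
    rw [tsum_mul_left, hcompl] at h2
    nlinarith
  have hmain := abs_integral_norm_sq_sub_le ha X T
  rw [← hS] at hmain
  have hS0 : 0 ≤ S := Finset.sum_nonneg fun n _ => by positivity
  -- the off-diagonal terms are at most a tenth of the diagonal ones
  have hXS : 2 * (X : ℝ) ^ 2 * S ≤ T / 10 * S := by gcongr; linarith
  obtain ⟨hlo, hhi⟩ := abs_le.mp hmain
  have hTT : T ≤ 2 * T := by linarith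
  have hci {f : ℝ → ℝ} (hf : Continuous f) : IntervalIntegrable f volume T (2 * T) :=
    hf.intervalIntegrable _ _
  have hconst (c : ℝ) : ∫ _ in T..2 * T, c = T * c := by
    rw [intervalIntegral.integral_const, smul_eq_mul]; ring
  -- `(a + b) ^ 2 ≤ 5 / 4 * a ^ 2 + 5 * b ^ 2`, with `b ≤ 1 / 5`
  have hup : ∫ t in T..2 * T, ‖F t‖ ^ 2 ≤ 5 / 4 * (∫ t in T..2 * T, ‖D t‖ ^ 2) + T * (1 / 5) := by
    rw [← hconst, ← intervalIntegral.integral_const_mul,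
      ← intervalIntegral.integral_add (hci (by fun_prop)) (hci (by fun_prop))]
    refine intervalIntegral.integral_mono_on hTT (hci (by fun_prop)) (hci (by fun_prop))
      fun t _ => ?_
    have h1 := hFD t
    have h2 : ‖F t‖ ≤ ‖D t‖ + ‖F t - D t‖ := by
      have := norm_add_le (D t) (F t - D t)
      rwa [add_sub_cancel] at this
    have h3 := norm_nonneg (F t)
    have h4 := norm_nonneg (F t - D t)
    nlinarith [sq_nonneg (‖D t‖ - 4 * ‖F t - D t‖)]
  have hdn : ∫ t in T..2 * T, ‖D t‖ ^ 2 ≤ 5 / 4 * (∫ t in T..2 * T, ‖F t‖ ^ 2) + T * (1 / 5) := by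
    rw [← hconst, ← intervalIntegral.integral_const_mul,
      ← intervalIntegral.integral_add (hci (by fun_prop)) (hci (by fun_prop))]
    refine intervalIntegral.integral_mono_on hTT (hci (by fun_prop)) (hci (by fun_prop))
      fun t _ => ?_
    have h1 := hFD t
    have h2 : ‖D t‖ ≤ ‖F t‖ + ‖F t - D t‖ := by
      have := norm_sub_le (F t) (F t - D t)
      rwa [sub_sub_cancel] at this
    have h3 := norm_nonneg (D t)
    have h4 := norm_nonneg (F t - D t)
    nlinarith [sq_nonneg (‖F t‖ - 4 * ‖F t - D t‖)]
  have hTS : T * S ≤ T * E := by gcongr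
  have hTE : T * (E - 1 / 25) ≤ T * S := by gcongr
  have hT1 : T * 1 ≤ T * E := by gcongr
  constructor <;> nlinarith

/-! ### The Dirichlet series of powers of the Euler product -/

/-- The multiplicative function with `d_κ(p ^ j)` the coefficient of `z ^ j` in `(1 - z) ^ (-κ)`. -/
def divisorCoeff (κ : ℝ) (n : ℕ) : ℝ := n.factorization.prod fun _ j => negBinom κ j

lemma divisorCoeff_nonneg {κ : ℝ} (hκ : 0 < κ) (n : ℕ) : 0 ≤ divisorCoeff κ n :=
  Finset.prod_nonneg (s := n.factorization.support)
    (f := fun p => negBinom κ (n.factorization p)) fun _ _ => negBinom_nonneg hκ _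

lemma divisorCoeff_one (κ : ℝ) : divisorCoeff κ 1 = 1 := by simp [divisorCoeff]

lemma divisorCoeff_mul (κ : ℝ) {m n : ℕ} (h : m.Coprime n) :
    divisorCoeff κ (m * n) = divisorCoeff κ m * divisorCoeff κ n := by
  rw [divisorCoeff, Nat.factorization_mul_of_coprime h,
    Finsupp.prod_add_index_of_disjoint (by simpa using h.disjoint_primeFactors)]
  rfl

lemma divisorCoeff_prime_pow (κ : ℝ) {p : ℕ} (hp : p.Prime) (j : ℕ) :
    divisorCoeff κ (p ^ j) = negBinom κ j := by
  rw [divisorCoeff, hp.factorization_pow, Finsupp.prod_single_index (h := fun _ j => negBinom κ j)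
    (negBinom_zero κ)]

/-- The primes up to `y` generate a Dirichlet series with these coefficients. -/
def smoothCoeff (σ κ y : ℝ) (n : ℕ) : ℝ :=
  (Nat.factoredNumbers (Finset.Icc 1 ⌊y⌋₊)).indicator
    (fun n => divisorCoeff κ n * (n : ℝ) ^ (-σ)) n

lemma smoothCoeff_nonneg {κ : ℝ} (hκ : 0 < κ) (σ y : ℝ) (n : ℕ) : 0 ≤ smoothCoeff σ κ y n :=
  Set.indicator_nonneg (fun n _ => mul_nonneg (divisorCoeff_nonneg hκ n) (by positivity)) n

lemma natCast_rpow_neg_lt_one {σ : ℝ} (hσ : 0 < σ) {p : ℕ} (hp : p.Prime) :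
    (p : ℝ) ^ (-σ) < 1 :=
  Real.rpow_lt_one_of_one_lt_of_neg (by exact_mod_cast hp.one_lt) (by linarith)

lemma hasSum_smoothCoeff {σ : ℝ} (hσ : 0 < σ) (κ y : ℝ) :
    HasSum (smoothCoeff σ κ y)
      (∏ p ∈ (Finset.Icc 1 ⌊y⌋₊).filter Nat.Prime, (1 - (p : ℝ) ^ (-σ)) ^ (-κ)) := by
  have hpp {p : ℕ} (hp : p.Prime) (j : ℕ) : divisorCoeff κ (p ^ j) * ((p ^ j : ℕ) : ℝ) ^ (-σ) =
      negBinom κ j * ((p : ℝ) ^ (-σ)) ^ j := by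
    rw [divisorCoeff_prime_pow κ hp, Nat.cast_pow, Real.rpow_pow_comm (by positivity)]
  have hsum {p : ℕ} (hp : p.Prime) := hasSum_negBinom_mul_pow_real κ
    (u := (p : ℝ) ^ (-σ)) (by positivity) (natCast_rpow_neg_lt_one hσ hp)
  have h := (EulerProduct.summable_and_hasSum_factoredNumbers_prod_filter_prime_tsum
    (f := fun n : ℕ => divisorCoeff κ n * (n : ℝ) ^ (-σ))
    (by simp [divisorCoeff_one]) (fun {m n} hmn => by
      rw [divisorCoeff_mul κ hmn, Nat.cast_mul, Real.mul_rpow (by positivity) (by positivity)]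
      ring) (fun {p} hp => by
      simp_rw [hpp hp]
      exact (hsum hp).summable.norm) (Finset.Icc 1 ⌊y⌋₊)).2
  rw [← Function.comp_def (fun n : ℕ => divisorCoeff κ n * (n : ℝ) ^ (-σ)),
    hasSum_subtype_iff_indicator] at h
  have e1 : smoothCoeff σ κ y = (Nat.factoredNumbers (Finset.Icc 1 ⌊y⌋₊)).indicator
      fun n : ℕ => divisorCoeff κ n * (n : ℝ) ^ (-σ) := rfl
  have e2 : ∏ p ∈ (Finset.Icc 1 ⌊y⌋₊).filter Nat.Prime, (1 - (p : ℝ) ^ (-σ)) ^ (-κ) =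
      ∏ p ∈ (Finset.Icc 1 ⌊y⌋₊).filter Nat.Prime,
        ∑' j : ℕ, divisorCoeff κ (p ^ j) * ((p ^ j : ℕ) : ℝ) ^ (-σ) := by
    refine Finset.prod_congr rfl fun p hp => ?_
    have hp' := (Finset.mem_filter.mp hp).2
    simp_rw [hpp hp']
    exact (hsum hp').tsum_eq.symm
  rw [e1, e2]
  exact h

lemma hasSum_smoothCoeff_sq {σ κ : ℝ} (hσ : 0 < σ) (hκ : 0 < κ) (y : ℝ) :
    HasSum (fun n => smoothCoeff σ κ y n ^ 2)
      (∏ p ∈ (Finset.Icc 1 ⌊y⌋₊).filter Nat.Prime, localMoment κ ((p : ℝ) ^ (-σ))) := by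
  have hpp {p : ℕ} (hp : p.Prime) (j : ℕ) : divisorCoeff κ (p ^ j) * ((p ^ j : ℕ) : ℝ) ^ (-σ) =
      negBinom κ j * ((p : ℝ) ^ (-σ)) ^ j := by
    rw [divisorCoeff_prime_pow κ hp, Nat.cast_pow, Real.rpow_pow_comm (by positivity)]
  have hsum {p : ℕ} (hp : p.Prime) := (hasSum_negBinom_mul_pow_real κ
    (u := (p : ℝ) ^ (-σ)) (by positivity) (natCast_rpow_neg_lt_one hσ hp)).summable
  have h := (EulerProduct.summable_and_hasSum_factoredNumbers_prod_filter_prime_tsum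
    (f := fun n : ℕ => (divisorCoeff κ n * (n : ℝ) ^ (-σ)) ^ 2)
    (by simp [divisorCoeff_one]) (fun {m n} hmn => by
      rw [divisorCoeff_mul κ hmn, Nat.cast_mul, Real.mul_rpow (by positivity) (by positivity)]
      ring) (fun {p} hp => by
      simp_rw [hpp hp]
      have h0 (j : ℕ) : 0 ≤ negBinom κ j * ((p : ℝ) ^ (-σ)) ^ j :=
        mul_nonneg (negBinom_nonneg hκ j) (by positivity)
      refine Summable.of_nonneg_of_le (fun j => norm_nonneg _) (fun j => ?_)
        ((hsum hp).mul_left (∑' j, negBinom κ j * ((p : ℝ) ^ (-σ)) ^ j))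
      rw [Real.norm_of_nonneg (sq_nonneg _), sq]
      exact mul_le_mul_of_nonneg_right ((hsum hp).le_tsum j fun i _ => h0 i) (h0 j))
      (Finset.Icc 1 ⌊y⌋₊)).2
  rw [← Function.comp_def (fun n : ℕ => (divisorCoeff κ n * (n : ℝ) ^ (-σ)) ^ 2),
    hasSum_subtype_iff_indicator] at h
  have e1 : (fun n => smoothCoeff σ κ y n ^ 2) =
      (Nat.factoredNumbers (Finset.Icc 1 ⌊y⌋₊)).indicator
        fun n : ℕ => (divisorCoeff κ n * (n : ℝ) ^ (-σ)) ^ 2 := by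
    ext n
    rw [smoothCoeff, Set.indicator_apply, Set.indicator_apply]
    split_ifs <;> simp
  have e2 : ∏ p ∈ (Finset.Icc 1 ⌊y⌋₊).filter Nat.Prime, localMoment κ ((p : ℝ) ^ (-σ)) =
      ∏ p ∈ (Finset.Icc 1 ⌊y⌋₊).filter Nat.Prime,
        ∑' j : ℕ, (divisorCoeff κ (p ^ j) * ((p ^ j : ℕ) : ℝ) ^ (-σ)) ^ 2 := by
    refine Finset.prod_congr rfl fun p hp => ?_
    have hp' := (Finset.mem_filter.mp hp).2
    simp_rw [hpp hp', localMoment]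
  rw [e1, e2]
  exact h

lemma tsum_smoothCoeff_sq {σ k : ℝ} (hσ : 0 < σ) (hk : 0 < k) (y : ℝ) :
    ∑' n, smoothCoeff σ (k / 2) y n ^ 2 = Real.exp (cumulant σ y k) := by
  rw [(hasSum_smoothCoeff_sq hσ (half_pos hk) y).tsum_eq, cumulant, Real.exp_sum]
  refine Finset.prod_congr rfl fun p hp => ?_
  rw [Real.exp_log]
  have := one_le_localMoment (half_pos hk) (u := (p : ℝ) ^ (-σ)) (by positivity)
    (natCast_rpow_neg_lt_one hσ (Finset.mem_filter.mp hp).2)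
  linarith

lemma norm_tsum_smoothCoeff_sq {σ k : ℝ} (hσ : 0 < σ) (hk : 0 < k) (y t : ℝ) :
    ‖∑' n : ℕ, (smoothCoeff σ (k / 2) y n : ℂ) *
      Complex.exp (((-(t * Real.log n) : ℝ) : ℂ) * Complex.I)‖ ^ 2 =
      ‖zetaShort ((σ : ℂ) + (t : ℂ) * Complex.I) y‖ ^ k := by
  set κ := k / 2 with hκd
  have hκ : 0 < κ := half_pos hk
  set s : ℂ := (σ : ℂ) + (t : ℂ) * Complex.I with hs
  have hre : (-s).re = -σ := by simp [hs]
  have hnorm {p : ℕ} (hp : p.Prime) : ‖(p : ℂ) ^ (-s)‖ = (p : ℝ) ^ (-σ) := by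
    rw [Complex.norm_natCast_cpow_of_pos hp.pos, hre]
  have hpp {p : ℕ} (hp : p.Prime) (j : ℕ) :
      (divisorCoeff κ (p ^ j) : ℂ) * ((p ^ j : ℕ) : ℂ) ^ (-s) =
      (negBinom κ j : ℂ) * ((p : ℂ) ^ (-s)) ^ j := by
    rw [divisorCoeff_prime_pow κ hp, Nat.cast_pow]
    congr 1
    induction j with
    | zero => simp
    | succ j ih =>
      rw [pow_succ, pow_succ, ← ih, ← Nat.cast_pow, Complex.natCast_mul_natCast_cpow]
  have hlt {p : ℕ} (hp : p.Prime) : ‖(p : ℂ) ^ (-s)‖ < 1 := by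
    rw [hnorm hp]; exact natCast_rpow_neg_lt_one hσ hp
  have h := (EulerProduct.summable_and_hasSum_factoredNumbers_prod_filter_prime_tsum
    (f := fun n : ℕ => (divisorCoeff κ n : ℂ) * (n : ℂ) ^ (-s))
    (by simp [divisorCoeff_one]) (fun {m n} hmn => by
      rw [divisorCoeff_mul κ hmn, Nat.cast_mul, Complex.natCast_mul_natCast_cpow]
      push_cast; ring) (fun {p} hp => by
      simp_rw [hpp hp]
      refine (hasSum_negBinom_mul_pow_real κ (u := (p : ℝ) ^ (-σ)) (by positivity)
        (natCast_rpow_neg_lt_one hσ hp)).summable.congr fun j => ?_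
      rw [norm_mul, norm_pow, hnorm hp, Complex.norm_real, Real.norm_of_nonneg
        (negBinom_nonneg hκ j)]) (Finset.Icc 1 ⌊y⌋₊)).2
  rw [← Function.comp_def (fun n : ℕ => (divisorCoeff κ n : ℂ) * (n : ℂ) ^ (-s)),
    hasSum_subtype_iff_indicator] at h
  have e1 : (fun n : ℕ => (smoothCoeff σ κ y n : ℂ) *
      Complex.exp (((-(t * Real.log n) : ℝ) : ℂ) * Complex.I)) =
      (Nat.factoredNumbers (Finset.Icc 1 ⌊y⌋₊)).indicator
        (fun n : ℕ => (divisorCoeff κ n : ℂ) * (n : ℂ) ^ (-s)) := by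
    ext n
    rw [smoothCoeff, Set.indicator_apply, Set.indicator_apply]
    split_ifs with hn
    · have hn0 : n ≠ 0 := Nat.ne_zero_of_mem_factoredNumbers hn
      have hn0' : (n : ℂ) ≠ 0 := by exact_mod_cast hn0
      push_cast
      rw [Complex.ofReal_cpow (by positivity), mul_assoc]
      congr 1
      rw [Complex.ofReal_natCast, Complex.cpow_def_of_ne_zero hn0', Complex.cpow_def_of_ne_zero hn0',
        ← Complex.exp_add, ← Complex.natCast_log, hs]
      congr 1
      push_cast
      ring
    · simp
  rw [e1, h.tsum_eq, norm_prod, zetaShort, norm_prod, ← Finset.prod_pow,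
    ← Real.finsetProd_rpow _ _ fun p _ => norm_nonneg _]
  refine Finset.prod_congr rfl fun p hp => ?_
  have hp' := (Finset.mem_filter.mp hp).2
  simp_rw [hpp hp']
  rw [(hasSum_negBinom_mul_pow κ (hlt hp')).tsum_eq, ← Complex.ofReal_neg, Complex.norm_cpow_real,
    ← Real.rpow_mul_natCast (norm_nonneg _), norm_inv, Real.inv_rpow (norm_nonneg _),
    ← Real.rpow_neg (norm_nonneg _)]
  congr 1
  rw [hκd]; push_cast; ring

/-- Rankin's bound for the mass of the coefficients beyond `x`. -/
lemma tsum_smoothCoeff_sub_sum_le {σ κ y x α : ℝ} (hκ : 0 < κ) (hα : 0 < α) (hασ : α < σ)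
    (hx : 0 < x) :
    ∑' n, smoothCoeff σ κ y n - ∑ n ∈ Finset.Icc 1 ⌊x⌋₊, smoothCoeff σ κ y n ≤
      x ^ (-α) * ∏ p ∈ (Finset.Icc 1 ⌊y⌋₊).filter Nat.Prime,
        (1 - (p : ℝ) ^ (-(σ - α))) ^ (-κ) := by
  have h1 := (hasSum_smoothCoeff (hα.trans hασ) κ y).summable
  have h2 := hasSum_smoothCoeff (σ := σ - α) (sub_pos.mpr hασ) κ y
  rw [← h2.tsum_eq, ← h1.sum_add_tsum_subtype_compl (Finset.Icc 1 ⌊x⌋₊), add_sub_cancel_left,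
    ← tsum_mul_left]
  refine le_trans (b := ∑' n : {n // n ∉ Finset.Icc 1 ⌊x⌋₊},
    x ^ (-α) * smoothCoeff (σ - α) κ y n) ?_ ?_
  · refine (h1.comp_injective Subtype.val_injective).tsum_le_tsum (fun n => ?_)
      ((h2.summable.mul_left _).comp_injective Subtype.val_injective)
    obtain ⟨n, hn⟩ := n
    simp only
    rw [smoothCoeff, smoothCoeff, Set.indicator_apply, Set.indicator_apply]
    split_ifs with hm
    · have hn0 : 0 < n := Nat.pos_of_ne_zero (Nat.ne_zero_of_mem_factoredNumbers hm)
      have hn0' : (0 : ℝ) < n := by exact_mod_cast hn0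
      have hxn : x ≤ n := by
        rw [Finset.mem_Icc, not_and, not_le] at hn
        exact (Nat.lt_of_floor_lt (hn hn0)).le
      have h3 : 1 ≤ x ^ (-α) * (n : ℝ) ^ α := by
        rw [Real.rpow_neg hx.le, inv_mul_eq_div, ← Real.div_rpow hn0'.le hx.le]
        exact Real.one_le_rpow (by rw [one_le_div hx]; exact hxn) hα.le
      have h4 := divisorCoeff_nonneg hκ n
      rw [show -(σ - α) = α + -σ by ring, Real.rpow_add hn0']
      calc divisorCoeff κ n * (n : ℝ) ^ (-σ) = divisorCoeff κ n * (n : ℝ) ^ (-σ) * 1 := by ring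
        _ ≤ divisorCoeff κ n * (n : ℝ) ^ (-σ) * (x ^ (-α) * (n : ℝ) ^ α) := by gcongr
        _ = _ := by ring
    · simp
  · exact (h2.summable.mul_left _).tsum_subtype_le (fun n => x ^ (-α) * smoothCoeff (σ - α) κ y n) _
      fun n => mul_nonneg (by positivity) (smoothCoeff_nonneg hκ _ _ n)

/-- The moments of `|ζ(σ + it; y)|` over `[T, 2T]` agree with those of the random model, up to a
factor `2`. -/
theorem exists_moment_mem_Icc {σ : ℝ} (hσ : 1 / 2 < σ) (hσ1 : σ < 1) :
    ∃ c T₁ : ℝ, 0 < c ∧ 1 ≤ T₁ ∧ ∀ T y k : ℝ, T₁ ≤ T → Real.log T ≤ y → y ≤ Real.log T ^ 2 →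
      0 < k → k ≤ c * (Real.log T / y ^ (1 - σ)) →
      (∫ t in T..2 * T, ‖zetaShort ((σ : ℂ) + (t : ℂ) * Complex.I) y‖ ^ k) ∈
        Set.Icc (T * (1 / 2 * Real.exp (cumulant σ y k)))
          (T * (2 * Real.exp (cumulant σ y k))) := by
  obtain ⟨C, hC, hP⟩ := exists_sum_primes_rpow_neg_le (by linarith : 0 < σ) hσ1
  have hev : ∀ᶠ T : ℝ in Filter.atTop,
      24 * Real.log (Real.log T) ≤ Real.log T ∧ Real.exp 10 ≤ Real.log T ∧ 8000 ≤ T := by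
    have h1 : ∀ᶠ x : ℝ in Filter.atTop, 24 * Real.log x ≤ x := by
      have := Real.isLittleO_log_id_atTop.bound (show (0 : ℝ) < 1 / 24 by norm_num)
      filter_upwards [this, Filter.eventually_ge_atTop 1] with x hx hx1
      rw [Real.norm_of_nonneg (Real.log_nonneg hx1), id, Real.norm_of_nonneg (by linarith)] at hx
      linarith
    filter_upwards [Real.tendsto_log_atTop.eventually h1,
      Real.tendsto_log_atTop.eventually_ge_atTop (Real.exp 10),
      Filter.eventually_ge_atTop 8000] with T h2 h3 h4
    exact ⟨h2, h3, h4⟩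
  obtain ⟨T₁, hT₁⟩ := Filter.eventually_atTop.mp hev
  refine ⟨1 / (42 * C), max T₁ 1, by positivity, le_max_right _ _,
    fun T y k hT hTy hyT hk hkc => ?_⟩
  obtain ⟨hT1, hT2, hT3⟩ := hT₁ T ((le_max_left _ _).trans hT)
  have hT0 : 0 < T := by linarith
  have he10 : (11 : ℝ) ≤ Real.exp 10 := by linarith [Real.add_one_le_exp (10 : ℝ)]
  have hy0 : 0 < y := by linarith
  have hlogT : 0 < Real.log T := by linarith
  have hly10 : 10 ≤ Real.log y := by
    rw [Real.le_log_iff_exp_le hy0]; linarith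
  have hly2 : Real.log y ≤ 2 * Real.log (Real.log T) := by
    have := Real.log_le_log hy0 hyT
    rwa [Real.log_pow] at this
  set κ := k / 2 with hκ
  have hκ0 : 0 < κ := half_pos hk
  -- Rankin's exponent: `p ^ α ≤ e` for every prime `p ≤ y`
  set α := 1 / Real.log y with hα
  have hα0 : 0 < α := by positivity
  have hα1 : α ≤ 1 / 10 := one_div_le_one_div_of_le (by norm_num) hly10
  -- a cutoff below `T ^ (1 / 2)`, as the mean value theorem for Dirichlet polynomials requires
  set x := T ^ (1 / 3 : ℝ) with hx
  have hx0 : 0 < x := by positivity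
  have hx3 : x ^ 3 = T := by
    rw [hx, ← Real.rpow_natCast, ← Real.rpow_mul hT0.le]; norm_num
  have hx20 : 20 ≤ x := by
    refine (pow_le_pow_iff_left₀ (by norm_num) hx0.le (n := 3) (by norm_num)).mp ?_
    rw [hx3]; linarith
  have hfl : ((⌊x⌋₊ : ℕ) : ℝ) ≤ x := Nat.floor_le hx0.le
  -- the exponent is half of the saving `x ^ (-α) = exp (-(log T / (3 log y)))`; this is where the
  -- upper bound for `k` enters
  have hprod : ∏ p ∈ (Finset.Icc 1 ⌊y⌋₊).filter Nat.Prime, (1 - (p : ℝ) ^ (-(σ - α))) ^ (-κ) ≤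
      Real.exp (1 / 6 * (Real.log T / Real.log y)) := by
    have h1 : ∀ p ∈ (Finset.Icc 1 ⌊y⌋₊).filter Nat.Prime, (1 - (p : ℝ) ^ (-(σ - α))) ^ (-κ) ≤
        Real.exp (5 * κ * Real.exp 1 * (p : ℝ) ^ (-σ)) := by
      intro p hp
      obtain ⟨hpy, hp'⟩ := Finset.mem_filter.mp hp
      have hp0 : (0 : ℝ) < p := by exact_mod_cast hp'.pos
      have hpy' : (p : ℝ) ≤ y := (Nat.le_floor_iff hy0.le).mp (Finset.mem_Icc.mp hpy).2
      have h2 := natCast_rpow_neg_le (σ := σ - α) (by linarith) hp'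
      set u := (p : ℝ) ^ (-(σ - α)) with hu
      have hu0 : 0 < u := by positivity
      have h3 : u ≤ Real.exp 1 * (p : ℝ) ^ (-σ) := by
        rw [hu, show -(σ - α) = α + -σ by ring, Real.rpow_add hp0]
        gcongr
        rw [Real.rpow_def_of_pos hp0]
        refine Real.exp_le_exp.mpr ?_
        rw [hα, mul_one_div, div_le_one (by linarith)]
        exact Real.log_le_log hp0 hpy'
      have h4 := Real.one_sub_inv_le_log_of_pos (show 0 < 1 - u by linarith)
      have h5 : (1 - u)⁻¹ ≤ 1 + 5 * u := by
        rw [inv_le_iff_one_le_mul₀ (by linarith)]; nlinarith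
      rw [Real.rpow_def_of_pos (by linarith)]
      refine Real.exp_le_exp.mpr ?_
      calc Real.log (1 - u) * -κ = κ * -Real.log (1 - u) := by ring
        _ ≤ κ * (5 * (Real.exp 1 * (p : ℝ) ^ (-σ))) := by gcongr; linarith
        _ = _ := by ring
    refine (Finset.prod_le_prod (fun p hp => ?_) h1).trans ?_
    · have h2 := natCast_rpow_neg_le (σ := σ - α) (by linarith) (Finset.mem_filter.mp hp).2
      exact Real.rpow_nonneg (by linarith) _
    rw [← Real.exp_sum, ← Finset.mul_sum]
    refine Real.exp_le_exp.mpr ?_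
    have h2 := hP y (by linarith)
    have hyp : 0 < y ^ (1 - σ) := by positivity
    have hly0 : 0 < Real.log y := by linarith
    have h3 : κ ≤ 1 / (84 * C) * (Real.log T / y ^ (1 - σ)) := by
      rw [hκ, div_le_iff₀ (by norm_num)]
      refine hkc.trans (le_of_eq ?_)
      field_simp
      norm_num
    calc _ ≤ 5 * (1 / (84 * C) * (Real.log T / y ^ (1 - σ))) * 2.8 *
          (C * (y ^ (1 - σ) / Real.log y)) := by
          have := Real.exp_one_lt_d9
          gcongr
          linarith
      _ = 1 / 6 * (Real.log T / Real.log y) := by field_simp; norm_num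
  have htail : ∑' n, smoothCoeff σ κ y n - ∑ n ∈ Finset.Icc 1 ⌊x⌋₊, smoothCoeff σ κ y n ≤ 1 / 5 := by
    refine (tsum_smoothCoeff_sub_sum_le hκ0 hα0 (by linarith) hx0).trans ?_
    have e1 : x ^ (-α) = Real.exp (-(1 / 3 * (Real.log T / Real.log y))) := by
      rw [hx, ← Real.rpow_mul hT0.le, Real.rpow_def_of_pos hT0, hα]
      congr 1; ring
    have h12 : 12 ≤ Real.log T / Real.log y := by
      rw [le_div_iff₀ (by linarith)]; linarith
    calc x ^ (-α) * _ ≤ Real.exp (-(1 / 3 * (Real.log T / Real.log y))) *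
          Real.exp (1 / 6 * (Real.log T / Real.log y)) := by rw [e1]; gcongr
      _ ≤ Real.exp (-2) := by
        rw [← Real.exp_add]
        exact Real.exp_le_exp.mpr (by linarith)
      _ ≤ 1 / 5 := by
        rw [Real.exp_neg, inv_le_comm₀ (Real.exp_pos _) (by norm_num)]
        have : Real.exp 2 = Real.exp 1 * Real.exp 1 := by rw [← Real.exp_add]; norm_num
        have := Real.exp_one_gt_d9
        nlinarith
  have hmain := integral_norm_sq_tsum_mem_Icc (smoothCoeff_nonneg hκ0 σ y)
    (hasSum_smoothCoeff (by linarith : 0 < σ) κ y).summable (X := ⌊x⌋₊) hT0 (by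
      calc 20 * ((⌊x⌋₊ : ℕ) : ℝ) ^ 2 ≤ x * x ^ 2 := by gcongr
        _ = T := by rw [← hx3]; ring) htail (by
      rw [tsum_smoothCoeff_sq (by linarith) hk]
      exact Real.one_le_exp (cumulant_nonneg hσ hk))
  rw [tsum_smoothCoeff_sq (by linarith) hk] at hmain
  simp_rw [hκ, norm_tsum_smoothCoeff_sq (by linarith : 0 < σ) hk] at hmain
  exact hmain

end

noncomputable section

/-! ### Nondegenerate maxima depending on parameters -/

/-- A critical point of a convex function on an interval is a minimum. -/
lemma le_of_second_deriv_nonneg {h h' h'' : ℝ → ℝ} {a b c w : ℝ}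
    (h1 : ∀ x ∈ Set.Icc a b, HasDerivAt h (h' x) x)
    (h2 : ∀ x ∈ Set.Icc a b, HasDerivAt h' (h'' x) x)
    (h3 : ∀ x ∈ Set.Icc a b, 0 ≤ h'' x) (hc : c ∈ Set.Icc a b) (hc0 : h' c = 0)
    (hw : w ∈ Set.Icc a b) : h c ≤ h w := by
  have hmono : MonotoneOn h' (Set.Icc a b) :=
    monotoneOn_of_hasDerivWithinAt_nonneg (convex_Icc a b)
      (fun x hx => (h2 x hx).continuousAt.continuousWithinAt)
      (fun x hx => (h2 x (interior_subset hx)).hasDerivWithinAt)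
      (fun x hx => h3 x (interior_subset hx))
  rcases le_total c w with hcw | hwc
  · have hsub : Set.Icc c w ⊆ Set.Icc a b := Set.Icc_subset_Icc hc.1 hw.2
    have : MonotoneOn h (Set.Icc c w) :=
      monotoneOn_of_hasDerivWithinAt_nonneg (convex_Icc c w)
        (fun x hx => (h1 x (hsub hx)).continuousAt.continuousWithinAt)
        (fun x hx => (h1 x (hsub (interior_subset hx))).hasDerivWithinAt)
        (fun x hx => by
          have hx' := interior_subset hx
          rw [← hc0]; exact hmono hc (hsub hx') hx'.1)
    exact this ⟨le_rfl, hcw⟩ ⟨hcw, le_rfl⟩ hcw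
  · have hsub : Set.Icc w c ⊆ Set.Icc a b := Set.Icc_subset_Icc hw.1 hc.2
    have : AntitoneOn h (Set.Icc w c) :=
      antitoneOn_of_hasDerivWithinAt_nonpos (convex_Icc w c)
        (fun x hx => (h1 x (hsub hx)).continuousAt.continuousWithinAt)
        (fun x hx => (h1 x (hsub (interior_subset hx))).hasDerivWithinAt)
        (fun x hx => by
          have hx' := interior_subset hx
          rw [← hc0]; exact hmono (hsub hx') hc hx'.2)
    exact this ⟨le_rfl, hwc⟩ ⟨hwc, le_rfl⟩ hwc

open scoped ContDiff Topology in
/-- A nondegenerate maximum of an analytic function in one variable persists, as an analytic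
function of parameters. -/
lemma exists_analyticAt_argmax {E : Type*} [NormedAddCommGroup E] [NormedSpace ℝ E]
    [CompleteSpace E] {S : E × ℝ → ℝ} {w₀ : ℝ} (hS : AnalyticAt ℝ S (0, w₀))
    {s' : ℝ → ℝ} {s'' : ℝ} (h1 : ∀ w, HasDerivAt (fun w => S (0, w)) (s' w) w)
    (h2 : HasDerivAt s' s'' w₀) (h0 : s' w₀ = 0) (hs : s'' < 0) :
    ∃ (W : E → ℝ) (B η : ℝ), AnalyticAt ℝ W 0 ∧ W 0 = w₀ ∧ 0 < B ∧ 0 < η ∧ η ≤ 1 ∧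
      ∀ᶠ v in 𝓝 (0 : E), |W v - w₀| ≤ η / 2 ∧ ∀ w, |w - w₀| ≤ η →
        S (v, W v) - B * (w - W v) ^ 2 ≤ S (v, w) ∧ S (v, w) ≤ S (v, W v) := by
  have hSc : ContDiffAt ℝ ω S (0, w₀) := hS.contDiffAt
  set f : E × ℝ → ℝ := fun u => fderiv ℝ S u (0, 1) with hf
  have hfa : AnalyticAt ℝ f (0, w₀) := by
    have := hS.fderiv
    exact (ContinuousLinearMap.apply ℝ ℝ ((0, 1) : E × ℝ)).analyticAt _ |>.comp this
  have hfc : ContDiffAt ℝ ω f (0, w₀) := hfa.contDiffAt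
  set f2 : E × ℝ → ℝ := fun u => fderiv ℝ f u (0, 1) with hf2
  have hf2a : AnalyticAt ℝ f2 (0, w₀) := by
    have := hfa.fderiv
    exact (ContinuousLinearMap.apply ℝ ℝ ((0, 1) : E × ℝ)).analyticAt _ |>.comp this
  have hline {g : E × ℝ → ℝ} {v : E} {w : ℝ} (hg : DifferentiableAt ℝ g (v, w)) :
      HasDerivAt (fun w => g (v, w)) (fderiv ℝ g (v, w) (0, 1)) w :=
    hg.hasFDerivAt.comp_hasDerivAt w ((hasDerivAt_const w v).prodMk (hasDerivAt_id w))
  have hdS : ∀ᶠ u in 𝓝 ((0 : E), w₀), DifferentiableAt ℝ S u :=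
    hS.eventually_analyticAt.mono fun u hu => hu.differentiableAt
  have hdf : ∀ᶠ u in 𝓝 ((0 : E), w₀), DifferentiableAt ℝ f u :=
    hfa.eventually_analyticAt.mono fun u hu => hu.differentiableAt
  have hf0 : ∀ᶠ w in 𝓝 w₀, f (0, w) = s' w := by
    have hc : ContinuousAt (fun w : ℝ => ((0 : E), w)) w₀ := by fun_prop
    filter_upwards [hc.eventually hdS] with w hw
    exact (hline hw).unique (h1 w)
  have hf2v : f2 (0, w₀) = s'' :=
    (hline hfa.differentiableAt).unique (h2.congr_of_eventuallyEq hf0)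
  -- the maximiser `W v` is the solution of `∂S/∂w = 0` given by the implicit function theorem
  have hinv : (fderiv ℝ f (0, w₀) ∘L .inr ℝ E ℝ).IsInvertible := by
    refine ⟨ContinuousLinearEquiv.unitsEquivAut ℝ (Units.mk0 s'' hs.ne), ?_⟩
    ext
    simp only [ContinuousLinearMap.comp_apply, ContinuousLinearMap.inr_apply]
    change (1 : ℝ) * s'' = f2 (0, w₀)
    rw [hf2v, one_mul]
  have hω : (ω : WithTop ℕ∞) ≠ 0 := by simp
  set W := hfc.implicitFunction hω hinv with hW
  have hW0 : W 0 = w₀ := hfc.implicitFunction_apply_self hω hinv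
  have hWc : ContDiffAt ℝ ω W 0 := hfc.contDiffAt_implicitFunction hω hinv
  have hWe : ∀ᶠ v in 𝓝 (0 : E), f (v, W v) = f (0, w₀) :=
    hfc.eventually_apply_implicitFunction hω hinv
  have hfz : f (0, w₀) = 0 := by rw [hf0.self_of_nhds, h0]
  -- `B` exceeds the absolute value of the second derivative on a neighbourhood
  set B := 1 - s'' with hB
  have hB0 : 0 < B := by linarith
  have hf2n : ∀ᶠ u in 𝓝 ((0 : E), w₀), f2 u ∈ Set.Ioo (s'' - 1) 0 :=
    hf2a.continuousAt.eventually (by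
      rw [hf2v]; exact Ioo_mem_nhds (by linarith) hs)
  obtain ⟨r, hr, hball⟩ := Metric.eventually_nhds_iff_ball.mp (hdS.and (hdf.and hf2n))
  set η := min (r / 2) 1 with hη
  have hη0 : 0 < η := lt_min (by linarith) one_pos
  have hηr : η < r := (min_le_left _ _).trans_lt (by linarith)
  refine ⟨W, B, η, hWc.analyticAt, hW0, hB0, hη0, min_le_right _ _, ?_⟩
  have hWη : ∀ᶠ v in 𝓝 (0 : E), |W v - w₀| ≤ η / 2 := by
    have h3 : Filter.Tendsto W (𝓝 0) (𝓝 w₀) := by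
      have := hWc.continuousAt.tendsto
      rwa [hW0] at this
    filter_upwards [h3.eventually (Metric.ball_mem_nhds w₀ (half_pos hη0))] with v hv
    rw [Real.dist_eq] at hv
    exact hv.le
  filter_upwards [hWη, hWe, Metric.ball_mem_nhds (0 : E) hr] with v hv1 hv2 hv3
  refine ⟨hv1, fun w hw => ?_⟩
  have hmem (x : ℝ) (hx : x ∈ Set.Icc (w₀ - η) (w₀ + η)) : (v, x) ∈ Metric.ball ((0 : E), w₀) r := by
    rw [← ball_prod_same]
    refine ⟨hv3, ?_⟩
    rw [Metric.mem_ball, Real.dist_eq, abs_lt]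
    constructor <;> linarith [hx.1, hx.2]
  have hwI : w ∈ Set.Icc (w₀ - η) (w₀ + η) := by
    rw [abs_le] at hw; constructor <;> linarith
  have hWI : W v ∈ Set.Icc (w₀ - η) (w₀ + η) := by
    rw [abs_le] at hv1; constructor <;> linarith
  -- both inequalities hold since the functions minimised are convex and critical at `W v`
  constructor
  · have := le_of_second_deriv_nonneg (h := fun x => S (v, x) + B * (x - W v) ^ 2)
      (h' := fun x => f (v, x) + B * (2 * (x - W v))) (h'' := fun x => f2 (v, x) + B * 2)
      (fun x hx => by
        refine (hline (hball _ (hmem x hx)).1).add ((((hasDerivAt_id x).sub_const (W v)).pow 2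
          |>.const_mul B).congr_deriv ?_)
        simp)
      (fun x hx => by
        refine (hline (hball _ (hmem x hx)).2.1).add ((((hasDerivAt_id x).sub_const (W v)).const_mul 2
          |>.const_mul B).congr_deriv ?_)
        ring)
      (fun x hx => by
        have := (hball _ (hmem x hx)).2.2.1
        simp only [hB]; linarith) hWI (by rw [hv2, hfz]; ring) hwI
    simp only [sub_self] at this
    linarith
  · have := le_of_second_deriv_nonneg (h := fun x => -S (v, x))
      (h' := fun x => -f (v, x)) (h'' := fun x => -f2 (v, x))
      (fun x hx => (hline (hball _ (hmem x hx)).1).neg)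
      (fun x hx => (hline (hball _ (hmem x hx)).2.1).neg)
      (fun x hx => by
        have := (hball _ (hmem x hx)).2.2.2
        linarith) hWI (by rw [hv2, hfz]; ring) hwI
    simpa using this

/-! ### The diagonal of a power series in two variables -/

/-- Values of a form of degree `n` in two variables along the line `(1, l)` are polynomial. -/
lemma exists_polynomial_eval_eq {n : ℕ} (p : (ℝ × ℝ) [×n]→L[ℝ] ℝ) :
    ∃ Q : Polynomial ℝ, Q.natDegree ≤ n ∧ ∀ l, Q.eval l = p fun _ => (1, l) := by
  refine ⟨∑ s : Finset (Fin n), Polynomial.C (p (s.piecewise (fun _ => (1, 0)) fun _ => (0, 1))) *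
    Polynomial.X ^ (sᶜ).card, ?_, fun l => ?_⟩
  · refine Polynomial.natDegree_sum_le_of_forall_le _ _ fun s _ => ?_
    refine (Polynomial.natDegree_C_mul_X_pow_le _ _).trans ?_
    simpa using Finset.card_le_univ sᶜ
  · rw [Polynomial.eval_finsetSum]
    have e : (fun _ : Fin n => ((1, l) : ℝ × ℝ)) = (fun _ => ((1, 0) : ℝ × ℝ)) +
        fun _ => ((0, l) : ℝ × ℝ) := by ext <;> simp
    rw [e]
    have h := p.toMultilinearMap.map_add_univ (fun _ => ((1, 0) : ℝ × ℝ)) fun _ => ((0, l) : ℝ × ℝ)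
    refine Eq.trans ?_ h.symm
    refine Finset.sum_congr rfl fun s _ => ?_
    rw [Polynomial.eval_mul, Polynomial.eval_C, Polynomial.eval_pow, Polynomial.eval_X]
    have h2 := p.toMultilinearMap.map_piecewise_smul (fun _ => l)
      (s.piecewise (fun _ => ((1, 0) : ℝ × ℝ)) fun _ => ((0, 1) : ℝ × ℝ)) sᶜ
    rw [Finset.prod_const, smul_eq_mul, mul_comm] at h2
    refine Eq.trans h2.symm ?_
    congr 1
    ext i
    · by_cases hi : i ∈ s <;> simp [Finset.piecewise, hi]
    · by_cases hi : i ∈ s <;> simp [Finset.piecewise, hi]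

open scoped Topology in
/-- Analytic functions that agree to order `M` at the origin have the same Taylor coefficients up
to degree `M`. -/
lemma hasFPowerSeriesAt_apply_eq_of_isBigO {E : Type*} [NormedAddCommGroup E] [NormedSpace ℝ E]
    {f g : E → ℝ} {p q : FormalMultilinearSeries ℝ E ℝ} (hf : HasFPowerSeriesAt f p 0)
    (hg : HasFPowerSeriesAt g q 0) {M : ℕ}
    (h : (fun v => f v - g v) =O[𝓝 0] fun v => ‖v‖ ^ (M + 1)) {n : ℕ} (hn : n ≤ M) (v : E) :
    p n (fun _ => v) = q n fun _ => v := by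
  have hd := hf.sub hg
  set d := p - q with hdd
  suffices H : ∀ n ≤ M, ∀ v, d n (fun _ => v) = 0 by
    have := H n hn v
    rw [hdd] at this
    exact sub_eq_zero.mp this
  intro n
  induction n using Nat.strong_induction_on with
  | _ n ih =>
    intro hn
    refine Asymptotics.IsBigO.continuousMultilinearMap_apply_eq_zero ?_
    have h1 := hd.isBigO_sub_partialSum_pow (n + 1)
    simp only [zero_add] at h1
    have h2 : (fun v : E => ‖v‖ ^ (M + 1)) =O[𝓝 0] fun v => ‖v‖ ^ (n + 1) := by
      refine Asymptotics.IsBigO.of_bound 1 ?_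
      filter_upwards [Metric.ball_mem_nhds (0 : E) one_pos] with v hv
      rw [mem_ball_zero_iff] at hv
      rw [one_mul, norm_pow, norm_pow, norm_norm]
      exact pow_le_pow_of_le_one (norm_nonneg v) hv.le (by omega)
    have h3 := (h.trans h2).sub h1
    refine h3.congr_left fun v => ?_
    rw [FormalMultilinearSeries.partialSum, Finset.sum_range_succ,
      Finset.sum_eq_zero fun k hk => ih k (Finset.mem_range.mp hk)
        (by have := Finset.mem_range.mp hk; omega) v]
    simp

end

noncomputable section

/-! ### The Legendre transform of the cumulant generating function -/

/-- The factor `U` for which `1 / log x = z U`, where `log x = ((1 + q) / (1 - σ) + w z) / z`. -/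
def legendreScale (σ : ℝ) (u : (ℝ × ℝ) × ℝ) : ℝ := ((1 + u.1.2) / (1 - σ) + u.2 * u.1.1)⁻¹

/-- The function maximised over `w` to find the optimal moment. At `u = ((z, q), w)` with
`z = 1 / log τ` and `q = log log τ / log τ` it is `k τ` minus the cumulant generating function at
`k = (τ log τ) ^ (σ / (1 - σ)) e ^ (σ w)`, truncated at order `M` and normalised. -/
def legendreFun (σ : ℝ) (M : ℕ) (u : (ℝ × ℝ) × ℝ) : ℝ :=
  Real.exp (σ * u.2) - Real.exp u.2 * legendreScale σ u *
    ∑ n ∈ Finset.range (M + 1), besselMoment σ n * (u.1.1 * legendreScale σ u) ^ n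

/-- The maximiser of `legendreFun` at `(z, q) = (0, 0)`. -/
def legendreCenter (σ : ℝ) : ℝ := Real.log (σ / ((1 - σ) * besselMoment σ 0)) / (1 - σ)

lemma legendreScale_zero {σ : ℝ} (w : ℝ) : legendreScale σ (0, w) = 1 - σ := by
  simp [legendreScale]

lemma legendreFun_zero {σ : ℝ} (M : ℕ) (w : ℝ) : legendreFun σ M (0, w) =
    Real.exp (σ * w) - Real.exp w * ((1 - σ) * besselMoment σ 0) := by
  rw [legendreFun, legendreScale_zero, Finset.sum_range_succ']
  simp [mul_assoc]

lemma analyticAt_coord (u : (ℝ × ℝ) × ℝ) : AnalyticAt ℝ (fun u : (ℝ × ℝ) × ℝ => u.1.1) u ∧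
    AnalyticAt ℝ (fun u : (ℝ × ℝ) × ℝ => u.1.2) u ∧ AnalyticAt ℝ (fun u : (ℝ × ℝ) × ℝ => u.2) u :=
  ⟨analyticAt_fst.fun_comp (g := Prod.fst) analyticAt_fst,
    analyticAt_snd.fun_comp (g := Prod.snd) analyticAt_fst, analyticAt_snd⟩

lemma analyticAt_legendreScale {σ : ℝ} (hσ1 : σ < 1) (w : ℝ) :
    AnalyticAt ℝ (legendreScale σ) (0, w) := by
  refine AnalyticAt.inv (f := fun u : (ℝ × ℝ) × ℝ => (1 + u.1.2) / (1 - σ) + u.2 * u.1.1) ?_ ?_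
  · obtain ⟨h1, h2, h3⟩ := analyticAt_coord (0, w)
    have : 1 - σ ≠ 0 := by linarith
    fun_prop (disch := assumption)
  · have : 1 - σ ≠ 0 := by linarith
    simp [this]

lemma analyticAt_legendreFun {σ : ℝ} (hσ1 : σ < 1) (M : ℕ) (w : ℝ) :
    AnalyticAt ℝ (legendreFun σ M) (0, w) := by
  have h := analyticAt_legendreScale hσ1 w
  obtain ⟨h1, h2, h3⟩ := analyticAt_coord (0, w)
  unfold legendreFun
  fun_prop

lemma legendreCenter_spec {σ : ℝ} (hσ : 1 / 2 < σ) (hσ1 : σ < 1) :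
    Real.exp (legendreCenter σ) * ((1 - σ) * besselMoment σ 0) =
      σ * Real.exp (σ * legendreCenter σ) := by
  have hD := besselMoment_zero_pos hσ hσ1
  have h1 : 0 < 1 - σ := by linarith
  have h2 : Real.exp ((1 - σ) * legendreCenter σ) = σ / ((1 - σ) * besselMoment σ 0) := by
    rw [legendreCenter, mul_div_cancel₀ _ h1.ne', Real.exp_log (by positivity)]
  have h3 : Real.exp (legendreCenter σ) =
      Real.exp ((1 - σ) * legendreCenter σ) * Real.exp (σ * legendreCenter σ) := by
    rw [← Real.exp_add]; congr 1; ring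
  rw [h3, h2]
  field_simp

lemma legendreFun_center {σ : ℝ} (hσ : 1 / 2 < σ) (hσ1 : σ < 1) (M : ℕ) :
    legendreFun σ M (0, legendreCenter σ) = leadingConst σ := by
  have hD := besselMoment_zero_pos hσ hσ1
  have h1 : 0 < 1 - σ := by linarith
  have hσ0 : 0 < σ := by linarith
  rw [legendreFun_zero, legendreCenter_spec hσ hσ1, leadingConst,
    besselConst_eq_mul_besselMoment hσ]
  set D := besselMoment σ 0 with hDd
  have hexp : Real.exp (σ * legendreCenter σ) = (σ / ((1 - σ) * D)) ^ (σ / (1 - σ)) := by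
    rw [Real.rpow_def_of_pos (by positivity), legendreCenter]
    congr 1; ring
  have e1 : (1 - σ : ℝ) = ((1 - σ) ^ (1 - σ)) ^ (1 / (1 - σ)) := by
    rw [← Real.rpow_mul h1.le, mul_one_div_cancel h1.ne', Real.rpow_one]
  have e2 : (σ / ((1 - σ) * D)) ^ (σ / (1 - σ)) = ((σ / ((1 - σ) * D)) ^ σ) ^ (1 / (1 - σ)) := by
    rw [← Real.rpow_mul (by positivity)]; congr 1; ring
  have e3 : Real.exp (σ * legendreCenter σ) - σ * Real.exp (σ * legendreCenter σ) =
      (σ / ((1 - σ) * D)) ^ (σ / (1 - σ)) * (1 - σ) := by rw [hexp]; ring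
  rw [e3, e2]
  conv_lhs => arg 2; rw [e1]
  rw [← Real.mul_rpow (by positivity) (by positivity)]
  congr 1
  rw [Real.div_rpow hσ0.le (by positivity), Real.mul_rpow h1.le hD.le, Real.mul_rpow hσ0.le hD.le,
    show 2 * σ = σ + σ by ring, Real.rpow_add hσ0, show σ + σ - 1 = σ - (1 - σ) by ring,
    Real.rpow_sub h1 σ (1 - σ)]
  have p1 : 0 < (1 - σ) ^ σ := by positivity
  have p2 : 0 < (1 - σ) ^ (1 - σ) := by positivity
  have p3 : 0 < σ ^ σ := by positivity
  have p4 : 0 < D ^ σ := by positivity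
  generalize (1 - σ) ^ σ = a at *
  generalize (1 - σ) ^ (1 - σ) = b at *
  generalize σ ^ σ = c at *
  generalize D ^ σ = d at *
  field_simp

open scoped Topology in
lemma exists_legendreFun_argmax {σ : ℝ} (hσ : 1 / 2 < σ) (hσ1 : σ < 1) (M : ℕ) :
    ∃ (W : ℝ × ℝ → ℝ) (B η : ℝ), AnalyticAt ℝ W 0 ∧ W 0 = legendreCenter σ ∧ 0 < B ∧ 0 < η ∧
      η ≤ 1 ∧ ∀ᶠ v in 𝓝 (0 : ℝ × ℝ), |W v - legendreCenter σ| ≤ η / 2 ∧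
        ∀ w, |w - legendreCenter σ| ≤ η →
          legendreFun σ M (v, W v) - B * (w - W v) ^ 2 ≤ legendreFun σ M (v, w) ∧
          legendreFun σ M (v, w) ≤ legendreFun σ M (v, W v) := by
  have hspec := legendreCenter_spec hσ hσ1
  refine exists_analyticAt_argmax (analyticAt_legendreFun hσ1 M _)
    (s' := fun w => σ * Real.exp (σ * w) - Real.exp w * ((1 - σ) * besselMoment σ 0))
    (s'' := σ * (σ * Real.exp (σ * legendreCenter σ)) -
      Real.exp (legendreCenter σ) * ((1 - σ) * besselMoment σ 0)) (fun w => ?_) ?_ ?_ ?_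
  · simp_rw [legendreFun_zero]
    refine HasDerivAt.sub ?_ ((Real.hasDerivAt_exp w).mul_const _)
    exact (((hasDerivAt_id w).const_mul σ).exp).congr_deriv (by simp; ring)
  · refine HasDerivAt.sub (HasDerivAt.const_mul σ ?_) ((Real.hasDerivAt_exp _).mul_const _)
    exact (((hasDerivAt_id _).const_mul σ).exp).congr_deriv (by simp; ring)
  · rw [hspec]; ring
  · rw [hspec]
    have := Real.exp_pos (σ * legendreCenter σ)
    have : 0 < σ * Real.exp (σ * legendreCenter σ) := by positivity
    nlinarith

open scoped Topology in
/-- Truncating the cumulant expansion one step later changes the maximum to a higher order only. -/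
lemma isBigO_legendreFun_argmax_sub {σ : ℝ} (hσ1 : σ < 1) {M : ℕ}
    {W W' : ℝ × ℝ → ℝ} {η η' : ℝ} (hη : 0 < η) (hη' : 0 < η')
    (hW : AnalyticAt ℝ W 0) (hW' : AnalyticAt ℝ W' 0) (hW0 : W 0 = legendreCenter σ)
    (hW'0 : W' 0 = legendreCenter σ)
    (h : ∀ᶠ v in 𝓝 (0 : ℝ × ℝ), ∀ w, |w - legendreCenter σ| ≤ η →
      legendreFun σ M (v, w) ≤ legendreFun σ M (v, W v))
    (h' : ∀ᶠ v in 𝓝 (0 : ℝ × ℝ), ∀ w, |w - legendreCenter σ| ≤ η' →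
      legendreFun σ (M + 1) (v, w) ≤ legendreFun σ (M + 1) (v, W' v)) :
    (fun v => legendreFun σ M (v, W v) - legendreFun σ (M + 1) (v, W' v)) =O[𝓝 0]
      fun v => ‖v‖ ^ (M + 1) := by
  set H : (ℝ × ℝ) × ℝ → ℝ := fun u => Real.exp u.2 * legendreScale σ u *
    (besselMoment σ (M + 1) * legendreScale σ u ^ (M + 1)) with hH
  have hdiff (u : (ℝ × ℝ) × ℝ) :
      legendreFun σ M u - legendreFun σ (M + 1) u = u.1.1 ^ (M + 1) * H u := by
    rw [legendreFun, legendreFun, Finset.sum_range_succ _ (M + 1), hH]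
    ring
  have hHa : AnalyticAt ℝ H (0, legendreCenter σ) := by
    have := analyticAt_legendreScale hσ1 (legendreCenter σ)
    obtain ⟨h1, h2, h3⟩ := analyticAt_coord (0, legendreCenter σ)
    rw [hH]; fun_prop
  set K := |H (0, legendreCenter σ)| + 1 with hK
  have hHb : ∀ᶠ u in 𝓝 ((0 : ℝ × ℝ), legendreCenter σ), |H u| ≤ K := by
    filter_upwards [hHa.continuousAt.abs.eventually (gt_mem_nhds (lt_add_one _))] with u hu
    exact le_of_lt hu
  have key {V : ℝ × ℝ → ℝ} (hV : AnalyticAt ℝ V 0) (hV0 : V 0 = legendreCenter σ) {θ : ℝ}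
      (hθ : 0 < θ) : ∀ᶠ v in 𝓝 (0 : ℝ × ℝ), |V v - legendreCenter σ| ≤ θ ∧
        |legendreFun σ M (v, V v) - legendreFun σ (M + 1) (v, V v)| ≤ K * ‖v‖ ^ (M + 1) := by
    have hc : Filter.Tendsto V (𝓝 0) (𝓝 (legendreCenter σ)) := by
      have := hV.continuousAt.tendsto; rwa [hV0] at this
    have hc2 : Filter.Tendsto (fun v => (v, V v)) (𝓝 0) (𝓝 ((0 : ℝ × ℝ), legendreCenter σ)) :=
      Filter.tendsto_id.prodMk_nhds hc
    filter_upwards [hc.eventually (Metric.ball_mem_nhds _ hθ), hc2.eventually hHb] with v h1 h2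
    rw [Real.dist_eq] at h1
    refine ⟨h1.le, ?_⟩
    rw [hdiff, abs_mul, abs_pow, mul_comm]
    gcongr
    exact norm_fst_le v
  refine Asymptotics.IsBigO.of_bound K ?_
  filter_upwards [h, h', key hW hW0 hη', key hW' hW'0 hη] with v h1 h2 ⟨h3, h4⟩ ⟨h5, h6⟩
  -- compare each maximum with the value of the same function at the other maximiser
  have h7 := h1 _ h5
  have h8 := h2 _ h3
  rw [norm_pow, norm_norm, Real.norm_eq_abs]
  rw [abs_le] at h4 h6 ⊢
  constructor <;> linarith

open scoped Topology in
/-- The expansion of the maximum of `legendreFun` along `(z, q) = (z, z l)`, with coefficients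
polynomial in `l` and independent of the order of truncation. -/
theorem exists_polynomials_legendreFun {σ : ℝ} (hσ : 1 / 2 < σ) (hσ1 : σ < 1) :
    ∃ 𝔞 : ℕ → Polynomial ℝ, (∀ n, (𝔞 n).natDegree ≤ n) ∧
      𝔞 0 = Polynomial.C (leadingConst σ) ∧
      ∀ N M : ℕ, N ≤ M → ∃ (W : ℝ × ℝ → ℝ) (B η C : ℝ), 0 < B ∧ 0 < η ∧ η ≤ 1 ∧ 0 < C ∧
        ∀ᶠ v in 𝓝 (0 : ℝ × ℝ), |W v - legendreCenter σ| ≤ η / 2 ∧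
          leadingConst σ - 1 ≤ legendreFun σ M (v, W v) ∧
          (∀ w, |w - legendreCenter σ| ≤ η →
            legendreFun σ M (v, W v) - B * (w - W v) ^ 2 ≤ legendreFun σ M (v, w)) ∧
          ∀ z l : ℝ, v = (z, z * l) →
            |legendreFun σ M (v, W v) - ∑ n ∈ Finset.range (N + 1), (𝔞 n).eval l * z ^ n| ≤
              C * ‖v‖ ^ (N + 1) := by
  choose W B η hWa hW0 hB hη hη1 hWe using exists_legendreFun_argmax hσ hσ1
  have hS (M : ℕ) : AnalyticAt ℝ (fun v => legendreFun σ M (v, W M v)) 0 := by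
    have h1 : AnalyticAt ℝ (fun v : ℝ × ℝ => (v, W M v)) 0 := analyticAt_id.prod (hWa M)
    refine AnalyticAt.fun_comp (g := legendreFun σ M) ?_ h1
    rw [hW0]
    exact analyticAt_legendreFun hσ1 M _
  have hS0 (M : ℕ) : legendreFun σ M (0, W M 0) = leadingConst σ := by
    rw [hW0, legendreFun_center hσ hσ1]
  choose p hp using id hS
  have hstep (M n : ℕ) (hn : n ≤ M) (v : ℝ × ℝ) :
      p M n (fun _ => v) = p (M + 1) n fun _ => v :=
    hasFPowerSeriesAt_apply_eq_of_isBigO (hp M) (hp (M + 1))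
      (isBigO_legendreFun_argmax_sub hσ1 (hη M) (hη (M + 1)) (hWa M) (hWa (M + 1)) (hW0 M)
        (hW0 (M + 1)) ((hWe M).mono fun v hv w hw => (hv.2 w hw).2)
        ((hWe (M + 1)).mono fun v hv w hw => (hv.2 w hw).2)) hn v
  -- the Taylor coefficients of degree `n` are the same for all truncation orders `M ≥ n`
  have hconst (M n : ℕ) (hn : n ≤ M) (v : ℝ × ℝ) :
      p M n (fun _ => v) = p n n fun _ => v := by
    induction M, hn using Nat.le_induction with
    | base => rfl
    | succ M hM ih => rw [← hstep M n hM, ih]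
  choose 𝔞 h𝔞d h𝔞 using fun n => exists_polynomial_eval_eq (p n n)
  refine ⟨𝔞, h𝔞d, ?_, fun N M hNM => ?_⟩
  · rw [Polynomial.eq_C_of_natDegree_le_zero (h𝔞d 0)]
    congr 1
    rw [Polynomial.coeff_zero_eq_eval_zero, h𝔞, (hp 0).coeff_zero, hS0]
  obtain ⟨C, hC, hCb⟩ := ((hp M).isBigO_sub_partialSum_pow (N + 1)).exists_pos
  refine ⟨W M, B M, η M, C, hB M, hη M, hη1 M, hC, ?_⟩
  have hlow := (hS M).continuousAt.eventually
    (lt_mem_nhds (show leadingConst σ - 1 < legendreFun σ M (0, W M 0) by rw [hS0]; linarith))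
  filter_upwards [hWe M, hCb.bound, hlow] with v hv1 hv2 hv3
  refine ⟨hv1.1, hv3.le, fun w hw => (hv1.2 w hw).1, fun z l hzl => ?_⟩
  rw [zero_add, norm_pow, norm_norm, Real.norm_eq_abs] at hv2
  refine le_trans (le_of_eq ?_) hv2
  congr 2
  rw [FormalMultilinearSeries.partialSum]
  refine Finset.sum_congr rfl fun n hn => ?_
  rw [hconst M n (by have := Finset.mem_range.mp hn; omega), h𝔞, hzl]
  have e : (fun _ : Fin n => ((z, z * l) : ℝ × ℝ)) = fun _ => z • ((1, l) : ℝ × ℝ) := by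
    ext <;> simp
  rw [e]
  have := (p n n).toMultilinearMap.map_smul_univ (fun _ => z) fun _ => ((1, l) : ℝ × ℝ)
  rw [Finset.prod_const, Finset.card_univ, Fintype.card_fin, smul_eq_mul, mul_comm] at this
  exact this.symm

end

noncomputable section

/-! ### Exponential moments and the distribution function -/

lemma volume_real_eq_integral_indicator {X : ℝ → ℝ} (hX : Continuous X) (a b τ : ℝ) :
    volume.real {t | t ∈ Set.Icc a b ∧ τ < X t} =
      ∫ t in Set.Icc a b, {t | τ < X t}.indicator 1 t := by
  have hm : MeasurableSet {t | τ < X t} := measurableSet_lt measurable_const hX.measurable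
  rw [integral_indicator_one hm, measureReal_restrict_apply hm]
  congr 1
  ext t
  exact and_comm

lemma volume_real_le_exp_mul_integral {X : ℝ → ℝ} (hX : Continuous X) {a b : ℝ} (hab : a ≤ b)
    {k : ℝ} (hk : 0 ≤ k) (τ : ℝ) :
    volume.real {t | t ∈ Set.Icc a b ∧ τ < X t} ≤
      Real.exp (-(k * τ)) * ∫ t in a..b, Real.exp (k * X t) := by
  rw [volume_real_eq_integral_indicator hX, intervalIntegral.integral_of_le hab,
    ← integral_Icc_eq_integral_Ioc, ← integral_const_mul]
  have hm : MeasurableSet {t | τ < X t} := measurableSet_lt measurable_const hX.measurable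
  refine integral_mono_ae ?_ ?_ (Filter.Eventually.of_forall fun t => ?_)
  · exact (integrable_const (1 : ℝ)).indicator hm
  · exact Continuous.integrableOn_Icc (by fun_prop)
  · simp only [Set.indicator_apply, Set.mem_ofPred_eq, Pi.one_apply]
    rw [← Real.exp_add]
    split_ifs with h
    · refine Real.one_le_exp ?_
      nlinarith
    · positivity

/-- Tilting: the moment of order `k` is carried by the values of `X` between `q` and `s`, up to
what the moments of neighbouring orders control. -/
lemma integral_exp_le_tilt {X : ℝ → ℝ} (hX : Continuous X) {a b : ℝ} (hab : a ≤ b)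
    {k k₁ k₂ : ℝ} (hk : 0 ≤ k) (hk₁ : k₁ ≤ k) (hk₂ : k ≤ k₂) (q s : ℝ) :
    ∫ t in a..b, Real.exp (k * X t) ≤
      Real.exp (-((k₂ - k) * s)) * (∫ t in a..b, Real.exp (k₂ * X t)) +
      Real.exp ((k - k₁) * q) * (∫ t in a..b, Real.exp (k₁ * X t)) +
      Real.exp (k * s) * volume.real {t | t ∈ Set.Icc a b ∧ q < X t} := by
  have hm : MeasurableSet {t | q < X t} := measurableSet_lt measurable_const hX.measurable
  rw [volume_real_eq_integral_indicator hX, intervalIntegral.integral_of_le hab,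
    intervalIntegral.integral_of_le hab, intervalIntegral.integral_of_le hab,
    ← integral_Icc_eq_integral_Ioc, ← integral_Icc_eq_integral_Ioc, ← integral_Icc_eq_integral_Ioc,
    ← integral_const_mul, ← integral_const_mul, ← integral_const_mul]
  have hi (c l : ℝ) : IntegrableOn (fun t => c * Real.exp (l * X t)) (Set.Icc a b) :=
    Continuous.integrableOn_Icc (by fun_prop)
  have hj : IntegrableOn (fun t => Real.exp (k * s) * {t | q < X t}.indicator (1 : ℝ → ℝ) t)
      (Set.Icc a b) := ((integrable_const (1 : ℝ)).indicator hm).const_mul _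
  have hij : IntegrableOn (fun t => Real.exp (-((k₂ - k) * s)) * Real.exp (k₂ * X t) +
      Real.exp ((k - k₁) * q) * Real.exp (k₁ * X t)) (Set.Icc a b) := (hi _ _).add (hi _ _)
  rw [← integral_add (hi _ _) (hi _ _), ← integral_add hij hj]
  refine integral_mono_ae (Continuous.integrableOn_Icc (by fun_prop)) (hij.add hj) (Filter.Eventually.of_forall fun t => ?_)
  simp only [Set.indicator_apply, Set.mem_ofPred_eq, Pi.one_apply]
  rw [← Real.exp_add, ← Real.exp_add]
  have p1 := Real.exp_pos (-((k₂ - k) * s) + k₂ * X t)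
  have p2 := Real.exp_pos ((k - k₁) * q + k₁ * X t)
  have p3 := Real.exp_pos (k * s)
  split_ifs with h
  · rcases le_total s (X t) with h1 | h1
    · have : Real.exp (k * X t) ≤ Real.exp (-((k₂ - k) * s) + k₂ * X t) :=
        Real.exp_le_exp.mpr (by nlinarith)
      linarith
    · have : Real.exp (k * X t) ≤ Real.exp (k * s) := Real.exp_le_exp.mpr (by nlinarith)
      linarith
  · have : Real.exp (k * X t) ≤ Real.exp ((k - k₁) * q + k₁ * X t) :=
      Real.exp_le_exp.mpr (by nlinarith)
    linarith

/-! ### Elementary properties of the short Euler product -/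

lemma one_sub_cpow_ne_zero {σ : ℝ} (hσ : 0 < σ) {p : ℕ} (hp : p.Prime) (t : ℝ) :
    1 - (p : ℂ) ^ (-((σ : ℂ) + (t : ℂ) * Complex.I)) ≠ 0 := by
  intro h
  have h1 : ‖(p : ℂ) ^ (-((σ : ℂ) + (t : ℂ) * Complex.I))‖ = (p : ℝ) ^ (-σ) := by
    rw [Complex.norm_natCast_cpow_of_pos hp.pos]; simp
  rw [← sub_eq_zero.mp h, norm_one] at h1
  exact (natCast_rpow_neg_lt_one hσ hp).ne h1.symm

lemma continuous_zetaShort {σ : ℝ} (hσ : 0 < σ) (y : ℝ) :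
    Continuous fun t : ℝ => zetaShort ((σ : ℂ) + (t : ℂ) * Complex.I) y := by
  refine continuous_finsetProd _ fun p hp => ?_
  have hp' := (Finset.mem_filter.mp hp).2
  refine Continuous.inv₀ (continuous_const.sub ?_) fun t => one_sub_cpow_ne_zero hσ hp' t
  exact Continuous.const_cpow (by fun_prop) (Or.inl (by exact_mod_cast hp'.ne_zero))

/-- The trivial lower bound for the short Euler product. -/
lemma exp_neg_sum_le_norm_zetaShort {σ : ℝ} (hσ : 0 < σ) (y t : ℝ) :
    Real.exp (-∑ p ∈ (Finset.Icc 1 ⌊y⌋₊).filter Nat.Prime, (p : ℝ) ^ (-σ)) ≤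
      ‖zetaShort ((σ : ℂ) + (t : ℂ) * Complex.I) y‖ := by
  rw [← Finset.sum_neg_distrib, Real.exp_sum, zetaShort, norm_prod]
  refine Finset.prod_le_prod (fun p _ => (Real.exp_pos _).le) fun p hp => ?_
  have hp' := (Finset.mem_filter.mp hp).2
  have h1 : ‖(p : ℂ) ^ (-((σ : ℂ) + (t : ℂ) * Complex.I))‖ = (p : ℝ) ^ (-σ) := by
    rw [Complex.norm_natCast_cpow_of_pos hp'.pos]; simp
  have h2 := norm_sub_le 1 ((p : ℂ) ^ (-((σ : ℂ) + (t : ℂ) * Complex.I)))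
  rw [h1, norm_one] at h2
  rw [norm_inv, Real.exp_neg]
  refine inv_anti₀ (norm_pos_iff.mpr (one_sub_cpow_ne_zero hσ hp' t)) ?_
  linarith [Real.add_one_le_exp ((p : ℝ) ^ (-σ))]

lemma norm_zetaShort_pos {σ : ℝ} (hσ : 0 < σ) (y t : ℝ) :
    0 < ‖zetaShort ((σ : ℂ) + (t : ℂ) * Complex.I) y‖ :=
  (Real.exp_pos _).trans_le (exp_neg_sum_le_norm_zetaShort hσ y t)

lemma continuous_log_norm_zetaShort {σ : ℝ} (hσ : 0 < σ) (y : ℝ) :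
    Continuous fun t : ℝ => Real.log ‖zetaShort ((σ : ℂ) + (t : ℂ) * Complex.I) y‖ :=
  (continuous_zetaShort hσ y).norm.log fun t => (norm_zetaShort_pos hσ y t).ne'

/-- The normalised moment of order `k` of `|ζ(σ + it; y)|` over `[T, 2T]`. -/
def zetaMoment (σ T y k : ℝ) : ℝ :=
  1 / T * ∫ t in T..2 * T,
    Real.exp (k * Real.log ‖zetaShort ((σ : ℂ) + (t : ℂ) * Complex.I) y‖)

lemma zetaMoment_eq {σ : ℝ} (hσ : 0 < σ) (T y k : ℝ) : zetaMoment σ T y k =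
    1 / T * ∫ t in T..2 * T, ‖zetaShort ((σ : ℂ) + (t : ℂ) * Complex.I) y‖ ^ k := by
  rw [zetaMoment]
  congr 1
  refine intervalIntegral.integral_congr fun t _ => ?_
  rw [Real.rpow_def_of_pos (norm_zetaShort_pos hσ y t), mul_comm]

lemma PhiShort_anti {σ T y τ τ' : ℝ} (hT : 0 < T) (h : τ ≤ τ') :
    PhiShort σ T τ' y ≤ PhiShort σ T τ y := by
  rw [PhiShort, PhiShort]
  refine mul_le_mul_of_nonneg_left (measureReal_mono (fun t ht => ⟨ht.1, h.trans_lt ht.2⟩) ?_)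
    (by positivity)
  exact ((measure_mono fun t ht => ht.1).trans_lt measure_Icc_lt_top).ne

lemma PhiShort_le_exp_mul_zetaMoment {σ : ℝ} (hσ : 0 < σ) {T k : ℝ} (hT : 0 < T) (hk : 0 ≤ k)
    (τ y : ℝ) : PhiShort σ T τ y ≤ Real.exp (-(k * τ)) * zetaMoment σ T y k := by
  have h := volume_real_le_exp_mul_integral (continuous_log_norm_zetaShort hσ y)
    (show T ≤ 2 * T by linarith) hk τ
  rw [PhiShort, zetaMoment, mul_left_comm]
  exact mul_le_mul_of_nonneg_left h (by positivity)

lemma zetaMoment_le_tilt {σ : ℝ} (hσ : 0 < σ) {T k k₁ k₂ : ℝ} (hT : 0 < T) (hk : 0 ≤ k)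
    (hk₁ : k₁ ≤ k) (hk₂ : k ≤ k₂) (y q s : ℝ) :
    zetaMoment σ T y k ≤ Real.exp (-((k₂ - k) * s)) * zetaMoment σ T y k₂ +
      Real.exp ((k - k₁) * q) * zetaMoment σ T y k₁ + Real.exp (k * s) * PhiShort σ T q y := by
  have h := integral_exp_le_tilt (continuous_log_norm_zetaShort hσ y)
    (show T ≤ 2 * T by linarith) hk hk₁ hk₂ q s
  have h1 := mul_le_mul_of_nonneg_left h (show 0 ≤ 1 / T by positivity)
  rw [PhiShort, zetaMoment, zetaMoment, zetaMoment]
  linarith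

lemma PhiShort_eq_one {σ T y τ : ℝ} (hT : 0 < T)
    (h : ∀ t : ℝ, τ < Real.log ‖zetaShort ((σ : ℂ) + (t : ℂ) * Complex.I) y‖) :
    PhiShort σ T τ y = 1 := by
  have e : {t : ℝ | t ∈ Set.Icc T (2 * T) ∧
      τ < Real.log ‖zetaShort ((σ : ℂ) + (t : ℂ) * Complex.I) y‖} = Set.Icc T (2 * T) := by
    ext t; exact ⟨fun ht => ht.1, fun ht => ⟨ht, h t⟩⟩
  rw [PhiShort, e, Real.volume_real_Icc_of_le (by linarith)]
  field_simp
  ring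

/-! ### The scales attached to `τ` -/

/-- The size of the primes that govern the event `log |ζ(σ + it; y)| > τ`. -/
def primeScale (σ τ : ℝ) : ℝ := (τ * Real.log τ) ^ (1 / (1 - σ))

/-- The order of magnitude of `-log Φ_T(τ; y)`. -/
def valueScale (σ τ : ℝ) : ℝ := (τ * Real.log τ ^ σ) ^ (1 / (1 - σ))

/-- The parameters `(1 / log τ, log log τ / log τ)` of `legendreFun`. -/
def legendrePoint (τ : ℝ) : ℝ × ℝ := (1 / Real.log τ, Real.log (Real.log τ) / Real.log τ)

/-- The quantity `ε₀ / c₀`. -/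
def errScale (σ : ℝ) (N : ℕ) (τ y : ℝ) : ℝ :=
  (Real.log (Real.log τ) / Real.log τ) ^ (N + 1) + (primeScale σ τ / y) ^ (σ - 1 / 2)

lemma epsZero_eq (σ : ℝ) (N : ℕ) (c₀ τ y : ℝ) : epsZero σ N c₀ τ y = c₀ * errScale σ N τ y := rfl

section scales

variable {σ τ : ℝ}

lemma valueScale_div (hσ1 : σ < 1) (hτ : 0 < τ) (hL : 0 < Real.log τ) :
    valueScale σ τ / τ = (τ * Real.log τ) ^ (σ / (1 - σ)) := by
  have h1 : 1 - σ ≠ 0 := by linarith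
  rw [valueScale, Real.mul_rpow hτ.le (by positivity), Real.mul_rpow hτ.le hL.le,
    ← Real.rpow_mul hL.le, mul_one_div, show 1 / (1 - σ) = σ / (1 - σ) + 1 by field_simp; ring,
    Real.rpow_add hτ, Real.rpow_one]
  field_simp

lemma primeScale_div_log (hσ1 : σ < 1) (hτ : 0 < τ) (hL : 0 < Real.log τ) :
    primeScale σ τ / Real.log τ = valueScale σ τ := by
  have h1 : 1 - σ ≠ 0 := by linarith
  rw [valueScale, primeScale, Real.mul_rpow hτ.le hL.le,
    Real.mul_rpow (y := Real.log τ ^ σ) hτ.le (by positivity),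
    ← Real.rpow_mul hL.le, mul_one_div, show 1 / (1 - σ) = σ / (1 - σ) + 1 by field_simp; ring,
    Real.rpow_add hL, Real.rpow_one]
  field_simp

lemma primeScale_pos (hτ : 0 < τ) (hL : 0 < Real.log τ) : 0 < primeScale σ τ := by
  rw [primeScale]; positivity

lemma valueScale_pos (hτ : 0 < τ) (hL : 0 < Real.log τ) : 0 < valueScale σ τ := by
  rw [valueScale]; positivity

lemma le_primeScale (hσ0 : 0 < σ) (hσ1 : σ < 1) (hτ : 1 ≤ τ) (hL : 1 ≤ Real.log τ) :
    τ ≤ primeScale σ τ := by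
  have h1 : 1 ≤ τ * Real.log τ := by nlinarith
  calc τ ≤ τ * Real.log τ := by nlinarith
    _ = (τ * Real.log τ) ^ (1 : ℝ) := (Real.rpow_one _).symm
    _ ≤ _ := Real.rpow_le_rpow_of_exponent_le h1 (by
      rw [le_div_iff₀ (by linarith)]; linarith)

lemma le_valueScale (hσ0 : 0 < σ) (hσ1 : σ < 1) (hτ : 1 ≤ τ) (hL : 1 ≤ Real.log τ) :
    τ ≤ valueScale σ τ := by
  have h0 : 1 ≤ Real.log τ ^ σ := Real.one_le_rpow hL hσ0.le
  have h1 : 1 ≤ τ * Real.log τ ^ σ := by nlinarith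
  calc τ ≤ τ * Real.log τ ^ σ := by nlinarith
    _ = (τ * Real.log τ ^ σ) ^ (1 : ℝ) := (Real.rpow_one _).symm
    _ ≤ _ := Real.rpow_le_rpow_of_exponent_le h1 (by
      rw [le_div_iff₀ (by linarith)]; linarith)

lemma log_primeScale_mul_exp (hτ : 0 < τ) (hL : 0 < Real.log τ) (w : ℝ) :
    Real.log (primeScale σ τ * Real.exp w) =
      (Real.log τ + Real.log (Real.log τ)) / (1 - σ) + w := by
  rw [Real.log_mul (primeScale_pos hτ hL).ne' (Real.exp_pos _).ne', Real.log_exp, primeScale,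
    Real.log_rpow (by positivity), Real.log_mul hτ.ne' hL.ne']
  ring

lemma one_div_log_eq_mul_legendreScale (hτ : 0 < τ) (hL : 0 < Real.log τ) (w : ℝ) :
    1 / Real.log (primeScale σ τ * Real.exp w) =
      (legendrePoint τ).1 * legendreScale σ (legendrePoint τ, w) := by
  rw [log_primeScale_mul_exp hτ hL, legendreScale, legendrePoint]
  simp only
  rw [one_div, one_div, ← mul_inv]
  congr 1
  field_simp

lemma rpow_eq_valueScale_div_mul (hσ1 : σ < 1) (hτ : 0 < τ) (hL : 0 < Real.log τ) (w : ℝ) :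
    (primeScale σ τ * Real.exp w) ^ σ = valueScale σ τ / τ * Real.exp (σ * w) := by
  rw [valueScale_div hσ1 hτ hL, Real.mul_rpow (primeScale_pos hτ hL).le (Real.exp_pos _).le,
    primeScale, ← Real.rpow_mul (by positivity), ← Real.exp_mul]
  congr 2
  · ring
  · ring

/-- The truncated cumulant expansion, expressed through `legendreFun`. -/
lemma mul_sum_besselMoment_eq (hσ1 : σ < 1) (hτ : 0 < τ) (hL : 0 < Real.log τ) (M : ℕ) (w : ℝ) :
    primeScale σ τ * Real.exp w * ∑ n ∈ Finset.range (M + 1),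
      besselMoment σ n / Real.log (primeScale σ τ * Real.exp w) ^ (n + 1) =
      valueScale σ τ * (Real.exp (σ * w) - legendreFun σ M (legendrePoint τ, w)) := by
  have h (n : ℕ) : besselMoment σ n / Real.log (primeScale σ τ * Real.exp w) ^ (n + 1) =
      ((legendrePoint τ).1 * legendreScale σ (legendrePoint τ, w)) * (besselMoment σ n *
        ((legendrePoint τ).1 * legendreScale σ (legendrePoint τ, w)) ^ n) := by
    rw [← one_div_log_eq_mul_legendreScale hτ hL, one_div, inv_pow, pow_succ]
    rw [div_eq_mul_inv, mul_inv]; ring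
  simp_rw [h]
  rw [← Finset.mul_sum, legendreFun, ← primeScale_div_log hσ1 hτ hL]
  simp only [legendrePoint]
  ring

end scales

end

noncomputable section

/-! ### The moments in the admissible range -/

lemma admissible_range_bounds {σ c T y τ : ℝ} (hσ0 : 0 < σ) (hσ1 : σ < 1) (hc0 : 0 < c)
    (hc1 : c ≤ 1) (hT0 : 0 < Real.log T) (hT : 1 ≤ Real.log (Real.log T)) (hy : Real.log T ≤ y)
    (hτ1 : 1 ≤ τ) (hL : 1 ≤ Real.log τ)
    (hτ : τ ≤ c / Real.log (Real.log T) * (Real.log T / y ^ (1 - σ)) ^ ((1 - σ) / σ)) :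
    (τ * Real.log τ) ^ (σ / (1 - σ)) ≤ c ^ (σ / (1 - σ)) * (Real.log T / y ^ (1 - σ)) ∧
      primeScale σ τ ≤ y ∧ Real.log τ ≤ Real.log y := by
  set l := Real.log T with hl
  set Q := l / y ^ (1 - σ) with hQ
  have h1 : 0 < 1 - σ := by linarith
  have hy0 : 0 < y := by linarith
  have hQ0 : 0 < Q := by positivity
  have hl1 : 1 ≤ l := by
    by_contra! h
    linarith [Real.log_nonpos hT0.le h.le]
  have hinv : σ * ((1 - σ) / σ) = 1 - σ := by field_simp
  have hQl : Q ^ ((1 - σ) / σ) ≤ l ^ (1 - σ) := by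
    have h2 : Q ≤ l ^ σ := by
      rw [hQ, div_le_iff₀ (by positivity)]
      calc l = l ^ σ * l ^ (1 - σ) := by rw [← Real.rpow_add hT0]; simp
        _ ≤ _ := by gcongr
    calc Q ^ ((1 - σ) / σ) ≤ (l ^ σ) ^ ((1 - σ) / σ) := by gcongr
      _ = _ := by rw [← Real.rpow_mul hT0.le, hinv]
  have hQy : Q ^ ((1 - σ) / σ) ≤ y ^ (1 - σ) := hQl.trans (by gcongr)
  have hτl : τ ≤ l := by
    calc τ ≤ c / Real.log l * Q ^ ((1 - σ) / σ) := hτ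
      _ ≤ 1 * l ^ (1 : ℝ) := by
        gcongr
        · rw [div_le_one (by linarith)]; linarith
        · exact hQl.trans (Real.rpow_le_rpow_of_exponent_le hl1 (by linarith))
      _ = l := by rw [one_mul, Real.rpow_one]
  have hLl : Real.log τ ≤ Real.log l := Real.log_le_log (by linarith) hτl
  have hτL : τ * Real.log τ ≤ c * Q ^ ((1 - σ) / σ) := by
    calc τ * Real.log τ ≤ (c / Real.log l * Q ^ ((1 - σ) / σ)) * Real.log l := by gcongr
      _ = _ := by field_simp
  have hτy : τ * Real.log τ ≤ y ^ (1 - σ) := by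
    have : 0 < Q ^ ((1 - σ) / σ) := by positivity
    nlinarith
  refine ⟨?_, ?_, ?_⟩
  · calc (τ * Real.log τ) ^ (σ / (1 - σ)) ≤ (c * Q ^ ((1 - σ) / σ)) ^ (σ / (1 - σ)) := by gcongr
      _ = _ := by
        rw [Real.mul_rpow hc0.le (by positivity), ← Real.rpow_mul hQ0.le,
          show (1 - σ) / σ * (σ / (1 - σ)) = 1 by field_simp, Real.rpow_one]
  · calc primeScale σ τ ≤ (y ^ (1 - σ)) ^ (1 / (1 - σ)) := by rw [primeScale]; gcongr
      _ = y := by rw [← Real.rpow_mul hy0.le, mul_one_div_cancel h1.ne', Real.rpow_one]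
  · refine Real.log_le_log (by linarith) ?_
    have hy1 : 1 ≤ y := hl1.trans hy
    calc τ ≤ τ * Real.log τ := by nlinarith
      _ ≤ y ^ (1 - σ) := hτy
      _ ≤ y ^ (1 : ℝ) := Real.rpow_le_rpow_of_exponent_le hy1 (by linarith)
      _ = y := Real.rpow_one y

lemma eventually_log_pow_le (m : ℕ) : ∀ᶠ τ : ℝ in Filter.atTop, Real.log τ ^ m ≤ τ := by
  have := (Real.isLittleO_pow_log_id_atTop (n := m)).bound (show (0 : ℝ) < 1 by norm_num)
  filter_upwards [this, Filter.eventually_ge_atTop 1] with τ hτ hτ1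
  rw [one_mul, id, Real.norm_of_nonneg (by linarith : 0 ≤ τ)] at hτ
  exact (le_abs_self _).trans hτ

lemma errScale_le_two {σ τ y : ℝ} (hσ : 1 / 2 < σ) {N : ℕ} (hL : 1 ≤ Real.log τ)
    (hl : 1 ≤ Real.log (Real.log τ)) (hx : 0 < primeScale σ τ) (hxy : primeScale σ τ ≤ y) :
    errScale σ N τ y ≤ 2 := by
  have h1 : Real.log (Real.log τ) / Real.log τ ≤ 1 := by
    rw [div_le_one (by linarith)]
    exact Real.log_le_self (by linarith)
  have h2 : primeScale σ τ / y ≤ 1 := by rw [div_le_one (by linarith)]; exact hxy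
  have h3 := pow_le_one₀ (n := N + 1) (by positivity) h1
  have h4 : (primeScale σ τ / y) ^ (σ - 1 / 2) ≤ 1 :=
    Real.rpow_le_one (div_nonneg hx.le (by linarith)) h2 (by linarith)
  rw [errScale]; linarith

lemma one_le_valueScale_mul_errScale_sq {σ τ y : ℝ} (hσ0 : 0 < σ) (hσ1 : σ < 1) {N : ℕ}
    (hτ : 1 ≤ τ) (hL : 1 ≤ Real.log τ) (hl : 1 ≤ Real.log (Real.log τ))
    (hLτ : Real.log τ ^ (2 * N + 2) ≤ τ) (hy : 0 < y) :
    1 ≤ valueScale σ τ * errScale σ N τ y ^ 2 := by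
  have h1 := le_valueScale hσ0 hσ1 hτ hL
  have h2 : (1 / Real.log τ) ^ (N + 1) ≤ errScale σ N τ y := by
    have h3 : 0 ≤ (primeScale σ τ / y) ^ (σ - 1 / 2) := by
      have := primeScale_pos (σ := σ) (by linarith : 0 < τ) (by linarith : 0 < Real.log τ)
      positivity
    have h4 : (1 / Real.log τ) ^ (N + 1) ≤ (Real.log (Real.log τ) / Real.log τ) ^ (N + 1) := by
      gcongr
    rw [errScale]; linarith
  calc (1 : ℝ) = Real.log τ ^ (2 * N + 2) * ((1 / Real.log τ) ^ (N + 1)) ^ 2 := by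
        rw [← pow_mul, show (N + 1) * 2 = 2 * N + 2 by ring, ← mul_pow, mul_one_div_cancel
          (by linarith), one_pow]
    _ ≤ valueScale σ τ * errScale σ N τ y ^ 2 := by
        have := hLτ.trans h1
        have : 0 ≤ valueScale σ τ := by linarith
        gcongr

set_option maxHeartbeats 400000 in
/-- The truncation error of the cumulant expansion is at most the square of `errScale`. -/
lemma exists_abs_cumulant_sub_legendreFun_le {σ : ℝ} (hσ : 1 / 2 < σ) (hσ1 : σ < 1) (N : ℕ) :
    ∃ C τ₀ y₀ : ℝ, 0 < C ∧ ∀ τ y : ℝ, τ₀ ≤ τ → y₀ ≤ y → primeScale σ τ ≤ y →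
      ∀ w, |w - legendreCenter σ| ≤ 1 →
        |cumulant σ y (valueScale σ τ / τ * Real.exp (σ * w)) - valueScale σ τ *
          (Real.exp (σ * w) - legendreFun σ (2 * N + 2) (legendrePoint τ, w))| ≤
          C * (valueScale σ τ * errScale σ N τ y ^ 2) := by
  obtain ⟨C, hC, h⟩ := exists_abs_cumulant_sub_le hσ hσ1 (2 * N + 2)
  set a := |legendreCenter σ| + 1 with ha
  have ha1 : 1 ≤ a := by rw [ha]; linarith [abs_nonneg (legendreCenter σ)]
  set κ := Real.exp a with hκ
  have hκ1 : 1 ≤ κ := Real.one_le_exp (by linarith)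
  have hev : ∀ᶠ τ : ℝ in Filter.atTop, 1 ≤ τ ∧ a ≤ Real.log τ ∧ 1 ≤ Real.log (Real.log τ) ∧
      2 * κ ≤ τ := by
    filter_upwards [Filter.eventually_ge_atTop 1, Real.tendsto_log_atTop.eventually_ge_atTop a,
      (Real.tendsto_log_atTop.comp Real.tendsto_log_atTop).eventually_ge_atTop 1,
      Filter.eventually_ge_atTop (2 * κ)] with τ h1 h2 h3 h4
    exact ⟨h1, h2, h3, h4⟩
  obtain ⟨τ₀, hτ₀⟩ := Filter.eventually_atTop.mp hev
  refine ⟨C * κ * κ, τ₀, 2 * κ, by positivity, fun τ y hτ hy hxy w hw => ?_⟩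
  obtain ⟨hτ1, hLa, hl, hτκ⟩ := hτ₀ τ hτ
  have hτ0 : 0 < τ := by linarith
  have hL1 : 1 ≤ Real.log τ := ha1.trans hLa
  have hL : 0 < Real.log τ := by linarith
  have hy0 : 0 < y := by linarith
  have hwa : |w| ≤ a := by
    have := abs_add_le (w - legendreCenter σ) (legendreCenter σ)
    rw [sub_add_cancel] at this
    rw [ha]; linarith
  obtain ⟨hwa1, hwa2⟩ := abs_le.mp hwa
  have hew : Real.exp w ≤ κ := Real.exp_le_exp.mpr hwa2
  have hew2 : κ⁻¹ ≤ Real.exp w := by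
    rw [hκ, ← Real.exp_neg]; exact Real.exp_le_exp.mpr hwa1
  set X := primeScale σ τ with hX
  set V := valueScale σ τ with hV
  have hX0 : 0 < X := primeScale_pos hτ0 hL
  have hV0 : 0 < V := valueScale_pos hτ0 hL
  have hX2 : 2 ≤ X * Real.exp w := by
    have h1 : 2 * κ ≤ X := hτκ.trans (le_primeScale (by linarith) hσ1 hτ1 hL1)
    calc 2 = 2 * κ * κ⁻¹ := by field_simp
      _ ≤ _ := by gcongr
  have hXy : X * Real.exp w ≤ y ^ 2 := by
    rw [sq]
    have : Real.exp w ≤ y := by linarith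
    gcongr
  have hmain := h (X * Real.exp w) y hX2 (by linarith) hXy
  rw [rpow_eq_valueScale_div_mul hσ1 hτ0 hL, mul_sum_besselMoment_eq hσ1 hτ0 hL] at hmain
  refine hmain.trans ?_
  set z := (legendrePoint τ).1 with hz
  have hz' : z = 1 / Real.log τ := rfl
  set U := legendreScale σ (legendrePoint τ, w) with hU
  have hinv : 1 / Real.log (X * Real.exp w) = z * U := one_div_log_eq_mul_legendreScale hτ0 hL w
  have hden : 1 ≤ (1 + (legendrePoint τ).2) / (1 - σ) + w * (legendrePoint τ).1 := by
    have h1 : 2 ≤ (1 + (legendrePoint τ).2) / (1 - σ) := by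
      rw [le_div_iff₀ (by linarith)]
      have : 0 ≤ (legendrePoint τ).2 := by rw [legendrePoint]; positivity
      linarith
    have h2 : -1 ≤ w * (legendrePoint τ).1 := by
      rw [legendrePoint]
      simp only
      rw [mul_one_div, le_div_iff₀ hL]
      linarith
    linarith
  have hU0 : 0 < U := by rw [hU, legendreScale]; simp only; positivity
  have hU1 : U ≤ 1 := by rw [hU, legendreScale]; exact inv_le_one_of_one_le₀ hden
  have hz0 : 0 < z := by rw [hz']; positivity
  have hz1 : z ≤ 1 := by rw [hz', div_le_one hL]; exact hL1
  have hXlog : X * Real.exp w * (1 / Real.log (X * Real.exp w)) = V * Real.exp w * U := by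
    rw [hinv, hV, ← primeScale_div_log hσ1 hτ0 hL, hz']; ring
  set ρ := Real.log (Real.log τ) / Real.log τ with hρ
  have hzρ : z ≤ ρ := by rw [hz', hρ]; gcongr
  have hρ0 : 0 < ρ := hz0.trans_le hzρ
  -- the truncation and the primes beyond `y` each contribute at most the square of one of the two
  -- terms of `errScale`, up to a constant
  have e1 : (1 / Real.log (X * Real.exp w)) ^ (2 * N + 3) ≤ ρ ^ (2 * N + 2) := by
    rw [hinv]
    calc (z * U) ^ (2 * N + 3) ≤ z ^ (2 * N + 3) := by
          gcongr
          exact mul_le_of_le_one_right hz0.le hU1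
      _ ≤ z ^ (2 * N + 2) := pow_le_pow_of_le_one hz0.le hz1 (by omega)
      _ ≤ _ := by gcongr
  have e2 : (X * Real.exp w / y) ^ (2 * σ - 1) ≤ κ * ((X / y) ^ (σ - 1 / 2)) ^ 2 := by
    rw [← Real.rpow_mul_natCast (by positivity), show (σ - 1 / 2) * ((2 : ℕ) : ℝ) = 2 * σ - 1 by
      push_cast; ring, mul_div_right_comm, Real.mul_rpow (by positivity) (Real.exp_pos _).le,
      mul_comm]
    gcongr
    calc Real.exp w ^ (2 * σ - 1) ≤ κ ^ (2 * σ - 1) :=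
          Real.rpow_le_rpow (Real.exp_pos _).le hew (by linarith)
      _ ≤ κ ^ (1 : ℝ) := Real.rpow_le_rpow_of_exponent_le hκ1 (by linarith)
      _ = κ := Real.rpow_one κ
  have e3 : ρ ^ (2 * N + 2) + ((X / y) ^ (σ - 1 / 2)) ^ 2 ≤ errScale σ N τ y ^ 2 := by
    have h1 : 0 ≤ ρ ^ (N + 1) := by positivity
    have h2 : 0 ≤ (X / y) ^ (σ - 1 / 2) := by positivity
    have h3 : errScale σ N τ y = ρ ^ (N + 1) + (X / y) ^ (σ - 1 / 2) := rfl
    rw [h3, show 2 * N + 2 = (N + 1) * 2 by ring, pow_mul]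
    nlinarith
  calc C * (X * Real.exp w) * (1 / Real.log (X * Real.exp w) ^ (2 * N + 2 + 2) +
        (X * Real.exp w / y) ^ (2 * σ - 1) / Real.log (X * Real.exp w))
      = C * (X * Real.exp w * (1 / Real.log (X * Real.exp w))) *
        ((1 / Real.log (X * Real.exp w)) ^ (2 * N + 3) +
          (X * Real.exp w / y) ^ (2 * σ - 1)) := by
        rw [show 2 * N + 2 + 2 = (2 * N + 3) + 1 by ring, pow_succ, one_div_pow]
        ring
    _ = C * (V * Real.exp w * U) * ((1 / Real.log (X * Real.exp w)) ^ (2 * N + 3) +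
          (X * Real.exp w / y) ^ (2 * σ - 1)) := by rw [hXlog]
    _ ≤ C * (V * κ * 1) * (κ * errScale σ N τ y ^ 2) := by
        have h1 : (1 / Real.log (X * Real.exp w)) ^ (2 * N + 3) +
            (X * Real.exp w / y) ^ (2 * σ - 1) ≤ κ * errScale σ N τ y ^ 2 := by
          have h2 : 0 ≤ ρ ^ (2 * N + 2) := by positivity
          nlinarith
        have h3 : 0 ≤ (1 / Real.log (X * Real.exp w)) ^ (2 * N + 3) +
            (X * Real.exp w / y) ^ (2 * σ - 1) := by rw [hinv]; positivity
        gcongr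
    _ = _ := by ring

/-- The moments of `|ζ(σ + it; y)|` of order `k = (τ log τ) ^ (σ / (1 - σ)) e ^ (σ w)`, in the
admissible range of `τ`. -/
theorem exists_abs_log_zetaMoment_sub_le {σ : ℝ} (hσ : 1 / 2 < σ) (hσ1 : σ < 1) :
    ∃ c : ℝ, 0 < c ∧ ∀ N : ℕ, ∃ C τ₀ T₀ : ℝ, 0 < C ∧ ∀ T y τ : ℝ, T₀ ≤ T → Real.log T ≤ y →
      y ≤ Real.log T ^ 2 → τ₀ ≤ τ →
      τ ≤ c / Real.log (Real.log T) * (Real.log T / y ^ (1 - σ)) ^ ((1 - σ) / σ) →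
      0 < T ∧ 1 ≤ τ ∧ 1 ≤ Real.log τ ∧ 1 ≤ Real.log (Real.log τ) ∧ 2 ≤ y ∧
      primeScale σ τ ≤ y ∧ Real.log τ ≤ Real.log y ∧
      1 ≤ valueScale σ τ * errScale σ N τ y ^ 2 ∧
      ∀ w, |w - legendreCenter σ| ≤ 1 →
        0 < zetaMoment σ T y (valueScale σ τ / τ * Real.exp (σ * w)) ∧
        |Real.log (zetaMoment σ T y (valueScale σ τ / τ * Real.exp (σ * w))) - valueScale σ τ *
          (Real.exp (σ * w) - legendreFun σ (2 * N + 2) (legendrePoint τ, w))| ≤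
          C * (valueScale σ τ * errScale σ N τ y ^ 2) := by
  have hσ0 : 0 < σ := by linarith
  obtain ⟨c₁, T₁, hc₁, hT₁, hmom⟩ := exists_moment_mem_Icc hσ hσ1
  set κ := Real.exp (|legendreCenter σ| + 1) with hκ
  have hκ0 : 0 < κ := Real.exp_pos _
  -- for this `c` every moment in use has order in the range of `exists_moment_mem_Icc`
  set c := min 1 ((c₁ / κ) ^ ((1 - σ) / σ)) with hc
  have hc0 : 0 < c := lt_min one_pos (by positivity)
  have hcpow : c ^ (σ / (1 - σ)) * κ ≤ c₁ := by
    have h1 : 0 < 1 - σ := by linarith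
    have : c ^ (σ / (1 - σ)) ≤ ((c₁ / κ) ^ ((1 - σ) / σ)) ^ (σ / (1 - σ)) := by
      gcongr
      exact min_le_right _ _
    rw [← Real.rpow_mul (by positivity), show (1 - σ) / σ * (σ / (1 - σ)) = 1 by field_simp,
      Real.rpow_one, le_div_iff₀ hκ0] at this
    exact this
  refine ⟨c, hc0, fun N => ?_⟩
  obtain ⟨C, τ₁, y₁, hC, hcum⟩ := exists_abs_cumulant_sub_legendreFun_le hσ hσ1 N
  have hevτ : ∀ᶠ τ : ℝ in Filter.atTop, 1 ≤ τ ∧ 1 ≤ Real.log τ ∧ 1 ≤ Real.log (Real.log τ) ∧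
      Real.log τ ^ (2 * N + 2) ≤ τ := by
    filter_upwards [Filter.eventually_ge_atTop 1, Real.tendsto_log_atTop.eventually_ge_atTop 1,
      (Real.tendsto_log_atTop.comp Real.tendsto_log_atTop).eventually_ge_atTop 1,
      eventually_log_pow_le (2 * N + 2)] with τ h1 h2 h3 h4
    exact ⟨h1, h2, h3, h4⟩
  have hevT : ∀ᶠ T : ℝ in Filter.atTop, max 2 y₁ ≤ Real.log T ∧ 1 ≤ Real.log (Real.log T) := by
    filter_upwards [Real.tendsto_log_atTop.eventually_ge_atTop (max 2 y₁),
      (Real.tendsto_log_atTop.comp Real.tendsto_log_atTop).eventually_ge_atTop 1] with T h1 h2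
    exact ⟨h1, h2⟩
  obtain ⟨τ₂, hτ₂⟩ := Filter.eventually_atTop.mp hevτ
  obtain ⟨T₂, hT₂⟩ := Filter.eventually_atTop.mp hevT
  refine ⟨C + 1, max τ₁ τ₂, max T₁ T₂, by positivity, fun T y τ hT hTy hyT hτ hτc => ?_⟩
  obtain ⟨hτ1, hL, hl, hLτ⟩ := hτ₂ τ ((le_max_right _ _).trans hτ)
  obtain ⟨hTl, hTll⟩ := hT₂ T ((le_max_right _ _).trans hT)
  have hT0 : 0 < T := by linarith [(le_max_left T₁ T₂).trans hT]
  have hTl2 : 2 ≤ Real.log T := (le_max_left _ _).trans hTl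
  have hy2 : 2 ≤ y := hTl2.trans hTy
  obtain ⟨hb1, hb2, hb3⟩ := admissible_range_bounds hσ0 hσ1 hc0 (min_le_left _ _) (by linarith)
    hTll hTy hτ1 hL hτc
  have hV1 := one_le_valueScale_mul_errScale_sq hσ0 hσ1 (N := N) hτ1 hL hl hLτ
    (by linarith : 0 < y)
  refine ⟨hT0, hτ1, hL, hl, hy2, hb2, hb3, hV1, fun w hw => ?_⟩
  set k := valueScale σ τ / τ * Real.exp (σ * w) with hk
  have hk0 : 0 < k := by
    have := valueScale_pos (σ := σ) (by linarith : 0 < τ) (by linarith : 0 < Real.log τ)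
    positivity
  have hkle : k ≤ c₁ * (Real.log T / y ^ (1 - σ)) := by
    have h1 : Real.exp (σ * w) ≤ κ := by
      refine Real.exp_le_exp.mpr ?_
      have h2 := abs_add_le (w - legendreCenter σ) (legendreCenter σ)
      rw [sub_add_cancel] at h2
      calc σ * w ≤ σ * |w| := by gcongr; exact le_abs_self w
        _ ≤ 1 * |w| := by gcongr
        _ ≤ _ := by linarith
    rw [hk, valueScale_div hσ1 (by linarith) (by linarith)]
    calc _ ≤ (c ^ (σ / (1 - σ)) * (Real.log T / y ^ (1 - σ))) * κ := by gcongr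
      _ = c ^ (σ / (1 - σ)) * κ * (Real.log T / y ^ (1 - σ)) := by ring
      _ ≤ _ := by gcongr
  obtain ⟨hm1, hm2⟩ := hmom T y k ((le_max_left _ _).trans hT) hTy hyT hk0 hkle
  have hcu := hcum τ y ((le_max_left _ _).trans hτ) (((le_max_right _ _).trans hTl).trans hTy)
    hb2 w hw
  rw [← hk] at hcu
  set Λ := cumulant σ y k with hΛ
  have hJ : zetaMoment σ T y k = 1 / T *
      ∫ t in T..2 * T, ‖zetaShort ((σ : ℂ) + (t : ℂ) * Complex.I) y‖ ^ k := zetaMoment_eq hσ0 T y k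
  have hlo : 1 / 2 * Real.exp Λ ≤ zetaMoment σ T y k := by
    rw [hJ, one_div_mul_eq_div T, le_div_iff₀ hT0]; linarith
  have hhi : zetaMoment σ T y k ≤ 2 * Real.exp Λ := by
    rw [hJ, one_div_mul_eq_div T, div_le_iff₀ hT0]; linarith
  have hpos : 0 < zetaMoment σ T y k := lt_of_lt_of_le (by positivity) hlo
  refine ⟨hpos, ?_⟩
  have hlog : |Real.log (zetaMoment σ T y k) - Λ| ≤ 1 := by
    have h1 := Real.log_le_log (by positivity) hlo
    have h2 := Real.log_le_log hpos hhi
    rw [Real.log_mul (by norm_num) (Real.exp_pos _).ne', Real.log_exp] at h1 h2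
    rw [one_div, Real.log_inv] at h1
    have := Real.log_two_lt_d9
    rw [abs_le]; constructor <;> linarith
  refine (abs_sub_le _ Λ _).trans ?_
  linarith

end

noncomputable section

/-! ### The distribution function -/

open scoped Topology in
lemma tendsto_legendrePoint : Filter.Tendsto legendrePoint Filter.atTop (𝓝 0) := by
  have h1 : Filter.Tendsto (fun x : ℝ => Real.log x / x) Filter.atTop (𝓝 0) :=
    Real.isLittleO_log_id_atTop.tendsto_div_nhds_zero
  have h2 : Filter.Tendsto (fun x : ℝ => 1 / x) Filter.atTop (𝓝 0) := by
    simpa using tendsto_inv_atTop_zero (𝕜 := ℝ)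
  exact (h2.comp Real.tendsto_log_atTop).prodMk_nhds (h1.comp Real.tendsto_log_atTop)

lemma norm_legendrePoint {τ : ℝ} (hL : 1 ≤ Real.log τ) (hl : 1 ≤ Real.log (Real.log τ)) :
    ‖legendrePoint τ‖ = Real.log (Real.log τ) / Real.log τ := by
  rw [legendrePoint, Prod.norm_mk, Real.norm_of_nonneg (by positivity),
    Real.norm_of_nonneg (by positivity), max_eq_right]
  gcongr

/-- Chernoff's bound at a moment for which the moment asymptotics are known. -/
lemma PhiShort_le_exp {σ T y τ V w S E : ℝ} (hσ : 0 < σ) (hT : 0 < T) (hτ : 0 < τ) (hV : 0 ≤ V)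
    (hpos : 0 < zetaMoment σ T y (V / τ * Real.exp (σ * w)))
    (h : |Real.log (zetaMoment σ T y (V / τ * Real.exp (σ * w))) -
      V * (Real.exp (σ * w) - S)| ≤ E) :
    PhiShort σ T τ y ≤ Real.exp (-(V * S) + E) := by
  refine (PhiShort_le_exp_mul_zetaMoment hσ hT (k := V / τ * Real.exp (σ * w)) (by positivity)
    τ y).trans ?_
  rw [← Real.exp_log hpos, ← Real.exp_add]
  refine Real.exp_le_exp.mpr ?_
  have h1 : V / τ * Real.exp (σ * w) * τ = V * Real.exp (σ * w) := by field_simp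
  rw [h1]
  linarith [(abs_le.mp h).2]

/-- If two of the three contributions to `J` are negligible, the third one is at least half
of `J`. -/
lemma exp_le_of_le_add_add {J J₁ J₂ P a x x₁ x₂ : ℝ} (hJ : 0 < J) (hJ₁ : 0 < J₁) (hJ₂ : 0 < J₂)
    (h : J ≤ Real.exp x₂ * J₂ + Real.exp x₁ * J₁ + Real.exp x * P)
    (h₁ : x₁ + Real.log J₁ ≤ Real.log J - 2) (h₂ : x₂ + Real.log J₂ ≤ Real.log J - 2)
    (ha : x + a ≤ Real.log J - 1) : Real.exp a ≤ P := by
  have he1 : Real.exp (-1) ≤ 1 / 2 := by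
    rw [Real.exp_neg, inv_le_comm₀ (Real.exp_pos _) (by norm_num)]
    have := Real.exp_one_gt_d9
    linarith
  have he2 : Real.exp (-2) ≤ 1 / 4 := by
    have e : Real.exp (-2) = Real.exp (-1) * Real.exp (-1) := by rw [← Real.exp_add]; norm_num
    have := Real.exp_pos (-1)
    rw [e]
    nlinarith
  have hquart {u b : ℝ} (hb : 0 < b) (hab : u + Real.log b ≤ Real.log J - 2) :
      Real.exp u * b ≤ 1 / 4 * J := by
    calc Real.exp u * b = Real.exp (u + Real.log b) := by rw [Real.exp_add, Real.exp_log hb]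
      _ ≤ Real.exp (-2 + Real.log J) := Real.exp_le_exp.mpr (by linarith)
      _ = Real.exp (-2) * J := by rw [Real.exp_add, Real.exp_log hJ]
      _ ≤ _ := by gcongr
  have q1 := hquart hJ₁ h₁
  have q2 := hquart hJ₂ h₂
  have q3 : Real.exp x * Real.exp a ≤ 1 / 2 * J := by
    calc Real.exp x * Real.exp a = Real.exp (x + a) := (Real.exp_add _ _).symm
      _ ≤ Real.exp (-1 + Real.log J) := Real.exp_le_exp.mpr (by linarith)
      _ = Real.exp (-1) * J := by rw [Real.exp_add, Real.exp_log hJ]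
      _ ≤ _ := by gcongr
  exact le_of_mul_le_mul_left (q3.trans (by linarith)) (Real.exp_pos x)

/-- The lower bound obtained by tilting. The moments of orders `k e ^ (±σ h)` show that, in the
measure weighted by the moment of order `k`, the value of `log |ζ|` lies within `r τ` of `τ`. -/
lemma exp_le_PhiShort {σ T y τ V w h S S₁ S₂ E r : ℝ} (hσ : 0 < σ) (hT : 0 < T) (hτ : 0 < τ)
    (hV : 0 ≤ V) (hh : 0 ≤ h)
    (hp : 0 < zetaMoment σ T y (V / τ * Real.exp (σ * w)))
    (hp₁ : 0 < zetaMoment σ T y (V / τ * Real.exp (σ * (w - h))))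
    (hp₂ : 0 < zetaMoment σ T y (V / τ * Real.exp (σ * (w + h))))
    (hm : |Real.log (zetaMoment σ T y (V / τ * Real.exp (σ * w))) -
      V * (Real.exp (σ * w) - S)| ≤ E)
    (hm₁ : |Real.log (zetaMoment σ T y (V / τ * Real.exp (σ * (w - h)))) -
      V * (Real.exp (σ * (w - h)) - S₁)| ≤ E)
    (hm₂ : |Real.log (zetaMoment σ T y (V / τ * Real.exp (σ * (w + h)))) -
      V * (Real.exp (σ * (w + h)) - S₂)| ≤ E)
    (h₁ : V * (S - S₁ - r * (Real.exp (σ * w) - Real.exp (σ * (w - h)))) + 2 * E ≤ -2)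
    (h₂ : V * (S - S₂ - r * (Real.exp (σ * (w + h)) - Real.exp (σ * w))) + 2 * E ≤ -2) :
    Real.exp (-(V * (S + r * Real.exp (σ * w))) - E - 1) ≤ PhiShort σ T ((1 - r) * τ) y := by
  have hVτ : 0 ≤ V / τ := by positivity
  have hk1 : V / τ * Real.exp (σ * (w - h)) ≤ V / τ * Real.exp (σ * w) := by
    gcongr; linarith
  have hk2 : V / τ * Real.exp (σ * w) ≤ V / τ * Real.exp (σ * (w + h)) := by
    gcongr; linarith
  have htilt := zetaMoment_le_tilt hσ hT (by positivity) hk1 hk2 y ((1 - r) * τ) ((1 + r) * τ)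
  have hkτ : ∀ u v : ℝ, V / τ * u * (v * τ) = v * (V * u) := fun u v => by field_simp
  have ha := abs_le.mp hm
  have ha1 := abs_le.mp hm₁
  have ha2 := abs_le.mp hm₂
  refine exp_le_of_le_add_add hp hp₁ hp₂ htilt ?_ ?_ ?_
  · rw [sub_mul, hkτ, hkτ]
    linarith
  · rw [sub_mul, hkτ, hkτ]
    linarith
  · rw [hkτ]
    linarith

/-- When `τ log τ` is at least a constant times `y ^ (1 - σ)`, the trivial lower bound for the
Euler product is of order `-τ`. -/
lemma exists_neg_mul_le_log_norm_zetaShort {σ κ : ℝ} (hσ : 0 < σ) (hσ1 : σ < 1) (hκ : 0 < κ) :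
    ∃ K : ℝ, 0 < K ∧ ∀ τ y t : ℝ, 1 ≤ τ → 1 ≤ Real.log τ → 2 ≤ y → Real.log τ ≤ Real.log y →
      κ ≤ primeScale σ τ / y →
      -(K * τ) ≤ Real.log ‖zetaShort ((σ : ℂ) + (t : ℂ) * Complex.I) y‖ := by
  obtain ⟨C, hC, h⟩ := exists_sum_primes_rpow_neg_le hσ hσ1
  have h1 : 0 < 1 - σ := by linarith
  refine ⟨C * (κ ^ (1 - σ))⁻¹, by positivity, fun τ y t hτ hL hy hLy hκy => ?_⟩
  have hy0 : 0 < y := by linarith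
  have hly : 0 < Real.log y := by linarith
  have h2 := exp_neg_sum_le_norm_zetaShort hσ y t
  rw [← Real.le_log_iff_exp_le (norm_zetaShort_pos hσ y t)] at h2
  refine le_trans (neg_le_neg ((h y hy).trans ?_)) h2
  rw [mul_assoc]
  refine mul_le_mul_of_nonneg_left ?_ hC.le
  rw [le_div_iff₀ hy0, primeScale] at hκy
  have h3 : (κ * y) ^ (1 - σ) ≤ τ * Real.log τ := by
    calc (κ * y) ^ (1 - σ) ≤ ((τ * Real.log τ) ^ (1 / (1 - σ))) ^ (1 - σ) := by gcongr
      _ = _ := by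
        rw [← Real.rpow_mul (by positivity), one_div_mul_cancel h1.ne', Real.rpow_one]
  rw [Real.mul_rpow hκ.le hy0.le] at h3
  rw [div_le_iff₀ hly, mul_assoc, ← div_eq_inv_mul, le_div_iff₀ (by positivity), mul_comm]
  refine h3.trans ?_
  gcongr

/-- Both inequalities follow once the distribution function is trapped between the exponentials
with the extreme values of the error term. -/
lemma exists_error_term {V Q ε a b : ℝ} (hV : 0 < V) (hε : 0 ≤ ε)
    (ha : a ≤ Real.exp (-(V * (Q - ε)))) (hb : Real.exp (-(V * (Q + ε))) ≤ b) (hab : a ≤ b) :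
    ∃ θ : ℝ, |θ| ≤ 1 * ε ∧ a ≤ Real.exp (-(V * (Q + θ))) ∧ Real.exp (-(V * (Q + θ))) ≤ b := by
  set m := max a (Real.exp (-(V * (Q + ε)))) with hm
  have hm0 : 0 < m := lt_of_lt_of_le (Real.exp_pos _) (le_max_right _ _)
  have hmb : m ≤ b := max_le hab hb
  have hm2 : m ≤ Real.exp (-(V * (Q - ε))) := by
    refine max_le ha (Real.exp_le_exp.mpr ?_)
    nlinarith
  have hl1 : -(V * (Q + ε)) ≤ Real.log m := by
    rw [Real.le_log_iff_exp_le hm0]; exact le_max_right _ _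
  have hl2 : Real.log m ≤ -(V * (Q - ε)) := by rwa [Real.log_le_iff_le_exp hm0]
  have hθ : Real.exp (-(V * (Q + (-(Real.log m / V) - Q)))) = m := by
    rw [show -(V * (Q + (-(Real.log m / V) - Q))) = Real.log m by field_simp; ring,
      Real.exp_log hm0]
  refine ⟨-(Real.log m / V) - Q, ?_, ?_, ?_⟩
  · rw [one_mul, abs_le]
    have e : Real.log m = V * (Real.log m / V) := by field_simp
    rw [e] at hl1 hl2
    constructor
    · have : V * (Real.log m / V) ≤ V * -(Q - ε) := by linarith
      linarith [le_of_mul_le_mul_left this hV]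
    · have : V * -(Q + ε) ≤ V * (Real.log m / V) := by linarith
      linarith [le_of_mul_le_mul_left this hV]
  · rw [hθ]; exact le_max_left _ _
  · rw [hθ]; exact hmb

set_option maxHeartbeats 2000000 in
/-- Both bounds for the distribution function. -/
theorem exists_PhiShort_bounds {σ : ℝ} (hσ : 1 / 2 < σ) (hσ1 : σ < 1) :
    ∃ (𝔞 : ℕ → Polynomial ℝ) (c : ℝ), (∀ n, (𝔞 n).natDegree ≤ n) ∧
      𝔞 0 = Polynomial.C (leadingConst σ) ∧ 0 < c ∧ ∀ N : ℕ, ∃ C τ₀ T₀ : ℝ, 0 < C ∧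
        ∀ c₀ : ℝ, C ≤ c₀ → ∀ T y τ : ℝ, T₀ ≤ T → Real.log T ≤ y → y ≤ Real.log T ^ 2 → τ₀ ≤ τ →
          τ ≤ c / Real.log (Real.log T) * (Real.log T / y ^ (1 - σ)) ^ ((1 - σ) / σ) →
          0 < T ∧ 0 < τ ∧ 0 < valueScale σ τ ∧ 0 ≤ c₀ * errScale σ N τ y ∧
          PhiShort σ T τ y ≤ Real.exp (-(valueScale σ τ * (∑ n ∈ Finset.range (N + 1),
            (𝔞 n).eval (Real.log (Real.log τ)) / Real.log τ ^ n - c₀ * errScale σ N τ y))) ∧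
          Real.exp (-(valueScale σ τ * (∑ n ∈ Finset.range (N + 1),
            (𝔞 n).eval (Real.log (Real.log τ)) / Real.log τ ^ n + c₀ * errScale σ N τ y))) ≤
            PhiShort σ T ((1 - c₀ * errScale σ N τ y) * τ) y := by
  have hσ0 : 0 < σ := by linarith
  obtain ⟨𝔞, hdeg, h𝔞0, hleg⟩ := exists_polynomials_legendreFun hσ hσ1
  obtain ⟨c, hc, hmom⟩ := exists_abs_log_zetaMoment_sub_le hσ hσ1
  refine ⟨𝔞, c, hdeg, h𝔞0, hc, fun N => ?_⟩
  obtain ⟨W, B, η, C₁, hB, hη, hη1, hC₁, hW⟩ := hleg N (2 * N + 2) (by omega)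
  obtain ⟨C₂, τ₁, T₁, hC₂, hest⟩ := hmom N
  set κ := Real.exp (|legendreCenter σ| + 1) with hκ
  have hκ0 : 0 < κ := Real.exp_pos _
  set b := σ / κ with hb
  have hb0 : 0 < b := by positivity
  -- the width `r = A δ` of the window around `τ`, and the step `h = r b / (2 B)` between moments
  set A := (B + 2 * C₂ + 2) / b with hA
  have hA0 : 0 < A := by positivity
  have hAb : A * b = B + 2 * C₂ + 2 := by rw [hA]; field_simp
  set δ₀ := η * B / (A * b) with hδ₀
  have hδ₀0 : 0 < δ₀ := by positivity
  set κ₀ := (δ₀ / 2) ^ (1 / (σ - 1 / 2)) with hκ₀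
  obtain ⟨K, hK, htriv⟩ := exists_neg_mul_le_log_norm_zetaShort hσ0 hσ1
    (show 0 < κ₀ by positivity)
  have hev : ∀ᶠ τ : ℝ in Filter.atTop,
      (|W (legendrePoint τ) - legendreCenter σ| ≤ η / 2 ∧
        leadingConst σ - 1 ≤ legendreFun σ (2 * N + 2) (legendrePoint τ, W (legendrePoint τ)) ∧
        (∀ w, |w - legendreCenter σ| ≤ η →
          legendreFun σ (2 * N + 2) (legendrePoint τ, W (legendrePoint τ)) -
            B * (w - W (legendrePoint τ)) ^ 2 ≤
            legendreFun σ (2 * N + 2) (legendrePoint τ, w)) ∧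
        ∀ z l : ℝ, legendrePoint τ = (z, z * l) →
          |legendreFun σ (2 * N + 2) (legendrePoint τ, W (legendrePoint τ)) -
            ∑ n ∈ Finset.range (N + 1), (𝔞 n).eval l * z ^ n| ≤
            C₁ * ‖legendrePoint τ‖ ^ (N + 1)) ∧
      ‖legendrePoint τ‖ < min 1 (δ₀ / 2) := by
    refine (tendsto_legendrePoint.eventually hW).and ?_
    have := tendsto_legendrePoint.norm
    rw [norm_zero] at this
    exact this.eventually (gt_mem_nhds (lt_min one_pos (by positivity)))
  obtain ⟨τ₂, hτ₂⟩ := Filter.eventually_atTop.mp hev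
  set Cb := C₁ + A * κ + 2 * C₂ + 2 with hCb
  set Cc := C₁ + (|leadingConst σ| + 1) / δ₀ with hCc
  have hCb0 : 0 < Cb := by positivity
  refine ⟨Cb + A + (K + 2) / δ₀ + Cc, max τ₁ τ₂, T₁, by positivity,
    fun c₀ hc₀ T y τ hT hTy hyT hτ hτc => ?_⟩
  have hCc0 : 0 ≤ Cc := by positivity
  have hK0 : 0 ≤ (K + 2) / δ₀ := by positivity
  obtain ⟨hT0, hτ1, hL, hl, hy2, hxy, hLy, hVδ, hJ⟩ :=
    hest T y τ hT hTy hyT ((le_max_left _ _).trans hτ) hτc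
  obtain ⟨⟨hW1, hWlow, hWq, hWs⟩, hnorm⟩ := hτ₂ τ ((le_max_right _ _).trans hτ)
  set v := legendrePoint τ with hv
  set V := valueScale σ τ with hV
  set δ := errScale σ N τ y with hδ
  set w := W v with hw
  set S := legendreFun σ (2 * N + 2) (v, w) with hS
  set Q := ∑ n ∈ Finset.range (N + 1),
    (𝔞 n).eval (Real.log (Real.log τ)) / Real.log τ ^ n with hQ
  have hτ0 : 0 < τ := by linarith only [hτ1]
  have hX0 : 0 < primeScale σ τ := primeScale_pos hτ0 (by linarith only [hL])
  have hV0 : 0 < V := valueScale_pos hτ0 (by linarith only [hL])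
  have hnv := norm_legendrePoint hL hl
  have hYnn : 0 ≤ (primeScale σ τ / y) ^ (σ - 1 / 2) := by positivity
  have hδeq : δ = ‖v‖ ^ (N + 1) + (primeScale σ τ / y) ^ (σ - 1 / 2) := by
    rw [hδ, errScale, hnv]
  have hv0 : 0 ≤ ‖v‖ ^ (N + 1) := by positivity
  have hδ0 : 0 < δ := by
    rw [hδeq]
    have : 0 < (primeScale σ τ / y) ^ (σ - 1 / 2) := by positivity
    linarith only [this, hv0]
  have hδ2 : δ ≤ 2 := errScale_le_two hσ hL hl hX0 hxy
  have hδsq : δ ^ 2 ≤ 2 * δ := by rw [sq]; gcongr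
  have hSQ : |S - Q| ≤ C₁ * δ := by
    have h1 := hWs (1 / Real.log τ) (Real.log (Real.log τ)) (by
      rw [hv, legendrePoint]; congr 1; ring)
    have h2 : ∑ n ∈ Finset.range (N + 1),
        (𝔞 n).eval (Real.log (Real.log τ)) * (1 / Real.log τ) ^ n = Q := by
      refine Finset.sum_congr rfl fun n _ => ?_
      rw [one_div, inv_pow, div_eq_mul_inv]
    rw [h2] at h1
    refine h1.trans ?_
    gcongr
    linarith only [hδeq, hYnn]
  obtain ⟨hSQ1, hSQ2⟩ := abs_le.mp hSQ
  have hwη : |w - legendreCenter σ| ≤ η / 2 := hW1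
  obtain ⟨hw1, hw2⟩ := abs_le.mp hwη
  have hclose {h : ℝ} (h0 : |h| ≤ η / 2) : |w + h - legendreCenter σ| ≤ η := by
    obtain ⟨h3, h4⟩ := abs_le.mp h0
    rw [abs_le]; constructor <;> linarith only [hw1, hw2, h3, h4]
  obtain ⟨hp, hm⟩ := hJ w (by linarith only [hwη, hη, hη1])
  rw [← hS] at hm
  have hc₀1 : Cb ≤ c₀ := by linarith only [hc₀, hCb0, hA0, hK0, hCc0]
  have hc₀2 : A ≤ c₀ := by linarith only [hc₀, hCb0, hA0, hK0, hCc0]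
  have hc₀3 : (K + 2) / δ₀ ≤ c₀ := by linarith only [hc₀, hCb0, hA0, hK0, hCc0]
  have hc₀4 : Cc ≤ c₀ := by linarith only [hc₀, hCb0, hA0, hK0, hCc0]
  have hc₀0 : 0 < c₀ := by linarith only [hc₀, hCb0, hA0, hK0, hCc0]
  refine ⟨hT0, hτ0, hV0, by positivity, ?_, ?_⟩
  · refine (PhiShort_le_exp hσ0 hT0 hτ0 hV0.le hp hm).trans (Real.exp_le_exp.mpr ?_)
    have h1 : Q - c₀ * δ ≤ S - C₂ * δ ^ 2 := by
      have h2 : Cb * δ ≤ c₀ * δ := by gcongr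
      have h3 : C₂ * δ ^ 2 ≤ C₂ * (2 * δ) := by gcongr
      have h4 : 0 ≤ A * κ * δ := by positivity
      rw [hCb] at h2
      linarith only [h2, h3, h4, hSQ1, hSQ2, hδ0, mul_pos hA0 hδ0]
    have h2 := mul_le_mul_of_nonneg_left h1 hV0.le
    linarith only [h2]
  rcases le_or_gt δ δ₀ with hδδ | hδδ
  · -- the tilting argument
    set r := A * δ with hr
    have hr0 : 0 < r := by positivity
    set h := r * b / (2 * B) with hh
    have hh0 : 0 < h := by positivity
    have hhη : h ≤ η / 2 := by
      rw [hh, div_le_iff₀ (by positivity)]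
      calc r * b = δ * (A * b) := by rw [hr]; ring
        _ ≤ δ₀ * (A * b) := by gcongr
        _ = η / 2 * (2 * B) := by rw [hδ₀]; field_simp
    have hc1 : |w - h - legendreCenter σ| ≤ η := by
      have := hclose (h := -h) (by rw [abs_neg, abs_of_pos hh0]; exact hhη)
      rwa [← sub_eq_add_neg] at this
    have hc2 : |w + h - legendreCenter σ| ≤ η := hclose (by rw [abs_of_pos hh0]; exact hhη)
    obtain ⟨hp₁, hm₁⟩ := hJ (w - h) (by linarith only [hc1, hη1])
    obtain ⟨hp₂, hm₂⟩ := hJ (w + h) (by linarith only [hc2, hη1])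
    have hS₁ := hWq (w - h) hc1
    have hS₂ := hWq (w + h) hc2
    rw [show w - h - w = -h by ring, neg_sq] at hS₁
    rw [show w + h - w = h by ring] at hS₂
    have hexp {x : ℝ} (hx : |x - legendreCenter σ| ≤ η) :
        κ⁻¹ ≤ Real.exp (σ * x) ∧ Real.exp (σ * x) ≤ κ := by
      have h1 : |x| ≤ |legendreCenter σ| + 1 := by
        have h2 := abs_add_le (x - legendreCenter σ) (legendreCenter σ)
        rw [sub_add_cancel] at h2
        linarith only [h2, hx, hη1]
      have h2 : |σ * x| ≤ |legendreCenter σ| + 1 := by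
        rw [abs_mul, abs_of_pos hσ0]
        exact (mul_le_of_le_one_left (abs_nonneg x) hσ1.le).trans h1
      obtain ⟨h3, h4⟩ := abs_le.mp h2
      rw [hκ, ← Real.exp_neg]
      exact ⟨Real.exp_le_exp.mpr h3, Real.exp_le_exp.mpr h4⟩
    have hstep {x : ℝ} (hx : |x - legendreCenter σ| ≤ η) :
        b * h ≤ Real.exp (σ * (x + h)) - Real.exp (σ * x) := by
      have h1 : Real.exp (σ * (x + h)) = Real.exp (σ * x) * Real.exp (σ * h) := by
        rw [← Real.exp_add]; congr 1; ring
      have h2 := Real.add_one_le_exp (σ * h)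
      have h3 := (hexp hx).1
      calc b * h = κ⁻¹ * (σ * h) := by rw [hb]; ring
        _ ≤ Real.exp (σ * x) * (Real.exp (σ * h) - 1) := by
          gcongr; linarith only [h2]
        _ = _ := by rw [h1]; ring
    have hd₁ := hstep hc1
    rw [sub_add_cancel] at hd₁
    have hd₂ := hstep (x := w) (by linarith only [hwη, hη])
    have hgain : B * h ^ 2 - r * (b * h) ≤ -((2 * C₂ + 2) * δ ^ 2) := by
      have e : B * h ^ 2 - r * (b * h) = -((A * b) ^ 2 / (4 * B) * δ ^ 2) := by
        rw [hh, hr]; field_simp; ring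
      rw [e, neg_le_neg_iff]
      gcongr
      rw [le_div_iff₀ (by positivity), hAb]
      nlinarith only [sq_nonneg (B - (2 * C₂ + 2))]
    have hfin {S' d : ℝ} (hS' : S - B * h ^ 2 ≤ S') (hd : b * h ≤ d) :
        V * (S - S' - r * d) + 2 * (C₂ * (V * δ ^ 2)) ≤ -2 := by
      have h1 : r * (b * h) ≤ r * d := by gcongr
      have h2 : S - S' - r * d ≤ -((2 * C₂ + 2) * δ ^ 2) := by linarith only [hS', h1, hgain]
      have h3 := mul_le_mul_of_nonneg_left h2 hV0.le
      linarith only [h3, hVδ]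
    have hlow := exp_le_PhiShort hσ0 hT0 hτ0 hV0.le hh0.le hp hp₁ hp₂ hm hm₁ hm₂
      (hfin hS₁ hd₁) (hfin hS₂ hd₂)
    have hanti : PhiShort σ T ((1 - r) * τ) y ≤ PhiShort σ T ((1 - c₀ * δ) * τ) y := by
      refine PhiShort_anti hT0 ?_
      have : r ≤ c₀ * δ := by rw [hr]; gcongr
      gcongr
    refine le_trans (Real.exp_le_exp.mpr ?_) (hlow.trans hanti)
    have h1 : r * Real.exp (σ * w) ≤ r * κ := by
      gcongr
      exact (hexp (x := w) (by linarith only [hwη, hη])).2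
    have h2 : S + r * Real.exp (σ * w) + (C₂ + 1) * δ ^ 2 ≤ Q + c₀ * δ := by
      have h3 : Cb * δ ≤ c₀ * δ := by gcongr
      have h4 : (C₂ + 1) * δ ^ 2 ≤ (C₂ + 1) * (2 * δ) := by gcongr
      have h5 : Cb * δ = C₁ * δ + r * κ + (C₂ + 1) * (2 * δ) := by rw [hCb, hr]; ring
      linarith only [h1, h3, h4, h5, hSQ2]
    have h3 := mul_le_mul_of_nonneg_left h2 hV0.le
    linarith only [h3, hVδ]
  · -- here `y` is of the order of `(τ log τ) ^ (1 / (1 - σ))`, and the event is certain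
    have hY : δ₀ / 2 ≤ (primeScale σ τ / y) ^ (σ - 1 / 2) := by
      have h1 : ‖v‖ ^ (N + 1) ≤ δ₀ / 2 := by
        have h2 : ‖v‖ < 1 := hnorm.trans_le (min_le_left _ _)
        have h3 : ‖v‖ < δ₀ / 2 := hnorm.trans_le (min_le_right _ _)
        calc ‖v‖ ^ (N + 1) ≤ ‖v‖ ^ 1 := pow_le_pow_of_le_one (norm_nonneg v) h2.le (by omega)
          _ ≤ _ := by rw [pow_one]; exact h3.le
      linarith only [h1, hδeq, hδδ]
    have hκy : κ₀ ≤ primeScale σ τ / y := by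
      have h1 : 0 < σ - 1 / 2 := by linarith only [hσ]
      calc κ₀ ≤ ((primeScale σ τ / y) ^ (σ - 1 / 2)) ^ (1 / (σ - 1 / 2)) := by rw [hκ₀]; gcongr
        _ = _ := by
          rw [← Real.rpow_mul (by positivity), mul_one_div_cancel h1.ne', Real.rpow_one]
    have hcδ : K + 2 ≤ c₀ * δ := by
      calc K + 2 = (K + 2) / δ₀ * δ₀ := by field_simp
        _ ≤ c₀ * δ := by gcongr
    have hone : PhiShort σ T ((1 - c₀ * δ) * τ) y = 1 := by
      refine PhiShort_eq_one hT0 fun t => lt_of_lt_of_le ?_ (htriv τ y t hτ1 hL hy2 hLy hκy)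
      have := mul_le_mul_of_nonneg_right hcδ hτ0.le
      linarith only [this, hτ0]
    rw [hone, Real.exp_le_one_iff]
    have h1 : Cc * δ ≤ c₀ * δ := by gcongr
    have h2 : |leadingConst σ| + 1 ≤ (|leadingConst σ| + 1) / δ₀ * δ := by
      calc |leadingConst σ| + 1 = (|leadingConst σ| + 1) / δ₀ * δ₀ := by field_simp
        _ ≤ _ := by gcongr
    have h3 : Cc * δ = C₁ * δ + (|leadingConst σ| + 1) / δ₀ * δ := by rw [hCc]; ring
    have h4 := neg_abs_le (leadingConst σ)
    have h5 : 0 ≤ Q + c₀ * δ := by linarith only [h1, h2, h3, h4, hWlow, hSQ2]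
    have := mul_nonneg hV0.le h5
    linarith only [this]

end

theorem proposition4p1 :
    -- the absolute implied constant of the term `O(ε₀)`
    ∃ K : ℝ, 0 < K ∧
    ∀ σ : ℝ, 1 / 2 < σ → σ < 1 →
    -- the polynomials and the constant `c(σ)` depend on `σ` only
    ∃ (𝔞 : ℕ → Polynomial ℝ) (c : ℝ),
      (∀ n, (𝔞 n).natDegree ≤ n) ∧
      𝔞 0 = Polynomial.C (leadingConst σ) ∧
      0 < c ∧
      ∀ N : ℕ, 1 ≤ N →
      -- thresholds depending on `σ` and `N`, the first one for the large constant `c₀`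
      ∃ C τ₀ T₀ : ℝ, 0 < C ∧
        ∀ c₀ : ℝ, C ≤ c₀ →
        ∀ T y τ : ℝ, T₀ ≤ T →
          Real.log T ≤ y → y ≤ Real.log T ^ 2 →
          τ₀ ≤ τ →
          τ ≤ c / Real.log (Real.log T)
              * (Real.log T / y ^ (1 - σ)) ^ ((1 - σ) / σ) →
          -- `θ` is the term `O(ε₀)`
          ∃ θ : ℝ, |θ| ≤ K * epsZero σ N c₀ τ y ∧
            PhiShort σ T ((1 + epsZero σ N c₀ τ y) * τ) y
              ≤ Real.exp (-((τ * Real.log τ ^ σ) ^ (1 / (1 - σ))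
                  * (∑ n ∈ Finset.range (N + 1),
                      (𝔞 n).eval (Real.log (Real.log τ)) / Real.log τ ^ n + θ))) ∧
            Real.exp (-((τ * Real.log τ ^ σ) ^ (1 / (1 - σ))
                  * (∑ n ∈ Finset.range (N + 1),
                      (𝔞 n).eval (Real.log (Real.log τ)) / Real.log τ ^ n + θ)))
              ≤ PhiShort σ T ((1 - epsZero σ N c₀ τ y) * τ) y := by
  refine ⟨1, one_pos, fun σ hσ hσ1 => ?_⟩
  obtain ⟨𝔞, c, hdeg, h0, hc, H⟩ := exists_PhiShort_bounds hσ hσ1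
  refine ⟨𝔞, c, hdeg, h0, hc, fun N _ => ?_⟩
  obtain ⟨C, τ₀, T₀, hC, h⟩ := H N
  refine ⟨C, τ₀, T₀, hC, fun c₀ hc₀ T y τ hT hTy hyT hτ hτc => ?_⟩
  obtain ⟨hT0, hτ0, hV, hε, hup, hlow⟩ := h c₀ hc₀ T y τ hT hTy hyT hτ hτc
  rw [epsZero_eq]
  have h1 : τ ≤ (1 + c₀ * errScale σ N τ y) * τ := by
    have := mul_nonneg hε hτ0.le
    linarith
  have h2 : (1 - c₀ * errScale σ N τ y) * τ ≤ τ := by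
    have := mul_nonneg hε hτ0.le
    linarith
  exact exists_error_term hV hε ((PhiShort_anti hT0 h1).trans hup) hlow
    (PhiShort_anti hT0 (h2.trans h1))
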